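/- Let $S$ be a compact connected surface, possibly with boundary, with a finite polygonal cellular decomposition with vertex set $V$ and face set $F$: a finite simple graph embedded in $S$ such that each boundary component of $S$ contains a vertex and is a union of edges, each vertex meets at least three edges, and each face (connected component of the complement of the graph) has closure homeomorphic to a closed disk and is bounded by a simple closed curve consisting of edges. For a face $P$ let $N(P)$ be its number of vertices; for $W\subset V$ let $F_W$ be the set of faces having a vertex in $W$ and $N(P,W)$ the number of vertices of $P$ lying in $W$. For $k\in\mathbb R_+^V$ (all coordinates positive), the generalized circle packing metric with geodesic curvatures $k$ is obtained as follows. For each face $P=i_1\cdots i_m$ take generalized circles (circles, horocycles or hypercycles) $C_{i_1},\dots,C_{i_m}$ in the hyperbolic plane with geodesic curvatures $k_{i_1},\dots,k_{i_m}$, bounding pairwise disjoint open generalized disks (on their convex sides), such that $C_i$ and $C_j$ are tangent if $ij$ is an edge of $P$ and disjoint otherwise, and such that some hyperbolic circle $C_P$ is perpendicular to all of them at the tangent points. Then glue the resulting generalized polygons along their edges. The total geodesic curvature $L_i=L_i(k)$ at a vertex $i$ is the sum, over the faces $P$ containing $i$, of the integral of the geodesic curvature over the sub-arc of $C_i$ lying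 in the generalized polygon of $P$, i.e. the sub-arc between its two tangent points that is enclosed by $C_P$. Put $$\mathcal L=\Big\{L\in\mathbb R_+^V:\ \sum_{w\in W}L_w<\sum_{P\in F_W}\pi\min\{N(P,W),\,N(P)-2\}\ \text{ for each nonempty } W\subset V\Big\}.$$ Let $\hat L\in\mathbb R^V$. For every initial value $k(0)\in\mathbb R_+^V$ the combinatorial Ricci flow $$\frac{dk_i}{dt}=-(L_i(k)-\hat L_i)\,k_i,\qquad i\in V,$$ has a solution $k:[0,\infty)\to\mathbb R_+^V$, and every such solution converges, as $t\to\infty$, to a point of $\mathbb R_+^V$ if and only if $\hat L\in\mathcal L$. Moreover, if it converges, then there is exactly one $k^*\in\mathbb R_+^V$ whose generalized circle packing metric has total geodesic curvatures $\hat L$, and there are constants $C,c>0$ with $|k_i(t)-k_i^*|\le C e^{-ct}$ for all $t\ge0$ and $i\in V$. -/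

import Mathlib

open Set Filter Topology MeasureTheory UpperHalfPlane
open scoped Manifold

/-! ### Generalized circles in the hyperbolic plane -/

/-- Open hyperbolic half-planes of the upper half-plane model: the two sides of a geodesic, which is
either a vertical line or a Euclidean half-circle centred on the real axis. -/
def IsHalfPlane (H : Set ℍ) : Prop :=
  ∃ x : ℝ, H = {z : ℍ | z.re < x} ∨ H = {z : ℍ | x < z.re} ∨
    ∃ ρ : ℝ, 0 < ρ ∧
      (H = {z : ℍ | dist (z : ℂ) (x : ℂ) < ρ} ∨ H = {z : ℍ | ρ < dist (z : ℂ) (x : ℂ)})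

/-- `IsGeneralizedCircle k C D`: the set `C` is a generalized circle of the hyperbolic plane of
geodesic curvature `k > 0`, and `D` is the open generalized disk that it bounds on its convex side.
* a circle of radius `r` has geodesic curvature `coth r`;
* a horocycle has geodesic curvature `1`; in the upper half-plane it is a horizontal line or a
  Euclidean circle tangent to the real axis;
* a hypercycle of radius `r`, i.e. one component of the set of points at distance `r` from a
  geodesic `γ`, has geodesic curvature `tanh r`.  If `H` is the side of `γ` not containing that
  component, the component is the set of points at distance `r` from `H`. -/
inductive IsGeneralizedCircle : ℝ → Set ℍ → Set ℍ → Prop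
  | circle (w : ℍ) (r : ℝ) (hr : 0 < r) :
      IsGeneralizedCircle (Real.cosh r / Real.sinh r) (Metric.sphere w r) (Metric.ball w r)
  | horocycleLine (h : ℝ) (hh : 0 < h) :
      IsGeneralizedCircle 1 {z : ℍ | z.im = h} {z : ℍ | h < z.im}
  | horocycleCircle (x ρ : ℝ) (hρ : 0 < ρ) :
      IsGeneralizedCircle 1 {z : ℍ | dist (z : ℂ) ⟨x, ρ⟩ = ρ} {z : ℍ | dist (z : ℂ) ⟨x, ρ⟩ < ρ}
  | hypercycle (H : Set ℍ) (hH : IsHalfPlane H) (r : ℝ) (hr : 0 < r) :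
      IsGeneralizedCircle (Real.tanh r)
        {z : ℍ | Metric.infDist z H = r} {z : ℍ | Metric.infDist z H < r}

/-- `v` is the velocity at `t` of a curve that stays in `C`. -/
def IsTangentVector (C : Set ℍ) (t : ℍ) (v : ℂ) : Prop :=
  ∃ γ : ℝ → ℍ, γ 0 = t ∧ (∀ s, γ s ∈ C) ∧ HasDerivAt (fun s => (γ s : ℂ)) v 0

/-- The curves `C` and `C'` are tangent at `t`: they have a common tangent direction there. -/
def TangentAt (C C' : Set ℍ) (t : ℍ) : Prop :=
  t ∈ C ∧ t ∈ C' ∧ ∃ v : ℂ, v ≠ 0 ∧ IsTangentVector C t v ∧ IsTangentVector C' t v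

/-- The curves `C` and `C'` are perpendicular at `t` (the upper half-plane model is conformal, so
hyperbolic angles are Euclidean angles). -/
def PerpendicularAt (C C' : Set ℍ) (t : ℍ) : Prop :=
  t ∈ C ∧ t ∈ C' ∧ ∃ v w : ℂ, v ≠ 0 ∧ w ≠ 0 ∧
    IsTangentVector C t v ∧ IsTangentVector C' t w ∧ inner ℝ v w = 0

/-! ### Generalized circle packings of a polygon -/

/-- A generalized circle packing of an abstract polygon with `n` vertices, where the circle at the
`i`-th vertex has geodesic curvature `k i`.  The abstract polygon is the cyclic graph on `Fin n`. -/
structure PolygonPacking (n : ℕ) (k : Fin n → ℝ) where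
  /-- the generalized circles -/
  circle : Fin n → Set ℍ
  /-- the open generalized disks bounded by them -/
  disk : Fin n → Set ℍ
  isGeneralizedCircle : ∀ i, IsGeneralizedCircle (k i) (circle i) (disk i)
  disjoint_disk : ∀ i j, i ≠ j → Disjoint (disk i) (disk j)
  tangent_of_meet : ∀ i j, i ≠ j → (circle i ∩ circle j).Nonempty →
    ∃ t, TangentAt (circle i) (circle j) t
  tangent_iff_adj : ∀ i j, i ≠ j →
    ((∃ t, TangentAt (circle i) (circle j) t) ↔ (SimpleGraph.cycleGraph n).Adj i j)
  /-- the centre of the dual circle `C_P` -/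
  center : ℍ
  /-- the radius of the dual circle `C_P` -/
  radius : ℝ
  radius_pos : 0 < radius
  /-- `C_P` is perpendicular to all the circles at the tangent points -/
  perpendicular : ∀ i j t, i ≠ j → TangentAt (circle i) (circle j) t →
    PerpendicularAt (Metric.sphere center radius) (circle i) t

/-- The sub-arc of the `i`-th generalized circle that lies in the generalized polygon.  The sides of
the generalized polygon are the geodesics through the tangent points perpendicular to the circles of
the packing, so they are tangent to the dual circle there, and this sub-arc is the part of the
`i`-th circle between its two tangent points enclosed by the dual circle. -/
def PolygonPacking.arc {n : ℕ} {k : Fin n → ℝ} (Q : PolygonPacking n k) (i : Fin n) : Set ℍ :=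
  Q.circle i ∩ Metric.closedBall Q.center Q.radius

/-- The total geodesic curvature of the `i`-th arc: the integral of the geodesic curvature of the
`i`-th circle along the arc, with respect to hyperbolic arc length (one-dimensional Hausdorff
measure of the hyperbolic metric). -/
noncomputable def PolygonPacking.totalCurvature {n : ℕ} {k : Fin n → ℝ}
    (Q : PolygonPacking n k) (i : Fin n) : ℝ :=
  ∫ _z in Q.arc i, k i ∂(Measure.hausdorffMeasure 1 : Measure ℍ)

/-! ### Finite polygonal cellular decompositions of a surface with boundary -/

/-- A finite polygonal cellular decomposition of a surface with boundary `S`, with vertices indexed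
by the finite type `V` and faces indexed by the finite type `F`: a simple graph embedded in `S`,
inducing a closed 2-cell embedding. -/
structure PolygonalDecomposition (S : Type*) [TopologicalSpace S]
    [ChartedSpace (EuclideanHalfSpace 2) S] (V F : Type*) [Fintype V] [Fintype F] where
  /-- the 1-skeleton as an abstract graph, without loops and double edges -/
  graph : SimpleGraph V
  /-- the embedding of the vertices -/
  point : V → S
  point_injective : Function.Injective point
  /-- the embedded edges -/
  edge : graph.edgeSet → Set S
  /-- an edge `uv` is a simple arc from `u` to `v` -/
  edge_arc : ∀ (u v : V) (h : s(u, v) ∈ graph.edgeSet), ∃ γ : C(unitInterval, S),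
    Function.Injective γ ∧ γ 0 = point u ∧ γ 1 = point v ∧ range γ = edge ⟨s(u, v), h⟩
  /-- an edge contains no vertices besides its endpoints -/
  mem_of_point_mem_edge : ∀ (v : V) (e : graph.edgeSet), point v ∈ edge e → v ∈ (e : Sym2 V)
  /-- two edges meet only in vertices -/
  edge_inter : ∀ e e' : graph.edgeSet, e ≠ e' → edge e ∩ edge e' ⊆ range point
  /-- every boundary component contains a vertex -/
  boundary_vertex : ∀ x ∈ (𝓡∂ 2).boundary S,
    ∃ v, point v ∈ connectedComponentIn ((𝓡∂ 2).boundary S) x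
  /-- every boundary component is a union of edges -/
  boundary_edges : ∀ x ∈ (𝓡∂ 2).boundary S, ∃ B : Set graph.edgeSet,
    connectedComponentIn ((𝓡∂ 2).boundary S) x = ⋃ e ∈ B, edge e
  /-- every vertex meets at least three edges -/
  three_le_degree : ∀ v, 3 ≤ (graph.neighborSet v).ncard
  /-- the faces -/
  face : F → Set S
  face_injective : Function.Injective face
  /-- the faces are the connected components of the complement of the vertices and edges -/
  range_face : range face =
    {P | ∃ x ∈ (range point ∪ ⋃ e, edge e)ᶜ,
      P = connectedComponentIn (range point ∪ ⋃ e, edge e)ᶜ x}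
  /-- the closure of each face is homeomorphic to a closed disk -/
  closure_face : ∀ f, Nonempty (closure (face f) ≃ₜ Metric.closedBall (0 : ℂ) 1)
  /-- the number of vertices of a face -/
  size : F → ℕ
  three_le_size : ∀ f, 3 ≤ size f
  /-- the vertices of a face, in cyclic order -/
  corner : (f : F) → Fin (size f) → V
  corner_injective : ∀ f, Function.Injective (corner f)
  corner_adj : ∀ f i j, (SimpleGraph.cycleGraph (size f)).Adj i j →
    graph.Adj (corner f i) (corner f j)
  /-- each face `i₁ i₂ ⋯ iₘ` is bounded by the simple closed curve with edges
  `i₁i₂, i₂i₃, …, iₘi₁` -/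
  frontier_face : ∀ f, frontier (face f) =
    ⋃ (e : graph.edgeSet) (_ : ∃ i j, (SimpleGraph.cycleGraph (size f)).Adj i j ∧
      (e : Sym2 V) = s(corner f i, corner f j)), edge e

namespace PolygonalDecomposition

variable {S : Type*} [TopologicalSpace S] [ChartedSpace (EuclideanHalfSpace 2) S]
  {V F : Type*} [Fintype V] [Fintype F]

open Classical in
/-- `F_W`: the faces having at least one vertex in `W`. -/
noncomputable def facesMeeting (D : PolygonalDecomposition S V F) (W : Finset V) : Finset F :=
  Finset.univ.filter fun f => ∃ v ∈ W, v ∈ range (D.corner f)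

open Classical in
/-- `N(P, W)`: the number of vertices of the face `P` that belong to `W`. -/
noncomputable def cornersIn (D : PolygonalDecomposition S V F) (f : F) (W : Finset V) : ℕ :=
  (W.filter fun v => v ∈ range (D.corner f)).card

/-- The set `𝓛` of positive vectors `L` such that, for each nonempty set `W` of vertices,
`∑_{w ∈ W} L_w < ∑_{P ∈ F_W} π min {N(P, W), N(P) - 2}`. -/
def admissible (D : PolygonalDecomposition S V F) : Set (V → ℝ) :=
  {L | (∀ i, 0 < L i) ∧ ∀ W : Finset V, W.Nonempty →
    ∑ w ∈ W, L w <
      ∑ f ∈ D.facesMeeting W, Real.pi * min (D.cornersIn f W : ℝ) ((D.size f : ℝ) - 2)}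

/-- A generalized circle packing metric on the surface with geodesic curvatures `k`: for each face
a generalized circle packing with the prescribed geodesic curvatures at its vertices.  The metric is
obtained by gluing the resulting generalized polygons along their edges. -/
def PackingMetric (D : PolygonalDecomposition S V F) (k : V → ℝ) : Type _ :=
  (f : F) → PolygonPacking (D.size f) (fun j => k (D.corner f j))

open Classical in
/-- The total geodesic curvature `L_i` at the vertex `i`: the sum of the total geodesic curvatures
of the arcs, in the faces around `i`, which make up the generalized circle at `i`. -/
noncomputable def totalCurvature (D : PolygonalDecomposition S V F) {k : V → ℝ}
    (M : D.PackingMetric k) (i : V) : ℝ :=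
  ∑ f, ∑ j, if D.corner f j = i then (M f).totalCurvature j else 0

/-- `k : [0, ∞) → ℝ₊^V` solves the combinatorial Ricci flow `dk_i/dt = -(L_i - L̂_i) k_i` with
initial value `k0`, where `L_i` is the total geodesic curvature at `i` of the generalized circle
packing metric with geodesic curvatures `k t`. -/
structure IsRicciFlow (D : PolygonalDecomposition S V F) (Lhat k0 : V → ℝ) (k : ℝ → V → ℝ) :
    Prop where
  initial : k 0 = k0
  pos : ∀ t, 0 ≤ t → ∀ i, 0 < k t i
  ode : ∀ t, 0 ≤ t → ∃ M : D.PackingMetric (k t), ∀ i,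
    HasDerivWithinAt (fun s => k s i) (-(D.totalCurvature M i - Lhat i) * k t i) (Ici 0) t

end PolygonalDecomposition

/-- The curve `k` converges, as `t → ∞`, in the space `ℝ₊^V` of geodesic curvatures. -/
def ConvergesInPos {V : Type*} (k : ℝ → V → ℝ) : Prop :=
  ∃ kinf : V → ℝ, (∀ i, 0 < kinf i) ∧ Tendsto k atTop (𝓝 kinf)

/-!
# The combinatorial Ricci flow of generalized circle packings

The flow is the gradient flow of a convex function in the coordinates `x i = log (k i)`, and the
gradient of this function, the total geodesic curvature, maps `ℝ^V` bijectively onto the admissible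
vectors.

**Packings of a polygon.** In the upper half-plane a generalized circle of curvature `k` is the zero
set of a quadratic form (`circleForm`) of determinant `k² - 1`. In hyperboloid coordinates around the
centre of the dual circle, a circle perpendicular to the dual circle of radius `r` is given by a form
`perpForm` that depends only on `k`, `r` and a direction, and its disk meets the dual circle in an arc
of half-length `halfAngle k r`. In a packing these arcs fill the dual circle, so the half-angles add up
to `π` (`PolygonPacking.sum_halfAngle`). Conversely, arcs with this sum can be placed side by side, and
the circles through their endpoints form a packing (`exists_polygonPacking`). As the half-angles
decrease with `r`, this determines `r`. The total curvature of the part of a circle inside the dual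
circle is `arcCurvature k r` (`PolygonPacking.totalCurvature_eq`), whatever packing is chosen. It is
found from a rational parametrization and the formula `hausdorffMeasure_image_Icc_eq_integral` for the
one-dimensional Hausdorff measure of a curve.

**Monotonicity.** Replace `r` by `σ` with `sinh σ sinh r = 1`. In the variables `x = log k` and `σ`,
the total curvature and twice the half-angle are the two partial derivatives of a convex function, and
its Hessian exceeds a semidefinite form by a positive multiple of `dx²`. This is `logCurvature_monotone`.
On a face the angle sum is constant, so the terms with `σ` cancel when this is added up over the
corners, and the total curvatures `L(x)` (`curvatureMap`) are strongly monotone in `x` on bounded sets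
(`exists_curvatureMap_monotone`). They are also bounded and globally Lipschitz.

**The flow.** In the coordinates `x` the flow is `x' = -(L(x) - L̂)`. Its vector field is bounded and
Lipschitz, so solutions exist for all times (`exists_isRicciFlow`). If a solution converges, its limit
solves `L(x) = L̂` (`IsRicciFlow.curvatureMap_eq_of_tendsto`); such a point is unique by monotonicity, and
if it exists, every solution converges to it exponentially (`IsRicciFlow.exists_exponential_decay`).

**The image of `L`.** It remains to see that `L(x) = L̂` has a solution exactly if `L̂` is admissible.
The inequalities hold for every `L(x)`, because the total curvature of an arc is less than `π`, and the
sum over all the arcs of a face `P` is less than `π (N(P) - 2)` by the Gauss–Bonnet inequality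
(`sum_faceCurvature_lt_min`). Their strictness and the positivity of `L(x)` need a face at every vertex,
which is a topological fact, namely that arcs in a surface have empty interior
(`PolygonalDecomposition.exists_corner_eq`). For the converse (`exists_curvatureMap_eq`), the strongly
monotone equations `L(x) + ε x = L̂` are solvable for `ε > 0`. Their solutions stay bounded as `ε → 0`:
a coordinate cannot tend to `-∞`, where `L` tends to `0`, and if the coordinates in a nonempty set `W`
tended to `+∞` while the others stayed bounded above, then the sum of `L` over `W` would tend to the
bound in the definition of admissibility (`exists_le_sum_curvatureMap`), but the sum of `L̂` is smaller.
-/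

/-! ### Normal form of generalized circles -/

/-- The quadratic polynomial `a|z|² + b Re z + c - 2 k Im z` at a point of the upper half-plane.
Generalized circles of geodesic curvature `k` are its zero sets under the normalization
`4ac - b² = 4(k² - 1)`; for `k = 0` these are the geodesics, and the form is negative on a
half-plane. -/
def circleForm (a b c k : ℝ) (z : ℍ) : ℝ :=
  a * (z.re ^ 2 + z.im ^ 2) + b * z.re + c - 2 * k * z.im

lemma dist_coe_sq (z : ℍ) (w : ℂ) :
    dist (z : ℂ) w ^ 2 = (z.re - w.re) ^ 2 + (z.im - w.im) ^ 2 := by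
  rw [Complex.dist_eq, Complex.sq_norm, Complex.normSq_apply]
  simp; ring

lemma cosh_dist_eq (z w : ℍ) : Real.cosh (dist z w) =
    ((z.re - w.re) ^ 2 + z.im ^ 2 + w.im ^ 2) / (2 * z.im * w.im) := by
  rw [UpperHalfPlane.cosh_dist, dist_coe_sq]
  have := z.im_pos
  have := w.im_pos
  field_simp
  simp only [coe_re, coe_im]
  ring

/-- The point of the boundary of a half-plane nearest to a point outside it. -/
lemma exists_dist_eq_of_circleForm_pos {a b c : ℝ} (h : b ^ 2 - 4 * a * c = 4) (z : ℍ) {δ : ℝ}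
    (hδ : 0 ≤ δ) (hz : circleForm a b c 0 z = 2 * z.im * Real.sinh δ) :
    ∃ w : ℍ, circleForm a b c 0 w = 0 ∧ dist z w = δ := by
  have hy := z.im_pos
  set f := Real.sinh δ with hf
  have hC2 : 1 + f ^ 2 = Real.cosh δ ^ 2 := by rw [Real.cosh_sq]; ring
  have hCpos := Real.cosh_pos δ
  unfold circleForm at hz
  -- the height of the foot of the perpendicular, up to the factor `cosh δ`
  have hE : 1 / z.im + f * a = (1 + (a * z.re + b / 2) ^ 2 + a ^ 2 * z.im ^ 2) / (2 * z.im) := by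
    have : f = (a * (z.re ^ 2 + z.im ^ 2) + b * z.re + c) / (2 * z.im) := by
      field_simp; linarith
    rw [this]; field_simp; linear_combination -h
  set E := 1 / z.im + f * a with hEdef
  have hEpos : 0 < E := by rw [hE]; positivity
  have hyE : z.im * E = 1 + f * a * z.im := by rw [hEdef]; field_simp
  refine ⟨⟨⟨(z.re / z.im - f * b / 2) / E, Real.cosh δ / E⟩, by simp; positivity⟩, ?_, ?_⟩
  · unfold circleForm
    simp only [mk_re, mk_im]
    have h1 : Real.cosh δ ^ 2 = 1 + f ^ 2 := hC2.symm
    have : a * (((z.re / z.im - f * b / 2) / E) ^ 2 + (Real.cosh δ / E) ^ 2)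
        + b * ((z.re / z.im - f * b / 2) / E) + c - 2 * 0 * (Real.cosh δ / E) =
        (a * ((z.re - f * b / 2 * z.im) ^ 2 + (1 + f ^ 2) * z.im ^ 2)
          + b * (z.re - f * b / 2 * z.im) * (z.im * E) + c * (z.im * E) ^ 2) / (z.im * E) ^ 2 := by
      field_simp
      rw [h1]; ring
    rw [this, hyE, div_eq_zero_iff]; left
    linear_combination hz - (a * f ^ 2 * z.im ^ 2 / 4 + f * z.im / 2) * h
  · have h0 : 0 ≤ dist z (⟨⟨(z.re / z.im - f * b / 2) / E, Real.cosh δ / E⟩,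
        by simp; positivity⟩ : ℍ) := dist_nonneg
    refine Real.cosh_strictMonoOn.injOn h0 hδ ?_
    rw [cosh_dist_eq]
    simp only [mk_re, mk_im]
    have h1 : Real.cosh δ ^ 2 = 1 + f ^ 2 := hC2.symm
    have : ((z.re - (z.re / z.im - f * b / 2) / E) ^ 2 + z.im ^ 2 + (Real.cosh δ / E) ^ 2)
        = ((z.re * (z.im * E) - (z.re - f * b / 2 * z.im)) ^ 2 + z.im ^ 2 * (z.im * E) ^ 2 +
          (1 + f ^ 2) * z.im ^ 2) / (z.im * E) ^ 2 := by
      field_simp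
      rw [h1]
    rw [this]
    have h2 : 2 * z.im * (Real.cosh δ / E) = 2 * z.im ^ 2 * Real.cosh δ / (z.im * E) := by
      field_simp
    rw [h2, div_div_div_eq, div_eq_iff (by positivity)]
    rw [show Real.cosh δ * ((z.im * E) ^ 2 * (2 * z.im ^ 2 * Real.cosh δ)) =
      (z.im * E) ^ 2 * (2 * z.im ^ 2 * (1 + f^2)) by rw [← h1]; ring]
    rw [show z.re * (z.im * E) - (z.re - f * b / 2 * z.im) =  z.re * (z.im * E - 1) + f * b / 2 * z.im by ring]
    rw [hyE]
    linear_combination (f * z.im^2 * (1+f * a* z.im) * f * a ) * hz + (f^2*z.im^2/4 * (1+f * a* z.im)) * h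

/-- For points `z = x + iy` and `w = X + iY`, at which a form has the values `2p` and `2q`, the
quantity `2 y Y cosh d(z, w) + 2 p q` times a positive factor is a sum of squares. This yields the lower
bound for the distance in `le_dist_of_circleForm`. -/
lemma coshDist_identity {a b c x y X Y p q : ℝ} (h : b ^ 2 - 4 * a * c = 4)
    (hz : 2 * p = a * (x ^ 2 + y ^ 2) + b * x + c)
    (hw : 2 * q = a * (X ^ 2 + Y ^ 2) + b * X + c) :
    (1 + a * p) * (1 + a * q) * ((x - X) ^ 2 + y ^ 2 + Y ^ 2 + 2 * p * q) =
      (y ^ 2 + p ^ 2) * (1 + a * q) ^ 2 + (Y ^ 2 + q ^ 2) * (1 + a * p) ^ 2 +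
        ((x - X) + a * (q * x - p * X) - (b / 2) * (p - q)) ^ 2 := by
  grind

/-- A point where the normalized form has the value `sinh δ` is at distance at least `δ` from the
half-plane. -/
lemma le_dist_of_circleForm {a b c : ℝ} (h : b ^ 2 - 4 * a * c = 4) (z w : ℍ) {δ : ℝ}
    (hδ : 0 ≤ δ) (hz : circleForm a b c 0 z = 2 * z.im * Real.sinh δ)
    (hw : circleForm a b c 0 w ≤ 0) : δ ≤ dist z w := by
  suffices Real.cosh δ ≤ Real.cosh (dist z w) by
    rwa [Real.cosh_le_cosh, abs_of_nonneg hδ, abs_of_nonneg dist_nonneg] at this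
  have hy := z.im_pos
  have hY := w.im_pos
  set p := circleForm a b c 0 z / 2 with hp
  set q := circleForm a b c 0 w / 2 with hq
  have hp' : 2 * p = a * (z.re ^ 2 + z.im ^ 2) + b * z.re + c := by
    rw [hp]; unfold circleForm; ring
  have hq' : 2 * q = a * (w.re ^ 2 + w.im ^ 2) + b * w.re + c := by
    rw [hq]; unfold circleForm; ring
  have hp0 : p = z.im * Real.sinh δ := by rw [hp, hz]; ring
  have hp1 : 0 ≤ p := hp0 ▸ mul_nonneg hy.le (Real.sinh_nonneg_iff.2 hδ)
  have hq1 : q ≤ 0 := by rw [hq]; linarith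
  have key := coshDist_identity h hp' hq'
  have e1 : 0 < 1 + a * p := by
    have : 2 * (1 + a * p) = 1 + (a * z.re + b / 2) ^ 2 + a ^ 2 * z.im ^ 2 := by
      linear_combination a * hp' - h / 4
    nlinarith [sq_nonneg (a * z.re + b / 2), sq_nonneg (a * z.im)]
  have e2 : 0 < 1 + a * q := by
    have : 2 * (1 + a * q) = 1 + (a * w.re + b / 2) ^ 2 + a ^ 2 * w.im ^ 2 := by
      linear_combination a * hq' - h / 4
    nlinarith [sq_nonneg (a * w.re + b / 2), sq_nonneg (a * w.im)]
  have hyp : z.im ^ 2 + p ^ 2 = (z.im * Real.cosh δ) ^ 2 := by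
    rw [hp0, mul_pow _ (Real.cosh δ), Real.cosh_sq]; ring
  rw [cosh_dist_eq, le_div_iff₀ (by positivity)]
  have hpq : p * q ≤ 0 := mul_nonpos_of_nonneg_of_nonpos hp1 hq1
  refine le_of_mul_le_mul_left ?_ (mul_pos e1 e2)
  have h3 : 0 ≤ (1 + a * p) * (1 + a * q) * (-(2 * p * q)) :=
    mul_nonneg (mul_pos e1 e2).le (by linarith)
  have h4 := sq_nonneg ((z.re - w.re) + a * (q * z.re - p * w.re) - (b / 2) * (p - q))
  have h5 := sq_nonneg (q * (1 + a * p))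
  have h6 := sq_nonneg (z.im * Real.cosh δ * (1 + a * q) - w.im * (1 + a * p))
  rw [hyp] at key
  generalize ((z.re - w.re) + a * (q * z.re - p * w.re) - (b / 2) * (p - q)) ^ 2 = X at *
  generalize 1 + a * p = e at *
  generalize 1 + a * q = e' at *
  generalize (z.re - w.re) ^ 2 + z.im ^ 2 + w.im ^ 2 = S at *
  linarith

lemma mem_closure_of_circleForm_eq_zero {a b c : ℝ} (h : b ^ 2 - 4 * a * c = 4) (w : ℍ)
    (hw : circleForm a b c 0 w = 0) : w ∈ closure {z : ℍ | circleForm a b c 0 z < 0} := by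
  have hy := w.im_pos
  -- move from `w` against the gradient of the form
  let u : ℝ → ℂ := fun ε => ⟨w.re - ε * (2 * a * w.re + b), w.im - ε * (2 * a * w.im)⟩
  have hu0 : u 0 = w := by apply Complex.ext <;> simp [u]
  have huc : Continuous u := by
    have : u = fun ε : ℝ => ((w.re - ε * (2 * a * w.re + b) : ℝ) : ℂ) +
        ((w.im - ε * (2 * a * w.im) : ℝ) : ℂ) * Complex.I := by
      ext ε; apply Complex.ext <;> simp [u]
    rw [this]; fun_prop
  have hpos : ∀ᶠ ε in 𝓝 (0 : ℝ), 0 < (u ε).im :=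
    (Complex.continuous_im.comp huc).continuousAt.tendsto.eventually_const_lt
      (by simpa only [Function.comp, hu0, coe_im] using hy)
  have hlt : ∀ᶠ ε in 𝓝 (0 : ℝ), a * ε < 1 := by
    have : ContinuousAt (fun ε : ℝ => a * ε) 0 := by fun_prop
    exact this.eventually_lt continuousAt_const (by simp)
  have ht : Tendsto (fun ε => ofComplex (u ε)) (𝓝[>] 0) (𝓝 w) := by
    rw [isEmbedding_coe.tendsto_nhds_iff]
    have h1 : Tendsto u (𝓝[>] 0) (𝓝 (w : ℂ)) := by
      rw [← hu0]; exact huc.continuousAt.tendsto.mono_left nhdsWithin_le_nhds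
    refine h1.congr' ?_
    filter_upwards [nhdsWithin_le_nhds hpos] with ε hε
    simp [ofComplex_apply_of_im_pos hε]
  refine mem_closure_of_tendsto ht ?_
  filter_upwards [nhdsWithin_le_nhds hpos, nhdsWithin_le_nhds hlt, self_mem_nhdsWithin]
    with ε h1 h2 h3
  rw [ofComplex_apply_of_im_pos h1]
  simp only [circleForm, mk_re, mk_im, u] at hw ⊢
  have h3' : (0 : ℝ) < ε := h3
  have : a * ((w.re - ε * (2 * a * w.re + b)) ^ 2 + (w.im - ε * (2 * a * w.im)) ^ 2) +
      b * (w.re - ε * (2 * a * w.re + b)) + c - 2 * 0 * (w.im - ε * (2 * a * w.im)) =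
      -4 * ε * (1 - a * ε) := by
    linear_combination (1 - 4*a*ε + 4*a^2*ε^2) * hw + (-ε + a * ε^2) * h
  rw [this]
  nlinarith

/-- The distance from a half-plane is the positive part of the `arsinh` of the normalized form. -/
lemma infDist_halfPlane {a b c : ℝ} (h : b ^ 2 - 4 * a * c = 4) (z : ℍ) :
    {z : ℍ | circleForm a b c 0 z < 0}.Nonempty ∧
    Metric.infDist z {z : ℍ | circleForm a b c 0 z < 0} =
      max 0 (Real.arsinh (circleForm a b c 0 z / (2 * z.im))) := by
  have hy := z.im_pos
  rcases lt_or_ge (circleForm a b c 0 z) 0 with hz | hz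
  · refine ⟨⟨z, hz⟩, ?_⟩
    rw [Metric.infDist_zero_of_mem (by exact hz), max_eq_left]
    rw [Real.arsinh_nonpos_iff]
    exact div_nonpos_of_nonpos_of_nonneg hz.le (by positivity)
  · set δ := Real.arsinh (circleForm a b c 0 z / (2 * z.im)) with hδ
    have hδ0 : 0 ≤ δ := Real.arsinh_nonneg_iff.2 (by positivity)
    have hz' : circleForm a b c 0 z = 2 * z.im * Real.sinh δ := by
      rw [hδ, Real.sinh_arsinh]; field_simp
    obtain ⟨w, hw, hd⟩ := exists_dist_eq_of_circleForm_pos h z hδ0 hz'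
    have hwc := mem_closure_of_circleForm_eq_zero h w hw
    have hne : {z : ℍ | circleForm a b c 0 z < 0}.Nonempty := closure_nonempty_iff.1 ⟨w, hwc⟩
    refine ⟨hne, ?_⟩
    rw [max_eq_right hδ0]
    apply le_antisymm
    · rw [← Metric.infDist_closure, ← hd]
      exact Metric.infDist_le_dist_of_mem hwc
    · rw [Metric.le_infDist hne]
      intro y hy
      exact le_dist_of_circleForm h z y hδ0 hz' (le_of_lt hy)

lemma infDist_halfPlane_eq_iff {a b c : ℝ} (h : b ^ 2 - 4 * a * c = 4) (z : ℍ) {r : ℝ}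
    (hr : 0 < r) : Metric.infDist z {z : ℍ | circleForm a b c 0 z < 0} = r ↔
      circleForm a b c 0 z = 2 * z.im * Real.sinh r := by
  have hy := z.im_pos
  rw [(infDist_halfPlane h z).2, ← Real.arsinh_sinh r]
  constructor
  · intro h1
    rcases max_cases 0 (Real.arsinh (circleForm a b c 0 z / (2 * z.im))) with h2 | h2
    · rw [h2.1, Real.arsinh_sinh] at h1; linarith
    · rw [h2.1, Real.arsinh_inj, div_eq_iff (by positivity)] at h1
      rw [h1, Real.arsinh_sinh]; ring
  · intro h1
    rw [Real.arsinh_sinh] at h1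
    rw [h1, mul_div_assoc, mul_comm, div_mul_cancel₀ _ (by positivity), Real.arsinh_sinh]
    exact max_eq_right hr.le

lemma infDist_halfPlane_lt_iff {a b c : ℝ} (h : b ^ 2 - 4 * a * c = 4) (z : ℍ) {r : ℝ}
    (hr : 0 < r) : Metric.infDist z {z : ℍ | circleForm a b c 0 z < 0} < r ↔
      circleForm a b c 0 z < 2 * z.im * Real.sinh r := by
  have hy := z.im_pos
  rw [(infDist_halfPlane h z).2, max_lt_iff]
  conv_lhs => rw [← Real.arsinh_sinh r, Real.arsinh_lt_arsinh, Real.arsinh_sinh]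
  rw [div_lt_iff₀ (by positivity), mul_comm (Real.sinh r)]
  exact and_iff_right hr

lemma IsHalfPlane.exists_circleForm {H : Set ℍ} (hH : IsHalfPlane H) :
    ∃ a b c : ℝ, b ^ 2 - 4 * a * c = 4 ∧ H = {z : ℍ | circleForm a b c 0 z < 0} := by
  obtain ⟨x, hx⟩ := hH
  rcases hx with rfl | rfl | ⟨ρ, hρ, rfl | rfl⟩
  · refine ⟨0, 2, -2 * x, by ring, ?_⟩
    ext z; simp only [circleForm, mem_ofPred_eq]
    constructor <;> intro h <;> linarith
  · refine ⟨0, -2, 2 * x, by ring, ?_⟩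
    ext z; simp only [circleForm, mem_ofPred_eq]
    constructor <;> intro h <;> linarith
  · refine ⟨1 / ρ, -2 * x / ρ, (x ^ 2 - ρ ^ 2) / ρ, by field_simp; ring, ?_⟩
    ext z
    rw [mem_ofPred_eq, mem_ofPred_eq, ← sq_lt_sq₀ dist_nonneg hρ.le, dist_coe_sq, circleForm]
    have : 1 / ρ * (z.re ^ 2 + z.im ^ 2) + -2 * x / ρ * z.re + (x ^ 2 - ρ ^ 2) / ρ - 2 * 0 * z.im
      = ((z.re - x) ^ 2 + z.im ^ 2 - ρ ^ 2) / ρ := by field_simp; ring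
    rw [this, div_lt_iff₀ hρ]
    simp
  · refine ⟨-1 / ρ, 2 * x / ρ, -(x ^ 2 - ρ ^ 2) / ρ, by field_simp; ring, ?_⟩
    ext z
    rw [mem_ofPred_eq, mem_ofPred_eq, ← sq_lt_sq₀ hρ.le dist_nonneg, dist_coe_sq, circleForm]
    have : -1 / ρ * (z.re ^ 2 + z.im ^ 2) + 2 * x / ρ * z.re + -(x ^ 2 - ρ ^ 2) / ρ - 2 * 0 * z.im
      = -((z.re - x) ^ 2 + z.im ^ 2 - ρ ^ 2) / ρ := by field_simp; ring
    rw [this, div_lt_iff₀ hρ]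
    simp

lemma circleForm_eq_cosh_dist (w z : ℍ) {r : ℝ} (hr : 0 < r) :
    circleForm (1 / (w.im * Real.sinh r)) (-2 * w.re / (w.im * Real.sinh r))
      ((w.re ^ 2 + w.im ^ 2) / (w.im * Real.sinh r)) (Real.cosh r / Real.sinh r) z =
      (2 * z.im / Real.sinh r) * (Real.cosh (dist z w) - Real.cosh r) := by
  have hs := Real.sinh_pos_iff.2 hr
  have := w.im_pos
  have := z.im_pos
  rw [cosh_dist_eq]; unfold circleForm; field_simp; ring

lemma sphere_eq_circleForm (w : ℍ) {r : ℝ} (hr : 0 < r) : Metric.sphere w r =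
    {z | circleForm (1 / (w.im * Real.sinh r)) (-2 * w.re / (w.im * Real.sinh r))
      ((w.re ^ 2 + w.im ^ 2) / (w.im * Real.sinh r)) (Real.cosh r / Real.sinh r) z = 0} := by
  have hs := Real.sinh_pos_iff.2 hr
  ext z
  have := z.im_pos
  rw [mem_ofPred_eq, circleForm_eq_cosh_dist w z hr, mul_eq_zero, or_iff_right (by positivity),
    sub_eq_zero, Metric.mem_sphere]
  exact ⟨fun h => by rw [h], fun h => Real.cosh_strictMonoOn.injOn dist_nonneg hr.le h⟩

lemma ball_eq_circleForm (w : ℍ) {r : ℝ} (hr : 0 < r) : Metric.ball w r =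
    {z | circleForm (1 / (w.im * Real.sinh r)) (-2 * w.re / (w.im * Real.sinh r))
      ((w.re ^ 2 + w.im ^ 2) / (w.im * Real.sinh r)) (Real.cosh r / Real.sinh r) z < 0} := by
  have hs := Real.sinh_pos_iff.2 hr
  ext z
  have := z.im_pos
  have h2 : 0 < 2 * z.im / Real.sinh r := by positivity
  rw [mem_ofPred_eq, circleForm_eq_cosh_dist w z hr, ← neg_pos, ← mul_neg, mul_pos_iff_of_pos_left h2,
    neg_sub, sub_pos, Real.cosh_lt_cosh, abs_of_nonneg dist_nonneg, abs_of_pos hr, Metric.mem_ball]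

lemma circleForm_eq_horocycle (x : ℝ) {ρ : ℝ} (hρ : 0 < ρ) (z : ℍ) :
    circleForm (1 / ρ) (-2 * x / ρ) (x ^ 2 / ρ) 1 z =
      (dist (z : ℂ) ⟨x, ρ⟩ ^ 2 - ρ ^ 2) / ρ := by
  rw [dist_coe_sq]; unfold circleForm; field_simp; ring

lemma horocycle_eq_circleForm (x : ℝ) {ρ : ℝ} (hρ : 0 < ρ) :
    {z : ℍ | dist (z : ℂ) ⟨x, ρ⟩ = ρ} =
      {z | circleForm (1 / ρ) (-2 * x / ρ) (x ^ 2 / ρ) 1 z = 0} := by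
  ext z
  rw [mem_ofPred_eq, mem_ofPred_eq, circleForm_eq_horocycle x hρ, div_eq_zero_iff,
    or_iff_left hρ.ne', sub_eq_zero, sq_eq_sq₀ dist_nonneg hρ.le]

lemma horodisk_eq_circleForm (x : ℝ) {ρ : ℝ} (hρ : 0 < ρ) :
    {z : ℍ | dist (z : ℂ) ⟨x, ρ⟩ < ρ} =
      {z | circleForm (1 / ρ) (-2 * x / ρ) (x ^ 2 / ρ) 1 z < 0} := by
  ext z
  rw [mem_ofPred_eq, mem_ofPred_eq, circleForm_eq_horocycle x hρ, div_lt_iff₀ hρ, zero_mul,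
    sub_neg, sq_lt_sq₀ dist_nonneg hρ.le]

lemma circleForm_eq_hypercycle (a b c r : ℝ) (z : ℍ) :
    circleForm (a / Real.cosh r) (b / Real.cosh r) (c / Real.cosh r) (Real.tanh r) z =
      (circleForm a b c 0 z - 2 * z.im * Real.sinh r) / Real.cosh r := by
  have hc := Real.cosh_pos r
  rw [Real.tanh_eq_sinh_div_cosh]; unfold circleForm; field_simp; ring

lemma hypercycle_eq_circleForm {a b c : ℝ} (h : b ^ 2 - 4 * a * c = 4) {r : ℝ} (hr : 0 < r) :
    {z : ℍ | Metric.infDist z {z : ℍ | circleForm a b c 0 z < 0} = r} =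
      {z | circleForm (a / Real.cosh r) (b / Real.cosh r) (c / Real.cosh r) (Real.tanh r) z = 0} := by
  have hc := Real.cosh_pos r
  ext z
  rw [mem_ofPred_eq, mem_ofPred_eq, infDist_halfPlane_eq_iff h z hr, circleForm_eq_hypercycle,
    div_eq_zero_iff, or_iff_left hc.ne', sub_eq_zero]

lemma hypercycleDisk_eq_circleForm {a b c : ℝ} (h : b ^ 2 - 4 * a * c = 4) {r : ℝ} (hr : 0 < r) :
    {z : ℍ | Metric.infDist z {z : ℍ | circleForm a b c 0 z < 0} < r} =
      {z | circleForm (a / Real.cosh r) (b / Real.cosh r) (c / Real.cosh r) (Real.tanh r) z < 0} := by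
  have hc := Real.cosh_pos r
  ext z
  rw [mem_ofPred_eq, mem_ofPred_eq, infDist_halfPlane_lt_iff h z hr, circleForm_eq_hypercycle,
    div_lt_iff₀ hc, zero_mul, sub_neg]

/-- Every generalized circle is cut out by a quadratic form of determinant `k ^ 2 - 1`. -/
lemma IsGeneralizedCircle.exists_circleForm {k : ℝ} {C D : Set ℍ}
    (h : IsGeneralizedCircle k C D) : ∃ a b c : ℝ, 4 * a * c - b ^ 2 = 4 * (k ^ 2 - 1) ∧
      C = {z : ℍ | circleForm a b c k z = 0} ∧ D = {z : ℍ | circleForm a b c k z < 0} := by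
  cases h with
  | circle w r hr =>
    have hs := Real.sinh_pos_iff.2 hr
    have hw := w.im_pos
    have hcs := Real.cosh_sq r
    refine ⟨_, _, _, ?_, sphere_eq_circleForm w hr, ball_eq_circleForm w hr⟩
    rw [div_pow, div_pow, hcs]; field_simp; ring
  | horocycleLine h hh =>
    refine ⟨0, 0, 2 * h, by ring, ?_, ?_⟩ <;> ext z <;>
      simp only [circleForm, mem_ofPred_eq] <;> constructor <;> intro h <;> linarith
  | horocycleCircle x ρ hρ =>
    exact ⟨_, _, _, by field_simp; ring, horocycle_eq_circleForm x hρ, horodisk_eq_circleForm x hρ⟩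
  | hypercycle H hH r hr =>
    obtain ⟨a, b, c, h, rfl⟩ := hH.exists_circleForm
    have hc := Real.cosh_pos r
    have hcs := Real.cosh_sq r
    refine ⟨_, _, _, ?_, hypercycle_eq_circleForm h hr, hypercycleDisk_eq_circleForm h hr⟩
    rw [Real.tanh_eq_sinh_div_cosh]; field_simp; rw [hcs]; linear_combination -h

lemma isHalfPlane_circleForm {a b c : ℝ} (h : b ^ 2 - 4 * a * c = 4) :
    IsHalfPlane {z : ℍ | circleForm a b c 0 z < 0} := by
  rcases lt_trichotomy a 0 with ha | rfl | ha
  · have ha' := ha.ne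
    refine ⟨-b / (2 * a), Or.inr (Or.inr ⟨-1 / a, div_pos_of_neg_of_neg (by norm_num) ha,
      Or.inr ?_⟩)⟩
    ext z
    rw [mem_ofPred_eq, mem_ofPred_eq, ← sq_lt_sq₀ (div_pos_of_neg_of_neg (by norm_num) ha).le
      dist_nonneg, dist_coe_sq]
    have : (z.re - ((-b / (2 * a) : ℝ) : ℂ).re) ^ 2 + (z.im - ((-b / (2 * a) : ℝ) : ℂ).im) ^ 2 =
        (-1 / a) ^ 2 + circleForm a b c 0 z / a := by
      simp only [circleForm, Complex.ofReal_re, Complex.ofReal_im]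
      field_simp; linear_combination h
    rw [this, lt_add_iff_pos_right]
    exact ⟨fun h1 => div_pos_of_neg_of_neg h1 ha, fun h1 => lt_of_not_ge fun h2 =>
      absurd (div_nonpos_of_nonneg_of_nonpos h2 ha.le) (not_le.2 h1)⟩
  · have hb : (b - 2) * (b + 2) = 0 := by linear_combination h
    rcases mul_eq_zero.1 hb with hb | hb
    · obtain rfl : b = 2 := by linarith
      refine ⟨-c / 2, Or.inl ?_⟩
      ext z; simp only [circleForm, mem_ofPred_eq]
      constructor <;> intro h <;> linarith
    · obtain rfl : b = -2 := by linarith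
      refine ⟨c / 2, Or.inr (Or.inl ?_)⟩
      ext z; simp only [circleForm, mem_ofPred_eq]
      constructor <;> intro h <;> linarith
  · refine ⟨-b / (2 * a), Or.inr (Or.inr ⟨1 / a, by positivity, Or.inl ?_⟩)⟩
    ext z
    rw [mem_ofPred_eq, mem_ofPred_eq, ← sq_lt_sq₀ dist_nonneg (by positivity), dist_coe_sq]
    have : (z.re - ((-b / (2 * a) : ℝ) : ℂ).re) ^ 2 + (z.im - ((-b / (2 * a) : ℝ) : ℂ).im) ^ 2 =
        (1 / a) ^ 2 + circleForm a b c 0 z / a := by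
      simp only [circleForm, Complex.ofReal_re, Complex.ofReal_im]
      field_simp; linear_combination h
    rw [this, add_lt_iff_neg_left, div_lt_iff₀ ha, zero_mul]

/-- Conversely, a quadratic form of determinant `k ^ 2 - 1` and positive trace cuts out a
generalized circle of geodesic curvature `k`. -/
lemma isGeneralizedCircle_of_circleForm {a b c k : ℝ} (hk : 0 < k) (hac : 0 < a + c)
    (h : 4 * a * c - b ^ 2 = 4 * (k ^ 2 - 1)) :
    IsGeneralizedCircle k {z : ℍ | circleForm a b c k z = 0}
      {z : ℍ | circleForm a b c k z < 0} := by
  rcases lt_trichotomy k 1 with hk1 | rfl | hk1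
  · set r := Real.artanh k with hr
    have hkm : k ∈ Ioo (-1 : ℝ) 1 := ⟨by linarith, hk1⟩
    have hrpos : 0 < r := Real.artanh_pos ⟨hk, hk1⟩
    have ht : Real.tanh r = k := Real.tanh_artanh hkm
    have hc := Real.cosh_pos r
    have hcs := Real.cosh_sq r
    have h' : (b * Real.cosh r) ^ 2 - 4 * (a * Real.cosh r) * (c * Real.cosh r) = 4 := by
      have h1 : k * Real.cosh r = Real.sinh r := by
        rw [← ht, Real.tanh_eq_sinh_div_cosh]; field_simp
      have h2 : Real.cosh r ^ 2 * (1 - k ^ 2) = 1 := by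
        rw [mul_sub, mul_one, ← mul_pow, mul_comm _ k, h1, hcs]; ring
      linear_combination -Real.cosh r ^ 2 * h + 4 * h2
    have := IsGeneralizedCircle.hypercycle _ (isHalfPlane_circleForm h') r hrpos
    rw [hypercycle_eq_circleForm h' hrpos, hypercycleDisk_eq_circleForm h' hrpos, ht] at this
    simpa only [mul_div_cancel_right₀ _ hc.ne'] using this
  · have hb : b ^ 2 = 4 * a * c := by linarith
    rcases lt_trichotomy a 0 with ha | rfl | ha
    · nlinarith [sq_nonneg b]
    · obtain rfl : b = 0 := by simpa using hb
      have := IsGeneralizedCircle.horocycleLine (c / 2) (by linarith)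
      convert this using 1 <;> ext z <;> simp only [circleForm, mem_ofPred_eq] <;> constructor <;>
        intro h <;> linarith
    · have := IsGeneralizedCircle.horocycleCircle (-b / (2 * a)) (1 / a) (by positivity)
      rw [horocycle_eq_circleForm _ (by positivity), horodisk_eq_circleForm _ (by positivity)] at this
      have e1 : 1 / (1 / a) = a := by field_simp
      have e2 : -2 * (-b / (2 * a)) / (1 / a) = b := by field_simp
      have e3 : (-b / (2 * a)) ^ 2 / (1 / a) = c := by field_simp; linarith
      rwa [e1, e2, e3] at this
  · have hk2 : 0 < k ^ 2 - 1 := by nlinarith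
    have ha : 0 < a := by
      by_contra hcon
      nlinarith [sq_nonneg b]
    set S := √(k ^ 2 - 1) with hS
    have hSpos : 0 < S := Real.sqrt_pos.2 hk2
    have hS2 : S ^ 2 = k ^ 2 - 1 := Real.sq_sqrt hk2.le
    set r := Real.arsinh (1 / S) with hr
    have hrpos : 0 < r := Real.arsinh_pos_iff.2 (by positivity)
    have hs : Real.sinh r = 1 / S := Real.sinh_arsinh _
    have hc : Real.cosh r = k / S := by
      have := Real.cosh_pos r
      rw [← sq_eq_sq₀ this.le (by positivity), Real.cosh_sq, hs]
      field_simp; linarith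
    have := IsGeneralizedCircle.circle ⟨⟨-b / (2 * a), S / a⟩, by simp; positivity⟩ r hrpos
    rw [sphere_eq_circleForm _ hrpos, ball_eq_circleForm _ hrpos] at this
    simp only [mk_re, mk_im, hs, hc] at this
    have e0 : k / S / (1 / S) = k := by field_simp
    have e1 : 1 / (S / a * (1 / S)) = a := by field_simp
    have e2 : -2 * (-b / (2 * a)) / (S / a * (1 / S)) = b := by field_simp
    have e3 : ((-b / (2 * a)) ^ 2 + (S / a) ^ 2) / (S / a * (1 / S)) = c := by
      field_simp; linarith
    rwa [e0, e1, e2, e3] at this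

/-! ### Tangency and perpendicularity in terms of the quadratic forms -/

lemma hasDerivAt_complex_mk {f g : ℝ → ℝ} {f' g' t : ℝ} (hf : HasDerivAt f f' t)
    (hg : HasDerivAt g g' t) :
    HasDerivAt (fun s => (⟨f s, g s⟩ : ℂ)) ⟨f', g'⟩ t := by
  have e : (fun s => (⟨f s, g s⟩ : ℂ)) = fun s => (f s : ℂ) + (g s : ℂ) * Complex.I := by
    ext s; apply Complex.ext <;> simp
  have e' : (⟨f', g'⟩ : ℂ) = (f' : ℂ) + (g' : ℂ) * Complex.I := by apply Complex.ext <;> simp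
  rw [e, e']
  exact hf.ofReal_comp.add (hg.ofReal_comp.mul_const _)

/-- The coordinates of the rational curves that parametrize generalized circles in
`isTangentVector_iff`. -/
lemma hasDerivAt_rational_zero (x p q r : ℝ) :
    HasDerivAt (fun s : ℝ => x + (s * p - q * s ^ 2) / (1 + r * s ^ 2)) p 0 := by
  have h1 : HasDerivAt (fun s : ℝ => s * p - q * s ^ 2) (1 * p - q * (2 * 0 ^ (2 - 1) * 1)) 0 :=
    ((hasDerivAt_id' (0 : ℝ)).mul_const p).sub (((hasDerivAt_id' (0 : ℝ)).pow 2).const_mul q)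
  have h2 : HasDerivAt (fun s : ℝ => 1 + r * s ^ 2) (r * (2 * 0 ^ (2 - 1) * 1)) 0 :=
    (((hasDerivAt_id' (0 : ℝ)).pow 2).const_mul r).const_add 1
  exact ((h1.div h2 (by norm_num)).const_add x).congr_deriv (by norm_num)

/-- The vectors tangent to a generalized circle are those annihilated by the differential of its
quadratic form. -/
lemma isTangentVector_iff {a b c k : ℝ} (h : 4 * a * c - b ^ 2 = 4 * (k ^ 2 - 1)) {t : ℍ}
    (ht : circleForm a b c k t = 0) (v : ℂ) :
    IsTangentVector {z : ℍ | circleForm a b c k z = 0} t v ↔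
      (2 * a * t.re + b) * v.re + (2 * a * t.im - 2 * k) * v.im = 0 := by
  constructor
  · rintro ⟨γ, h0, hC, hd⟩
    have hre : HasDerivAt (fun s => (γ s).re) v.re 0 := 
      Complex.reCLM.hasFDerivAt.comp_hasDerivAt (0 : ℝ) hd
    have him : HasDerivAt (fun s => (γ s).im) v.im 0 := 
      Complex.imCLM.hasFDerivAt.comp_hasDerivAt (0 : ℝ) hd
    have hF := ((((hre.pow 2).add (him.pow 2)).const_mul a).add (hre.const_mul b)).add
      (him.const_mul (-(2 * k)))
    have hF0 : HasDerivAt (fun _ : ℝ => -c) 0 0 := hasDerivAt_const _ _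
    have hev : (fun _ : ℝ => -c) = ((((fun s => (γ s).re) ^ 2 + (fun s => (γ s).im) ^ 2 : ℝ → ℝ) |>
        fun f s => a * f s) + fun s => b * (γ s).re) + fun s => -(2 * k) * (γ s).im := by
      ext s
      have := hC s
      simp only [circleForm, mem_ofPred_eq] at this
      simp only [Pi.add_apply, Pi.pow_apply]
      linarith
    rw [hev] at hF0
    have := hF.unique hF0
    simp only [h0] at this
    norm_num at this
    linarith
  · intro hv
    set n1 := a * t.re + b / 2 with hn1
    set n2 := a * t.im - k with hn2
    set m := v.re ^ 2 + v.im ^ 2 with hm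
    have hn : n1 ^ 2 + n2 ^ 2 = 1 := by
      rw [hn1, hn2]; unfold circleForm at ht; linear_combination a * ht - h / 4
    have hvn : n1 * v.re + n2 * v.im = 0 := by rw [hn1, hn2]; linarith
    -- A rational curve with velocity `v` on the zero set: the Euclidean circle of curvature `a` and unit
    -- normal `(n1, n2)` at `t`, or the line if `a = 0`. It is only used as long as it stays in the upper
    -- half-plane.
    let f : ℝ → ℝ := fun s => t.re + (s * v.re - (a / 2 * m * n1) * s ^ 2) / (1 + (a ^ 2 * m / 4) * s ^ 2)
    let g : ℝ → ℝ := fun s => t.im + (s * v.im - (a / 2 * m * n2) * s ^ 2) / (1 + (a ^ 2 * m / 4) * s ^ 2)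
    have hf : HasDerivAt f v.re 0 := hasDerivAt_rational_zero _ _ _ _
    have hg : HasDerivAt g v.im 0 := hasDerivAt_rational_zero _ _ _ _
    have hm0 : 0 ≤ m := by positivity
    have hfg : ∀ s, a * (f s ^ 2 + g s ^ 2) + b * f s + c - 2 * k * g s = 0 := by
      intro s
      have hQ : 0 < 1 + (a ^ 2 * m / 4) * s ^ 2 := by positivity
      have e1 : f s - t.re = (s * v.re - (a / 2 * m * n1) * s ^ 2) / (1 + (a ^ 2 * m / 4) * s ^ 2) := by
        simp [f]
      have e2 : g s - t.im = (s * v.im - (a / 2 * m * n2) * s ^ 2) / (1 + (a ^ 2 * m / 4) * s ^ 2) := by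
        simp [g]
      have e3 : (f s - t.re) ^ 2 + (g s - t.im) ^ 2 = s ^ 2 * m / (1 + (a ^ 2 * m / 4) * s ^ 2) := by
        rw [e1, e2, div_pow, div_pow, ← add_div, div_eq_div_iff (by positivity) hQ.ne']
        have : (s * v.re - (a / 2 * m * n1) * s ^ 2) ^ 2 + (s * v.im - (a / 2 * m * n2) * s ^ 2) ^ 2 =
          s ^ 2 * m * (1 + (a ^ 2 * m / 4) * s ^ 2) := by
          linear_combination (-s^3 * a * m) * hvn + (a^2/4*m^2*s^4) * hn - s^2 * hm
        rw [this]; ring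
      have e4 : n1 * (f s - t.re) + n2 * (g s - t.im) = -(a / 2) * (s ^ 2 * m / (1 + (a ^ 2 * m / 4) * s ^ 2)) := by
        rw [e1, e2, ← mul_div_assoc, ← mul_div_assoc, ← add_div, ← mul_div_assoc]
        congr 1
        linear_combination s * hvn - (a/2*m*s^2) * hn
      unfold circleForm at ht
      rw [← e3] at e4
      rw [hn1, hn2] at e4
      linear_combination ht + 2 * e4
    have hpos : ∀ᶠ s in 𝓝 (0 : ℝ), 0 < g s :=
      hg.continuousAt.tendsto.eventually_const_lt (by simp [g, t.im_pos])
    refine ⟨fun s => if hs : 0 < g s then ⟨⟨f s, g s⟩, hs⟩ else t, ?_, ?_, ?_⟩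
    · have : g 0 = t.im := by simp [g]
      dsimp only
      rw [dif_pos (this ▸ t.im_pos)]
      apply UpperHalfPlane.ext_re_im <;> simp [f, g]
    · intro s
      dsimp only
      by_cases hs : 0 < g s
      · rw [dif_pos hs]
        exact hfg s
      · rw [dif_neg hs]; exact ht
    · refine (hasDerivAt_complex_mk hf hg).congr_of_eventuallyEq ?_
      filter_upwards [hpos] with s hs
      rw [dif_pos hs]

/-- Two generalized circles through a point are tangent there if the Lorentz product of their
quadratic forms is that of externally tangent circles. -/
lemma tangentAt_of_circleForm {a b c k a' b' c' k' : ℝ}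
    (h : 4 * a * c - b ^ 2 = 4 * (k ^ 2 - 1)) (h' : 4 * a' * c' - b' ^ 2 = 4 * (k' ^ 2 - 1))
    {t : ℍ} (ht : circleForm a b c k t = 0) (ht' : circleForm a' b' c' k' t = 0)
    (hB : 2 * (a * c' + a' * c) - b * b' - 4 * k * k' = 4) :
    TangentAt {z : ℍ | circleForm a b c k z = 0} {z : ℍ | circleForm a' b' c' k' z = 0} t := by
  refine ⟨ht, ht', ⟨-(2 * a * t.im - 2 * k), 2 * a * t.re + b⟩, ?_, ?_, ?_⟩
  · intro h0
    rw [Complex.ext_iff] at h0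
    simp only [Complex.zero_re, Complex.zero_im] at h0
    unfold circleForm at ht
    have : (2 * a * t.im - 2 * k) ^ 2 + (2 * a * t.re + b) ^ 2 = 4 := by
      linear_combination 4 * a * ht - h
    rw [h0.2, neg_eq_zero.1 h0.1] at this
    norm_num at this
  · rw [isTangentVector_iff h ht]; ring
  · rw [isTangentVector_iff h' ht']
    -- the two gradients have length `2` and inner product `-4`, so they are opposite
    unfold circleForm at ht ht'
    have e1 : (2 * a * t.im - 2 * k) ^ 2 + (2 * a * t.re + b) ^ 2 = 4 := by
      linear_combination 4 * a * ht - h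
    have e2 : (2 * a' * t.im - 2 * k') ^ 2 + (2 * a' * t.re + b') ^ 2 = 4 := by
      linear_combination 4 * a' * ht' - h'
    have e3 : (2 * a * t.im - 2 * k) * (2 * a' * t.im - 2 * k') +
        (2 * a * t.re + b) * (2 * a' * t.re + b') = -4 := by
      linear_combination 2 * a' * ht + 2 * a * ht' - hB
    have e4 : ((2 * a * t.im - 2 * k) + (2 * a' * t.im - 2 * k')) ^ 2 +
        ((2 * a * t.re + b) + (2 * a' * t.re + b')) ^ 2 = 0 := by
      linear_combination e1 + e2 + 2 * e3
    have e5 : (2 * a * t.im - 2 * k) + (2 * a' * t.im - 2 * k') = 0 := by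
      nlinarith [sq_nonneg ((2 * a * t.im - 2 * k) + (2 * a' * t.im - 2 * k')),
        sq_nonneg ((2 * a * t.re + b) + (2 * a' * t.re + b'))]
    have e6 : (2 * a * t.re + b) + (2 * a' * t.re + b') = 0 := by
      nlinarith [sq_nonneg ((2 * a * t.im - 2 * k) + (2 * a' * t.im - 2 * k')),
        sq_nonneg ((2 * a * t.re + b) + (2 * a' * t.re + b'))]
    simp only
    linear_combination (2 * a * t.re + b) * e5 - (2 * a * t.im - 2 * k) * e6

/-- If two plane vectors are perpendicular, so are their normals. -/
lemma mul_eq_zero_of_perp {A B A' B' x y x' y' : ℝ} (h : B * x + A * y = 0)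
    (h' : B' * x' + A' * y' = 0) (hp : x * x' + y * y' = 0) :
    (x ^ 2 + y ^ 2) * (x' ^ 2 + y' ^ 2) * (A * A' + B * B') = 0 := by
  grind

/-- Two generalized circles through a point are perpendicular there if and only if their quadratic
forms are orthogonal. -/
lemma perpendicularAt_iff {a b c k a' b' c' k' : ℝ}
    (h : 4 * a * c - b ^ 2 = 4 * (k ^ 2 - 1)) (h' : 4 * a' * c' - b' ^ 2 = 4 * (k' ^ 2 - 1))
    {t : ℍ} (ht : circleForm a b c k t = 0) (ht' : circleForm a' b' c' k' t = 0) :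
    PerpendicularAt {z : ℍ | circleForm a b c k z = 0} {z : ℍ | circleForm a' b' c' k' z = 0} t ↔
      2 * (a * c' + a' * c) - b * b' - 4 * k * k' = 0 := by
  have e3 : (2 * a * t.im - 2 * k) * (2 * a' * t.im - 2 * k') +
      (2 * a * t.re + b) * (2 * a' * t.re + b') =
      -(2 * (a * c' + a' * c) - b * b' - 4 * k * k') := by
    unfold circleForm at ht ht'
    linear_combination 2 * a' * ht + 2 * a * ht'
  have e1 : (2 * a * t.im - 2 * k) ^ 2 + (2 * a * t.re + b) ^ 2 = 4 := by
    unfold circleForm at ht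
    linear_combination 4 * a * ht - h
  have e2 : (2 * a' * t.im - 2 * k') ^ 2 + (2 * a' * t.re + b') ^ 2 = 4 := by
    unfold circleForm at ht'
    linear_combination 4 * a' * ht' - h'
  rw [← neg_eq_zero (a := 2 * (a * c' + a' * c) - b * b' - 4 * k * k'), ← e3]
  generalize hA : 2 * a * t.im - 2 * k = A at *
  generalize hB : 2 * a * t.re + b = B at *
  generalize hA' : 2 * a' * t.im - 2 * k' = A' at *
  generalize hB' : 2 * a' * t.re + b' = B' at *
  constructor
  · rintro ⟨-, -, v, w, hv, hw, hv1, hw1, hvw⟩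
    rw [isTangentVector_iff h ht, hA, hB] at hv1
    rw [isTangentVector_iff h' ht', hA', hB'] at hw1
    rw [Complex.inner, Complex.mul_re] at hvw
    simp only [Complex.conj_re, Complex.conj_im] at hvw
    have hv0 : 0 < v.re ^ 2 + v.im ^ 2 := by
      have := Complex.normSq_pos.2 hv
      rw [Complex.normSq_apply] at this; linarith
    have hw0 : 0 < w.re ^ 2 + w.im ^ 2 := by
      have := Complex.normSq_pos.2 hw
      rw [Complex.normSq_apply] at this; linarith
    have : (v.re ^ 2 + v.im ^ 2) * (w.re ^ 2 + w.im ^ 2) * (A * A' + B * B') = 0 := by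
      have := mul_eq_zero_of_perp hv1 hw1 (by linarith)
      exact this
    rcases mul_eq_zero.1 this with h0 | h0
    · exact absurd h0 (mul_pos hv0 hw0).ne'
    · exact h0
  · intro h0
    refine ⟨ht, ht', ⟨-A, B⟩, ⟨-A', B'⟩, ?_, ?_, ?_, ?_, ?_⟩
    · intro h1; rw [Complex.ext_iff] at h1
      simp only [Complex.zero_re, Complex.zero_im, neg_eq_zero] at h1
      rw [h1.1, h1.2] at e1; norm_num at e1
    · intro h1; rw [Complex.ext_iff] at h1
      simp only [Complex.zero_re, Complex.zero_im, neg_eq_zero] at h1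
      rw [h1.1, h1.2] at e2; norm_num at e2
    · rw [isTangentVector_iff h ht, hA, hB]; ring
    · rw [isTangentVector_iff h' ht', hA', hB']; ring
    · rw [Complex.inner, Complex.mul_re]
      simp only [Complex.conj_re, Complex.conj_im]
      linarith

/-! ### The one-dimensional Hausdorff measure of a curve -/

section Length

variable {X : Type*} [MetricSpace X] [MeasurableSpace X] [BorelSpace X]

lemma hausdorffMeasure_image_Icc_le {γ : ℝ → X} {u v K : ℝ} (hK : 0 ≤ K)
    (h : ∀ s ∈ Icc u v, ∀ s' ∈ Icc u v, dist (γ s) (γ s') ≤ K * |s - s'|) :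
    Measure.hausdorffMeasure 1 (γ '' Icc u v) ≤ ENNReal.ofReal (K * (v - u)) := by
  have hL : LipschitzOnWith K.toNNReal γ (Icc u v) := by
    refine LipschitzOnWith.of_dist_le_mul fun s hs s' hs' => ?_
    rw [Real.coe_toNNReal _ hK, Real.dist_eq]
    exact h s hs s' hs'
  have := hL.hausdorffMeasure_image_le (d := 1) zero_le_one
  rw [hausdorffMeasure_real, Real.volume_Icc, ENNReal.rpow_one] at this
  rwa [ENNReal.ofReal_mul hK]

lemma le_hausdorffMeasure_image_Icc {γ : ℝ → X} {u v K : ℝ} (huv : u ≤ v)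
    (h : ∀ s ∈ Icc u v, ∀ s' ∈ Icc u v, K * |s - s'| ≤ dist (γ s) (γ s')) :
    ENNReal.ofReal (K * (v - u)) ≤ Measure.hausdorffMeasure 1 (γ '' Icc u v) := by
  rcases le_or_gt K 0 with hK | hK
  · rw [ENNReal.ofReal_of_nonpos (mul_nonpos_of_nonpos_of_nonneg hK (by linarith))]
    exact zero_le
  have hinj : InjOn γ (Icc u v) := by
    intro s hs s' hs' he
    have h1 := h s hs s' hs'
    rw [he, dist_self] at h1
    have : |s - s'| ≤ 0 := by
      by_contra hcon
      exact absurd h1 (not_le.2 (mul_pos hK (not_le.1 hcon)))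
    exact sub_eq_zero.1 (abs_nonpos_iff.1 this)
  set g := Function.invFunOn γ (Icc u v) with hg
  have hgl : ∀ s ∈ Icc u v, g (γ s) = s := fun s hs => hinj.leftInvOn_invFunOn hs
  have hL : LipschitzOnWith (K⁻¹).toNNReal g (γ '' Icc u v) := by
    refine LipschitzOnWith.of_dist_le_mul ?_
    rintro _ ⟨s, hs, rfl⟩ _ ⟨s', hs', rfl⟩
    rw [hgl s hs, hgl s' hs', Real.coe_toNNReal _ (by positivity), Real.dist_eq]
    have h1 := h s hs s' hs'
    rw [inv_mul_eq_div, le_div_iff₀ hK]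
    linarith
  have := hL.hausdorffMeasure_image_le (d := 1) zero_le_one
  have himg : g '' (γ '' Icc u v) = Icc u v := by
    rw [image_image]
    ext s; constructor
    · rintro ⟨s', hs', rfl⟩; dsimp only; rwa [hgl s' hs']
    · intro hs; exact ⟨s, hs, hgl s hs⟩
  rw [himg, hausdorffMeasure_real, Real.volume_Icc, ENNReal.rpow_one] at this
  calc ENNReal.ofReal (K * (v - u)) = ENNReal.ofReal K * ENNReal.ofReal (v - u) :=
        ENNReal.ofReal_mul hK.le
    _ ≤ ENNReal.ofReal K * (ENNReal.ofReal K⁻¹ * Measure.hausdorffMeasure 1 (γ '' Icc u v)) := by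
        gcongr; exact this
    _ = Measure.hausdorffMeasure 1 (γ '' Icc u v) := by
        rw [← mul_assoc, ← ENNReal.ofReal_mul hK.le, mul_inv_cancel₀ hK.ne', ENNReal.ofReal_one,
          one_mul]

lemma hausdorffMeasure_image_Icc_add {γ : ℝ → X} {a b u v w : ℝ} (hc : ContinuousOn γ (Icc a b))
    (hinj : InjOn γ (Icc a b)) (hau : a ≤ u) (huv : u ≤ v) (hvw : v ≤ w) (hwb : w ≤ b) :
    Measure.hausdorffMeasure 1 (γ '' Icc u w) = Measure.hausdorffMeasure 1 (γ '' Icc u v) +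
      Measure.hausdorffMeasure 1 (γ '' Icc v w) := by
  rw [← Icc_union_Icc_eq_Icc huv hvw, image_union]
  refine measure_union₀ ?_ ?_
  · refine (IsCompact.measurableSet ?_).nullMeasurableSet
    exact isCompact_Icc.image_of_continuousOn
      (hc.mono (Icc_subset_Icc (hau.trans huv) hwb))
  · have hsub : (γ '' Icc u v) ∩ (γ '' Icc v w) ⊆ {γ v} := by
      rw [← hinj.image_inter (Icc_subset_Icc hau (hvw.trans hwb))
        (Icc_subset_Icc (hau.trans huv) hwb)]
      rintro _ ⟨s, ⟨h1, h2⟩, rfl⟩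
      rw [le_antisymm h1.2 h2.1]; rfl
    have : NullSingletonClass (Measure.hausdorffMeasure 1 : Measure X) :=
      Measure.nullSingletonClass_hausdorff X one_pos
    exact measure_mono_null hsub (measure_singleton _)

/-- A curve that infinitesimally stretches distances by the factor `f` has length `∫ f`. -/
theorem hausdorffMeasure_image_Icc_eq_integral {γ : ℝ → X} {f : ℝ → ℝ} {a b : ℝ} (hab : a ≤ b)
    (hf : ContinuousOn f (Icc a b)) (hinj : InjOn γ (Icc a b))
    (hloc : ∀ t ∈ Icc a b, ∀ ε > 0, ∃ δ > 0, ∀ s ∈ Icc a b, ∀ s' ∈ Icc a b,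
      |s - t| < δ → |s' - t| < δ → (f t - ε) * |s - s'| ≤ dist (γ s) (γ s') ∧
        dist (γ s) (γ s') ≤ (f t + ε) * |s - s'|)
    (hf0 : ∀ t ∈ Icc a b, 0 ≤ f t) :
    (Measure.hausdorffMeasure 1).real (γ '' Icc a b) = ∫ t in a..b, f t := by
  have hc : ContinuousOn γ (Icc a b) := by
    intro t ht
    rw [Metric.continuousWithinAt_iff]
    intro ε hε
    obtain ⟨δ, hδ, h⟩ := hloc t ht 1 one_pos
    have hft := hf0 t ht
    refine ⟨min δ (ε / (f t + 1)), lt_min hδ (by positivity), fun s hs hd => ?_⟩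
    rw [Real.dist_eq] at hd
    have h1 := (h s hs t ht (hd.trans_le (min_le_left _ _)) (by simpa using hδ)).2
    have h2 := hd.trans_le (min_le_right _ _)
    rw [lt_div_iff₀ (by positivity)] at h2
    linarith
  have main : ∀ ε > 0, |(Measure.hausdorffMeasure 1).real (γ '' Icc a b) - ∫ t in a..b, f t| ≤
      2 * ε * (b - a) := by
    intro ε hε
    -- near each point the speed is almost constant
    have hδ : ∀ t : Icc a b, ∃ δ > 0, ∀ s ∈ Icc a b, ∀ s' ∈ Icc a b, |s - t| < δ → |s' - t| < δ →
        (f t - ε) * |s - s'| ≤ dist (γ s) (γ s') ∧ dist (γ s) (γ s') ≤ (f t + ε) * |s - s'| ∧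
          |f s - f t| ≤ ε := by
      intro t
      obtain ⟨δ, hδ, h⟩ := hloc t t.2 ε hε
      obtain ⟨δ', hδ', h'⟩ := Metric.continuousWithinAt_iff.1 (hf t t.2) ε hε
      refine ⟨min δ δ', lt_min hδ hδ', fun s hs s' hs' h1 h2 => ?_⟩
      have h3 := h s hs s' hs' (h1.trans_le (min_le_left _ _)) (h2.trans_le (min_le_left _ _))
      exact ⟨h3.1, h3.2, (h' hs (h1.trans_le (min_le_right _ _))).le⟩
    choose δ hδ0 hδ using hδ
    obtain ⟨p, hp0, hpm, ⟨m, hm⟩, hpc⟩ := exists_monotone_Icc_subset_open_cover_Icc hab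
      (c := fun t : Icc a b => Metric.ball t (δ t)) (fun _ => Metric.isOpen_ball)
      (fun t _ => mem_iUnion.2 ⟨t, Metric.mem_ball_self (hδ0 t)⟩)
    have hind : ∀ n : ℕ, Measure.hausdorffMeasure 1 (γ '' Icc a (p n)) ≠ ⊤ ∧
        |(Measure.hausdorffMeasure 1).real (γ '' Icc a (p n)) - ∫ t in a..(p n), f t| ≤
          2 * ε * (p n - a) := by
      intro n
      induction n with
      | zero =>
        have : NullSingletonClass (Measure.hausdorffMeasure 1 : Measure X) :=
          Measure.nullSingletonClass_hausdorff X one_pos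
        rw [hp0, Icc_self, image_singleton, measureReal_def, measure_singleton]
        simp
      | succ n ih =>
        obtain ⟨t, ht⟩ := hpc n
        set u : ℝ := (p n : ℝ) with hu
        set v : ℝ := (p (n + 1) : ℝ) with hv
        have huv : u ≤ v := hpm n.le_succ
        have hau : a ≤ u := (p n).2.1
        have hvb : v ≤ b := (p (n + 1)).2.2
        have hin : ∀ s ∈ Icc u v, s ∈ Icc a b ∧ |s - t| < δ t := by
          intro s hs
          have hs' : s ∈ Icc a b := ⟨hau.trans hs.1, hs.2.trans hvb⟩
          have := @ht ⟨s, hs'⟩ ⟨hs.1, hs.2⟩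
          exact ⟨hs', this⟩
        have hft := hf0 t t.2
        have up := hausdorffMeasure_image_Icc_le (γ := γ) (add_nonneg hft hε.le)
          fun s hs s' hs' => (hδ t s (hin s hs).1 s' (hin s' hs').1 (hin s hs).2 (hin s' hs').2).2.1
        have low := le_hausdorffMeasure_image_Icc (γ := γ) huv
          fun s hs s' hs' => (hδ t s (hin s hs).1 s' (hin s' hs').1 (hin s hs).2 (hin s' hs').2).1
        have hfin : Measure.hausdorffMeasure 1 (γ '' Icc u v) ≠ ⊤ :=
          ne_top_of_le_ne_top ENNReal.ofReal_ne_top up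
        have up' : (Measure.hausdorffMeasure 1).real (γ '' Icc u v) ≤ (f t + ε) * (v - u) :=
          ENNReal.toReal_le_of_le_ofReal
            (mul_nonneg (add_nonneg hft hε.le) (by linarith)) up
        have low' : (f t - ε) * (v - u) ≤ (Measure.hausdorffMeasure 1).real (γ '' Icc u v) :=
          (ENNReal.ofReal_le_iff_le_toReal hfin).1 low
        have hadd := hausdorffMeasure_image_Icc_add hc hinj le_rfl hau huv hvb
        have hint1 : IntervalIntegrable f volume a u :=
          (hf.mono (by rw [uIcc_of_le hau]; exact Icc_subset_Icc le_rfl (huv.trans hvb))).intervalIntegrable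
        have hint2 : IntervalIntegrable f volume u v :=
          (hf.mono (by rw [uIcc_of_le huv]; exact Icc_subset_Icc hau hvb)).intervalIntegrable
        have hI : |(∫ x in u..v, f x) - f t * (v - u)| ≤ ε * (v - u) := by
          have e : (∫ x in u..v, f x) - f t * (v - u) = ∫ x in u..v, (f x - f t) := by
            rw [intervalIntegral.integral_sub hint2 intervalIntegrable_const]
            simp; ring
          rw [e]
          have := intervalIntegral.norm_integral_le_of_norm_le_const (f := fun x => f x - f t)
            (a := u) (b := v) (C := ε) (by
              intro x hx
              rw [uIoc_of_le huv] at hx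
              have hx' := hin x ⟨hx.1.le, hx.2⟩
              exact (hδ t x hx'.1 x hx'.1 hx'.2 hx'.2).2.2)
          rwa [abs_of_nonneg (sub_nonneg.2 huv), Real.norm_eq_abs] at this
        refine ⟨by rw [hadd]; exact ENNReal.add_ne_top.2 ⟨ih.1, hfin⟩, ?_⟩
        have hadd' : (Measure.hausdorffMeasure 1).real (γ '' Icc a v) =
            (Measure.hausdorffMeasure 1).real (γ '' Icc a u) +
            (Measure.hausdorffMeasure 1).real (γ '' Icc u v) := by
          simp only [measureReal_def, hadd, ENNReal.toReal_add ih.1 hfin]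
        rw [hadd', ← intervalIntegral.integral_add_adjacent_intervals hint1 hint2]
        have := ih.2
        rw [abs_le] at this hI ⊢
        constructor <;> nlinarith
    have := (hind m).2
    rwa [hm m le_rfl] at this
  rw [← sub_eq_zero, ← abs_nonpos_iff]
  refine le_of_forall_pos_le_add fun η hη => ?_
  have hba : 0 < b - a + 1 := by linarith
  refine (main (η / (2 * (b - a + 1))) (by positivity)).trans ?_
  rw [zero_add, mul_div_assoc', div_mul_eq_mul_div, div_le_iff₀ (by positivity)]
  nlinarith

end Length

lemma Real.sinh_le_mul_cosh {x : ℝ} (hx : 0 ≤ x) : Real.sinh x ≤ x * Real.cosh x := by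
  have hd : ∀ y : ℝ, HasDerivAt (fun y => y * Real.cosh y - Real.sinh y) (y * Real.sinh y) y := by
    intro y
    exact (((hasDerivAt_id' y).mul (Real.hasDerivAt_cosh y)).sub
      (Real.hasDerivAt_sinh y)).congr_deriv (by ring)
  have hm : MonotoneOn (fun y => y * Real.cosh y - Real.sinh y) (Ici 0) := by
    refine monotoneOn_of_deriv_nonneg (convex_Ici 0)
      (fun y _ => (hd y).continuousAt.continuousWithinAt)
      (fun y _ => (hd y).differentiableAt.differentiableWithinAt) fun y hy => ?_
    rw [interior_Ici] at hy
    rw [(hd y).deriv]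
    exact mul_nonneg (le_of_lt hy) (Real.sinh_nonneg_iff.2 (le_of_lt hy))
  have := hm self_mem_Ici hx hx
  simp only [zero_mul, Real.sinh_zero, sub_zero] at this
  linarith

/-- The length of a curve in which distances are given by the rational function that appears for
generalized circles. -/
theorem hausdorffMeasure_image_Icc_of_cosh_dist {γ : ℝ → ℍ} {Q : ℝ → ℝ} {a b : ℝ} (hab : a ≤ b)
    (hQc : Continuous Q) (hQ : ∀ t ∈ Icc a b, 0 < Q t)
    (hd : ∀ s ∈ Icc a b, ∀ s' ∈ Icc a b,
      Real.cosh (dist (γ s) (γ s')) = 1 + 2 * (s - s') ^ 2 / (Q s * Q s')) :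
    (Measure.hausdorffMeasure 1).real (γ '' Icc a b) = ∫ t in a..b, 2 / Q t := by
  -- the hypothesis is a half-angle formula in disguise
  have hsinh : ∀ s ∈ Icc a b, ∀ s' ∈ Icc a b,
      Real.sinh (dist (γ s) (γ s') / 2) = |s - s'| / √(Q s * Q s') := by
    intro s hs s' hs'
    have h1 := hQ s hs
    have h2 := hQ s' hs'
    have h3 : 0 ≤ Real.sinh (dist (γ s) (γ s') / 2) := Real.sinh_nonneg_iff.2 (by positivity)
    rw [← sq_eq_sq₀ h3 (by positivity), div_pow, Real.sq_sqrt (by positivity), sq_abs]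
    have h4 := hd s hs s' hs'
    have h5 := Real.cosh_two_mul (dist (γ s) (γ s') / 2)
    rw [mul_div_cancel₀ _ two_ne_zero, Real.cosh_sq, h4, mul_div_assoc] at h5
    linarith
  have hup : ∀ s ∈ Icc a b, ∀ s' ∈ Icc a b,
      dist (γ s) (γ s') ≤ 2 / √(Q s * Q s') * |s - s'| := by
    intro s hs s' hs'
    have h1 := Real.self_le_sinh_iff.2 (show 0 ≤ dist (γ s) (γ s') / 2 by positivity)
    rw [hsinh s hs s' hs'] at h1
    calc _ = 2 * (dist (γ s) (γ s') / 2) := by ring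
      _ ≤ 2 * (|s - s'| / √(Q s * Q s')) := by linarith
      _ = _ := by ring
  have hlow : ∀ s ∈ Icc a b, ∀ s' ∈ Icc a b,
      2 / √(Q s * Q s' + (s - s') ^ 2) * |s - s'| ≤ dist (γ s) (γ s') := by
    intro s hs s' hs'
    have h1 := hQ s hs
    have h2 := hQ s' hs'
    set y := dist (γ s) (γ s') / 2 with hy
    have hy0 : 0 ≤ y := by positivity
    have h3 : Real.sinh y / Real.cosh y ≤ y := by
      rw [div_le_iff₀ (Real.cosh_pos _)]
      exact Real.sinh_le_mul_cosh hy0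
    have h4 : Real.cosh y = √(Q s * Q s' + (s - s') ^ 2) / √(Q s * Q s') := by
      have := Real.cosh_pos y
      rw [← sq_eq_sq₀ this.le (by positivity), Real.cosh_sq, hsinh s hs s' hs', div_pow, div_pow,
        Real.sq_sqrt (by positivity), Real.sq_sqrt (by positivity), sq_abs]
      field_simp; ring
    rw [hsinh s hs s' hs', h4, div_div_div_cancel_right₀ (by positivity)] at h3
    calc _ = 2 * (|s - s'| / √(Q s * Q s' + (s - s') ^ 2)) := by ring
      _ ≤ 2 * y := by linarith
      _ = _ := by rw [hy]; ring
  -- both bounds are asymptotic to `2 / Q t * |s - s'|` as `s` and `s'` tend to `t`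
  refine hausdorffMeasure_image_Icc_eq_integral hab ?_ ?_ ?_ ?_
  · exact ContinuousOn.div continuousOn_const hQc.continuousOn fun t ht => (hQ t ht).ne'
  · intro s hs s' hs' he
    have h1 := hsinh s hs s' hs'
    have h2 := mul_pos (hQ s hs) (hQ s' hs')
    rw [he, dist_self, zero_div, Real.sinh_zero, eq_comm, div_eq_zero_iff,
      or_iff_left (by positivity)] at h1
    exact sub_eq_zero.1 (abs_eq_zero.1 h1)
  · intro t ht ε hε
    have hQt := hQ t ht
    have hsq : √(Q t * Q t) = Q t := Real.sqrt_mul_self hQt.le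
    have hc1 : ContinuousAt (fun p : ℝ × ℝ => 2 / √(Q p.1 * Q p.2)) (t, t) :=
      ContinuousAt.div (by fun_prop) (by fun_prop) (by simp only [hsq]; exact hQt.ne')
    have hc2 : ContinuousAt (fun p : ℝ × ℝ => 2 / √(Q p.1 * Q p.2 + (p.1 - p.2) ^ 2)) (t, t) :=
      ContinuousAt.div (by fun_prop) (by fun_prop) (by simp [hsq]; exact hQt.ne')
    have e1 := hc1.tendsto.eventually_lt_const (show _ < 2 / Q t + ε by simp [hsq, hε])
    have e2 := hc2.tendsto.eventually_const_lt (show 2 / Q t - ε < _ by simp [hsq, hε])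
    obtain ⟨δ, hδ, h⟩ := Metric.eventually_nhds_iff.1 (e1.and e2)
    refine ⟨δ, hδ, fun s hs s' hs' h1 h2 => ?_⟩
    have h3 := @h (s, s') (by rw [Prod.dist_eq]; exact max_lt h1 h2)
    exact ⟨(mul_le_mul_of_nonneg_right h3.2.le (abs_nonneg _)).trans (hlow s hs s' hs'),
      (hup s hs s' hs').trans (mul_le_mul_of_nonneg_right h3.1.le (abs_nonneg _))⟩
  · intro t ht
    have := hQ t ht
    positivity

/-! ### Arcs on a circle arranged in a cycle -/

/-- Moving from the endpoint `φ` of the arc of centre `ψ` and half-length `θ` towards the centre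
leads into the arc. The sign `ε` tells at which end of the arc `φ` is. -/
lemma cos_lt_cos_sub_of_side {ψ θ φ ε δ : ℝ} {m : ℤ} (hε : ε = 1 ∨ ε = -1) (hθ : θ < Real.pi / 2)
    (hφ : φ = ψ + ε * θ + 2 * m * Real.pi) (hδ : 0 < δ) (hδθ : δ ≤ θ) :
    Real.cos θ < Real.cos (φ - ε * δ - ψ) := by
  have h1 : Real.cos (φ - ε * δ - ψ) = Real.cos (θ - δ) := by
    rw [hφ, show ψ + ε * θ + 2 * m * Real.pi - ε * δ - ψ = ε * (θ - δ) + m * (2 * Real.pi) by ring,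
      Real.cos_add_int_mul_two_pi]
    rcases hε with rfl | rfl
    · rw [one_mul]
    · rw [neg_one_mul, Real.cos_neg]
  rw [h1]
  exact Real.cos_lt_cos_of_nonneg_of_le_pi (by linarith) (by linarith [Real.pi_pos]) (by linarith)

lemma exists_side_of_cos_eq {ψ θ φ : ℝ} (h : Real.cos (φ - ψ) = Real.cos θ) :
    ∃ ε : ℝ, (ε = 1 ∨ ε = -1) ∧ ∃ m : ℤ, φ = ψ + ε * θ + 2 * m * Real.pi := by
  obtain ⟨m, hm | hm⟩ := Real.cos_eq_cos_iff.1 h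
  · exact ⟨1, Or.inl rfl, -m, by push_cast; linarith⟩
  · exact ⟨-1, Or.inr rfl, m, by linarith⟩

/-- A crude bound for the total length of disjoint arcs on a circle. The sharp bound is `π`, but
this one suffices to exclude that a cyclic chain of arcs winds around the circle twice. -/
lemma sum_arcs_lt {ι : Type*} [Fintype ι] {ψ θ : ι → ℝ} (h0 : ∀ i, 0 < θ i)
    (h1 : ∀ i, θ i < Real.pi / 2)
    (hdisj : ∀ i j, i ≠ j → ∀ φ, Real.cos (θ i) < Real.cos (φ - ψ i) →
      ¬ Real.cos (θ j) < Real.cos (φ - ψ j)) : ∑ i, θ i < 2 * Real.pi := by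
  have hpi := Real.pi_pos
  have : Fact (0 < 2 * Real.pi) := ⟨by positivity⟩
  -- shrunken arcs are disjoint balls of the circle `ℝ / 2πℤ`
  let B : ι → Set (AddCircle (2 * Real.pi)) := fun i => Metric.closedBall (ψ i : AddCircle _) (3 / 4 * θ i)
  have hB : ∀ i (φ : ℝ), (φ : AddCircle (2 * Real.pi)) ∈ B i → Real.cos (θ i) < Real.cos (φ - ψ i) := by
    intro i φ h
    rw [Metric.mem_closedBall, dist_eq_norm, ← AddCircle.coe_sub, AddCircle.norm_eq] at h
    set N := round ((2 * Real.pi)⁻¹ * (φ - ψ i)) with hN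
    have e : Real.cos (φ - ψ i) = Real.cos |φ - ψ i - N * (2 * Real.pi)| := by
      rw [Real.cos_abs, Real.cos_sub_int_mul_two_pi]
    rw [e]
    exact Real.cos_lt_cos_of_nonneg_of_le_pi (abs_nonneg _) (by linarith [h1 i])
      (by linarith [h0 i])
  have hd : Pairwise (Function.onFun Disjoint B) := by
    intro i j hij
    rw [Function.onFun, Set.disjoint_left]
    intro x
    induction x using QuotientAddGroup.induction_on with
    | H φ => exact fun hi hj => hdisj i j hij φ (hB i φ hi) (hB j φ hj)
  have hm := measure_iUnion (μ := (volume : Measure (AddCircle (2 * Real.pi)))) hd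
    (fun i => Metric.isClosed_closedBall.measurableSet)
  have hle := measure_mono (μ := (volume : Measure (AddCircle (2 * Real.pi)))) (subset_univ (⋃ i, B i))
  rw [hm, tsum_fintype, AddCircle.measure_univ] at hle
  have hv : ∀ i, volume (B i) = ENNReal.ofReal (3 / 2 * θ i) := by
    intro i
    rw [AddCircle.volume_closedBall, min_eq_right (by linarith [h1 i])]
    congr 1; ring
  simp only [hv] at hle
  rw [← ENNReal.ofReal_sum_of_nonneg (fun i _ => by linarith [h0 i]),
    ENNReal.ofReal_le_ofReal_iff (by positivity), ← Finset.mul_sum] at hle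
  linarith

/-- Disjoint arcs of half-lengths `θ i` on a circle such that cyclically consecutive arcs share an
endpoint fill the circle. -/
theorem sum_arcs_eq_pi {n : ℕ} (hn : 3 ≤ n) {ψ θ : Fin n → ℝ} (h0 : ∀ i, 0 < θ i)
    (h1 : ∀ i, θ i < Real.pi / 2)
    (hdisj : ∀ i j, i ≠ j → ∀ φ, Real.cos (θ i) < Real.cos (φ - ψ i) →
      ¬ Real.cos (θ j) < Real.cos (φ - ψ j))
    (htouch : ∀ i j, (SimpleGraph.cycleGraph n).Adj i j →
      ∃ φ, Real.cos (φ - ψ i) = Real.cos (θ i) ∧ Real.cos (φ - ψ j) = Real.cos (θ j)) :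
    ∑ i, θ i = Real.pi := by
  have hpi := Real.pi_pos
  obtain ⟨n, rfl⟩ : ∃ m, n = m + 3 := ⟨n - 3, by omega⟩
  -- two different arcs cannot lie on the same side of a common endpoint
  have hside : ∀ i j, i ≠ j → ∀ (φ ε : ℝ) (m m' : ℤ), (ε = 1 ∨ ε = -1) →
      φ = ψ i + ε * θ i + 2 * m * Real.pi → φ = ψ j + ε * θ j + 2 * m' * Real.pi → False := by
    intro i j hij φ ε m m' hε hi hj
    exact hdisj i j hij (φ - ε * min (θ i) (θ j))
      (cos_lt_cos_sub_of_side hε (h1 i) hi (lt_min (h0 i) (h0 j)) (min_le_left _ _))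
      (cos_lt_cos_sub_of_side hε (h1 j) hj (lt_min (h0 i) (h0 j)) (min_le_right _ _))
  have hadj : ∀ i : Fin (n + 3), (SimpleGraph.cycleGraph (n + 3)).Adj i (i + 1) := by
    intro i
    rw [SimpleGraph.cycleGraph_adj]; right; simp
  choose φ hφ hφ' using fun i => htouch i (i + 1) (hadj i)
  choose ε hε m hm using fun i => exists_side_of_cos_eq (hφ i)
  have hne1 : ∀ i : Fin (n + 3), i ≠ i + 1 := fun i => (hadj i).ne
  have hne2 : ∀ i : Fin (n + 3), i ≠ i + 1 + 1 := by
    intro i h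
    rw [add_assoc, left_eq_add] at h
    have := congrArg Fin.val h
    simp [Fin.val_add, Nat.mod_eq_of_lt] at this
  -- the next arc lies on the other side of the common endpoint
  have hm' : ∀ i, ∃ m' : ℤ, φ i = ψ (i + 1) - ε i * θ (i + 1) + 2 * m' * Real.pi := by
    intro i
    obtain ⟨ε', hε', m', h⟩ := exists_side_of_cos_eq (hφ' i)
    have : ε' = -ε i := by
      by_contra hcon
      have : ε' = ε i := by
        rcases hε' with rfl | rfl <;> rcases hε i with h' | h' <;> rw [h'] at hcon ⊢ <;>
          norm_num at hcon
      rw [this] at h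
      exact hside i (i + 1) (hne1 i) (φ i) (ε i) (m i) m' (hε i) (hm i) h
    exact ⟨m', by rw [h, this]; ring⟩
  choose m' hm' using hm'
  -- all steps go around the circle in the same direction, since otherwise the arcs `i` and `i + 2`
  -- would lie on the same side of an endpoint
  have hconst : ∀ i, ε (i + 1) = ε i := by
    intro i
    by_contra hcon
    have : ε (i + 1) = -ε i := by
      rcases hε i with h | h <;> rcases hε (i + 1) with h' | h' <;> rw [h, h'] at hcon ⊢ <;>
        first | (norm_num; done) | norm_num at hcon
    have e1 := hm (i + 1)
    have e2 := hm' (i + 1)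
    rw [this] at e1 e2
    refine hside i (i + 1 + 1) (hne2 i) (φ i) (ε i) (m i) (m' (i + 1) - m (i + 1) + m' i)
      (hε i) (hm i) ?_
    push_cast
    linarith [hm' i]
  have hconst' : ∀ i, ε i = ε 0 := by
    intro i
    induction i using Fin.induction with
    | zero => rfl
    | succ i ih =>
      rw [← ih, ← hconst i.castSucc, Fin.coeSucc_eq_succ]
  -- adding up the steps shows that the sum of the half-lengths is a multiple of `π`
  have hsum : ∑ i, ψ (i + 1) = ∑ i, ψ i := Equiv.sum_comp (Equiv.addRight (1 : Fin (n + 3))) ψ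
  have hsum' : ∑ i, θ (i + 1) = ∑ i, θ i := Equiv.sum_comp (Equiv.addRight (1 : Fin (n + 3))) θ
  have hstep : ∀ i, ψ (i + 1) - ψ i - ε 0 * (θ i + θ (i + 1)) = 2 * Real.pi * ((m i - m' i : ℤ) : ℝ) := by
    intro i
    have e1 := hm i
    have e2 := hm' i
    rw [hconst' i] at e1 e2
    push_cast
    linarith
  have htot : ε 0 * ∑ i, θ i = -Real.pi * ((∑ i, (m i - m' i) : ℤ) : ℝ) := by
    have := Finset.sum_congr rfl (fun i (_ : i ∈ Finset.univ) => hstep i)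
    rw [Finset.sum_sub_distrib, Finset.sum_sub_distrib, ← Finset.mul_sum, ← Finset.mul_sum,
      Finset.sum_add_distrib, hsum, hsum', ← Int.cast_sum] at this
    linarith
  have hpos : 0 < ∑ i, θ i := Finset.sum_pos (fun i _ => h0 i) Finset.univ_nonempty
  have hlt := sum_arcs_lt h0 h1 hdisj
  obtain ⟨N, hN⟩ : ∃ N : ℤ, ∑ i, θ i = Real.pi * N := by
    rcases hε 0 with h | h <;> rw [h] at htot
    · exact ⟨-∑ i, (m i - m' i), by push_cast at htot ⊢; linarith⟩
    · exact ⟨∑ i, (m i - m' i), by push_cast at htot ⊢; linarith⟩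
  rw [hN] at hpos hlt ⊢
  have hN0 : (0 : ℝ) < N := (mul_pos_iff_of_pos_left hpi).1 hpos
  have hN2 : (N : ℝ) < 2 := by nlinarith
  have : N = 1 := by
    have h3 : 0 < N := by exact_mod_cast hN0
    have h4 : N < 2 := by exact_mod_cast hN2
    omega
  rw [this]; simp

/-! ### Hyperboloid coordinates and circles perpendicular to a given circle -/

/-- First spatial coordinate of `z` in the hyperboloid model with origin `w`. -/
noncomputable def hypX (w z : ℍ) : ℝ :=
  ((z.re - w.re) ^ 2 + z.im ^ 2 - w.im ^ 2) / (2 * z.im * w.im)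

/-- Second spatial coordinate of `z` in the hyperboloid model with origin `w`. -/
noncomputable def hypY (w z : ℍ) : ℝ := (z.re - w.re) / z.im

/-- The equation of the hyperboloid; the timelike coordinate is `cosh (dist z w)`. -/
lemma cosh_dist_sq_eq (w z : ℍ) :
    Real.cosh (dist z w) ^ 2 = 1 + hypX w z ^ 2 + hypY w z ^ 2 := by
  have := z.im_pos
  have := w.im_pos
  rw [cosh_dist_eq]; unfold hypX hypY
  field_simp; ring

/-- The distance is given by the Lorentz product of hyperboloid coordinates. -/
lemma cosh_dist_eq_hyp (w z z' : ℍ) : Real.cosh (dist z z') =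
    Real.cosh (dist z w) * Real.cosh (dist z' w) - hypX w z * hypX w z' - hypY w z * hypY w z' := by
  have := z.im_pos
  have := z'.im_pos
  have := w.im_pos
  simp only [cosh_dist_eq]; unfold hypX hypY
  field_simp; ring

/-- The spatial hyperboloid coordinates are arbitrary. -/
lemma exists_hyp_eq (w : ℍ) (u₁ u₂ : ℝ) : ∃ z : ℍ, hypX w z = u₁ ∧ hypY w z = u₂ ∧
    Real.cosh (dist z w) = √(1 + u₁ ^ 2 + u₂ ^ 2) := by
  have hw := w.im_pos
  set c := √(1 + u₁ ^ 2 + u₂ ^ 2) with hc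
  have hc2 : c ^ 2 = 1 + u₁ ^ 2 + u₂ ^ 2 := Real.sq_sqrt (by positivity)
  have hc0 : 0 < c := Real.sqrt_pos.2 (by positivity)
  have hcu : 0 < c - u₁ := by nlinarith [sq_nonneg u₂]
  have hX : hypX w ⟨⟨w.re + u₂ * (w.im / (c - u₁)), w.im / (c - u₁)⟩, by simp; positivity⟩ = u₁ := by
    unfold hypX; simp only [mk_re, mk_im]
    field_simp; linear_combination -w.im ^ 2 * hc2
  have hY : hypY w ⟨⟨w.re + u₂ * (w.im / (c - u₁)), w.im / (c - u₁)⟩, by simp; positivity⟩ = u₂ := by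
    unfold hypY; simp only [mk_re, mk_im]
    field_simp; ring
  refine ⟨⟨⟨w.re + u₂ * (w.im / (c - u₁)), w.im / (c - u₁)⟩, by simp; positivity⟩, hX, hY, ?_⟩
  rw [← sq_eq_sq₀ (Real.cosh_pos _).le hc0.le, cosh_dist_sq_eq w, hX, hY, hc2]

/-- The circle of curvature `k` perpendicular to the circle of centre `w` and radius `r`, in the
direction `ψ` as seen from `w`, is the zero set of this function, and its disk is where the function
is negative. -/
noncomputable def perpForm (w : ℍ) (r k ψ : ℝ) (z : ℍ) : ℝ :=
  k * Real.cosh r * Real.cosh (dist z w) - √(1 + k ^ 2 * Real.sinh r ^ 2) *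
    (Real.cos ψ * hypX w z + Real.sin ψ * hypY w z) - k

/-- In hyperboloid coordinates the quadratic forms are affine. -/
lemma circleForm_eq_hyp (a b c k : ℝ) (w z : ℍ) : circleForm a b c k z = 2 * z.im *
    ((a * w.im + (a * w.re ^ 2 + b * w.re + c) / w.im) / 2 * Real.cosh (dist z w) +
      (a * w.im - (a * w.re ^ 2 + b * w.re + c) / w.im) / 2 * hypX w z +
      (2 * a * w.re + b) / 2 * hypY w z - k) := by
  have := z.im_pos
  have := w.im_pos
  rw [cosh_dist_eq]; unfold hypX hypY circleForm
  field_simp; ring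

lemma exists_cos_sin {x y M : ℝ} (hM : 0 < M) (h : x ^ 2 + y ^ 2 = M ^ 2) :
    ∃ ψ : ℝ, x = M * Real.cos ψ ∧ y = M * Real.sin ψ := by
  have hn : ‖(⟨x, y⟩ : ℂ)‖ = M := by
    rw [← sq_eq_sq₀ (norm_nonneg _) hM.le, Complex.sq_norm, Complex.normSq_apply]
    simp only; linarith
  refine ⟨Complex.arg ⟨x, y⟩, ?_, ?_⟩
  · have := Complex.norm_mul_cos_arg ⟨x, y⟩; rw [hn] at this; exact this.symm
  · have := Complex.norm_mul_sin_arg ⟨x, y⟩; rw [hn] at this; exact this.symm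

/-- A generalized circle perpendicular to a circle is given by a `perpForm`. -/
lemma exists_perpForm {k r : ℝ} {C D : Set ℍ} {w t : ℍ} (hr : 0 < r)
    (hC : IsGeneralizedCircle k C D) (hp : PerpendicularAt (Metric.sphere w r) C t) :
    ∃ ψ, C = {z | perpForm w r k ψ z = 0} ∧ D = {z | perpForm w r k ψ z < 0} := by
  obtain ⟨a, b, c, h, rfl, rfl⟩ := hC.exists_circleForm
  have hs := Real.sinh_pos_iff.2 hr
  have hcs := Real.cosh_sq r
  have hw := w.im_pos
  have hts := hp.1
  have htc := hp.2.1
  rw [sphere_eq_circleForm w hr] at hp hts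
  rw [perpendicularAt_iff (by rw [div_pow, div_pow, hcs]; field_simp; ring) h hts htc] at hp
  set p := (a * w.im + (a * w.re ^ 2 + b * w.re + c) / w.im) / 2 with hpd
  set q₁ := (a * w.im - (a * w.re ^ 2 + b * w.re + c) / w.im) / 2 with hq₁
  set q₂ := (2 * a * w.re + b) / 2 with hq₂
  -- perpendicularity fixes the timelike coefficient, the normalization then the norm of the others
  have hpk : p = k * Real.cosh r := by
    rw [hpd]; field_simp at hp ⊢
    linear_combination hp / 2
  have hq : q₁ ^ 2 + q₂ ^ 2 = p ^ 2 - k ^ 2 + 1 := by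
    rw [hpd, hq₁, hq₂]; field_simp
    linear_combination (-w.im ^ 2) * h
  have hM : (-q₁) ^ 2 + (-q₂) ^ 2 = √(1 + k ^ 2 * Real.sinh r ^ 2) ^ 2 := by
    rw [Real.sq_sqrt (by positivity), neg_sq, neg_sq, hq, hpk, mul_pow, hcs]; ring
  obtain ⟨ψ, h1, h2⟩ := exists_cos_sin (Real.sqrt_pos.2 (by positivity)) hM
  have key : ∀ z, circleForm a b c k z = 2 * z.im * perpForm w r k ψ z := by
    intro z
    rw [circleForm_eq_hyp a b c k w z, ← hpd, ← hq₁, ← hq₂, hpk, perpForm]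
    linear_combination (-2 * z.im * hypX w z) * h1 + (-2 * z.im * hypY w z) * h2
  refine ⟨ψ, ?_, ?_⟩ <;> ext z <;> have hz := z.im_pos <;> rw [mem_ofPred_eq, mem_ofPred_eq, key]
  · rw [mul_eq_zero, or_iff_right (by positivity)]
  · rw [← neg_pos, ← mul_neg, mul_pos_iff_of_pos_left (by positivity), neg_pos]

/-- The coefficients of the quadratic form of a circle perpendicular to a circle centred at `i`. -/
lemma perpForm_I (r k ψ : ℝ) (z : ℍ) :
    circleForm (k * Real.cosh r - √(1 + k ^ 2 * Real.sinh r ^ 2) * Real.cos ψ)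
      (-2 * √(1 + k ^ 2 * Real.sinh r ^ 2) * Real.sin ψ)
      (k * Real.cosh r + √(1 + k ^ 2 * Real.sinh r ^ 2) * Real.cos ψ) k z =
      2 * z.im * perpForm I r k ψ z := by
  rw [circleForm_eq_hyp _ _ _ _ I z, perpForm]
  simp only [I_im, I_re]; ring

lemma perpForm_I_det (r k ψ : ℝ) :
    4 * (k * Real.cosh r - √(1 + k ^ 2 * Real.sinh r ^ 2) * Real.cos ψ) *
      (k * Real.cosh r + √(1 + k ^ 2 * Real.sinh r ^ 2) * Real.cos ψ) -
      (-2 * √(1 + k ^ 2 * Real.sinh r ^ 2) * Real.sin ψ) ^ 2 = 4 * (k ^ 2 - 1) := by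
  have h1 : √(1 + k ^ 2 * Real.sinh r ^ 2) ^ 2 = 1 + k ^ 2 * Real.sinh r ^ 2 :=
    Real.sq_sqrt (by positivity)
  have h2 := Real.cosh_sq r
  have h3 := Real.sin_sq_add_cos_sq ψ
  linear_combination (-4 * (Real.sin ψ ^ 2 + Real.cos ψ ^ 2)) * h1 + 4 * k ^ 2 * h2
    - 4 * (1 + k ^ 2 * Real.sinh r ^ 2) * h3

lemma setOf_perpForm_I (r k ψ : ℝ) :
    {z | perpForm I r k ψ z = 0} =
      {z | circleForm (k * Real.cosh r - √(1 + k ^ 2 * Real.sinh r ^ 2) * Real.cos ψ)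
      (-2 * √(1 + k ^ 2 * Real.sinh r ^ 2) * Real.sin ψ)
      (k * Real.cosh r + √(1 + k ^ 2 * Real.sinh r ^ 2) * Real.cos ψ) k z = 0} := by
  ext z
  have hz := z.im_pos
  rw [mem_ofPred_eq, mem_ofPred_eq, perpForm_I, mul_eq_zero, or_iff_right (by positivity)]

lemma isGeneralizedCircle_perpForm_I {k : ℝ} (hk : 0 < k) (r ψ : ℝ) :
    IsGeneralizedCircle k {z | perpForm I r k ψ z = 0} {z | perpForm I r k ψ z < 0} := by
  have h2 : {z | perpForm I r k ψ z < 0} =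
      {z | circleForm (k * Real.cosh r - √(1 + k ^ 2 * Real.sinh r ^ 2) * Real.cos ψ)
      (-2 * √(1 + k ^ 2 * Real.sinh r ^ 2) * Real.sin ψ)
      (k * Real.cosh r + √(1 + k ^ 2 * Real.sinh r ^ 2) * Real.cos ψ) k z < 0} := by
    ext z
    have hz := z.im_pos
    rw [mem_ofPred_eq, mem_ofPred_eq, perpForm_I, ← neg_pos (a := 2 * z.im * _), ← mul_neg,
      mul_pos_iff_of_pos_left (by positivity), neg_pos]
  rw [h2, setOf_perpForm_I]
  have := Real.cosh_pos r
  exact isGeneralizedCircle_of_circleForm hk (by ring_nf; positivity) (perpForm_I_det r k ψ)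

/-! ### Rigidity of the packing of a polygon -/

/-- Points of the circle of centre `w` and radius `r` in direction `φ`. -/
lemma exists_mem_sphere (w : ℍ) {r : ℝ} (hr : 0 < r) (φ : ℝ) : ∃ z : ℍ, dist z w = r ∧
    hypX w z = Real.sinh r * Real.cos φ ∧ hypY w z = Real.sinh r * Real.sin φ := by
  obtain ⟨z, hX, hY, hd⟩ := exists_hyp_eq w (Real.sinh r * Real.cos φ) (Real.sinh r * Real.sin φ)
  refine ⟨z, ?_, hX, hY⟩
  refine Real.cosh_strictMonoOn.injOn (dist_nonneg (x := z) (y := w)) hr.le ?_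
  have hcs := Real.cosh_sq r
  rw [hd, ← sq_eq_sq₀ (Real.sqrt_nonneg _) (Real.cosh_pos r).le, Real.sq_sqrt (by positivity), hcs]
  linear_combination Real.sinh r ^ 2 * Real.sin_sq_add_cos_sq φ

lemma exists_direction {w z : ℍ} {r : ℝ} (hr : 0 < r) (hz : dist z w = r) :
    ∃ φ, hypX w z = Real.sinh r * Real.cos φ ∧ hypY w z = Real.sinh r * Real.sin φ := by
  refine exists_cos_sin (Real.sinh_pos_iff.2 hr) ?_
  have := cosh_dist_sq_eq w z
  rw [hz, Real.cosh_sq] at this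
  linarith

/-- The half-angle of the arc of the dual circle of radius `r` enclosed by a circle of curvature
`k`. -/
noncomputable def halfAngle (k r : ℝ) : ℝ := Real.pi / 2 - Real.arctan (k * Real.sinh r)

lemma halfAngle_pos (k r : ℝ) : 0 < halfAngle k r := by
  have := Real.arctan_lt_pi_div_two (k * Real.sinh r)
  unfold halfAngle; linarith

lemma halfAngle_lt {k r : ℝ} (hk : 0 < k) (hr : 0 < r) : halfAngle k r < Real.pi / 2 := by
  have := Real.arctan_pos.2 (mul_pos hk (Real.sinh_pos_iff.2 hr))
  unfold halfAngle; linarith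

/-- The disk of a `perpForm` meets the dual circle in the arc of half-length `halfAngle k r` centred
at the direction `ψ`. -/
lemma perpForm_on_sphere {w z : ℍ} {r k ψ φ : ℝ} (hz : dist z w = r)
    (hX : hypX w z = Real.sinh r * Real.cos φ) (hY : hypY w z = Real.sinh r * Real.sin φ) :
    perpForm w r k ψ z = √(1 + k ^ 2 * Real.sinh r ^ 2) * Real.sinh r *
      (Real.cos (halfAngle k r) - Real.cos (φ - ψ)) := by
  have h0 : √(1 + k ^ 2 * Real.sinh r ^ 2) ≠ 0 := (Real.sqrt_pos.2 (by positivity)).ne'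
  rw [perpForm, hz, hX, hY, halfAngle, Real.cos_pi_div_two_sub, Real.sin_arctan, Real.cos_sub,
    mul_pow]
  have := Real.cosh_sq r
  field_simp
  linear_combination k * this

/-- The angles of a packing around the centre of the dual circle add up to `2π`. -/
theorem PolygonPacking.sum_halfAngle {n : ℕ} (hn : 3 ≤ n) {k : Fin n → ℝ} (hk : ∀ i, 0 < k i)
    (Q : PolygonPacking n k) :
    (∑ i, halfAngle (k i) Q.radius = Real.pi) ∧ ∀ i, ∃ ψ,
      Q.circle i = {z | perpForm Q.center Q.radius (k i) ψ z = 0} := by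
  have hr := Q.radius_pos
  have hs := Real.sinh_pos_iff.2 hr
  have hM : ∀ k : ℝ, 0 < √(1 + k ^ 2 * Real.sinh Q.radius ^ 2) * Real.sinh Q.radius := fun k =>
    mul_pos (Real.sqrt_pos.2 (by positivity)) hs
  have hperp : ∀ i j, (SimpleGraph.cycleGraph n).Adj i j → ∃ t, t ∈ Q.circle j ∧
      PerpendicularAt (Metric.sphere Q.center Q.radius) (Q.circle i) t := by
    intro i j hij
    obtain ⟨t, ht⟩ := (Q.tangent_iff_adj i j hij.ne).2 hij
    exact ⟨t, ht.2.1, Q.perpendicular i j t hij.ne ht⟩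
  have hex : ∀ i : Fin n, ∃ j, (SimpleGraph.cycleGraph n).Adj i j := by
    obtain ⟨n, rfl⟩ : ∃ m, n = m + 2 := ⟨n - 2, by omega⟩
    intro i
    exact ⟨i + 1, by rw [SimpleGraph.cycleGraph_adj]; right; simp⟩
  have hψ : ∀ i, ∃ ψ, Q.circle i = {z | perpForm Q.center Q.radius (k i) ψ z = 0} ∧
      Q.disk i = {z | perpForm Q.center Q.radius (k i) ψ z < 0} := by
    intro i
    obtain ⟨j, hj⟩ := hex i
    obtain ⟨t, -, ht⟩ := hperp i j hj
    exact exists_perpForm hr (Q.isGeneralizedCircle i) ht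
  choose ψ hC hD using hψ
  refine ⟨?_, fun i => ⟨ψ i, hC i⟩⟩
  refine sum_arcs_eq_pi hn (ψ := ψ) (fun i => halfAngle_pos _ _)
    (fun i => halfAngle_lt (hk i) hr) ?_ ?_
  · intro i j hij φ hi hj
    obtain ⟨z, hz, hX, hY⟩ := exists_mem_sphere Q.center hr φ
    have mem : ∀ l, Real.cos (halfAngle (k l) Q.radius) < Real.cos (φ - ψ l) → z ∈ Q.disk l := by
      intro l hl
      rw [hD l, mem_ofPred_eq, perpForm_on_sphere hz hX hY]
      exact mul_neg_of_pos_of_neg (hM _) (by linarith)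
    exact Set.disjoint_left.1 (Q.disjoint_disk i j hij) (mem i hi) (mem j hj)
  · intro i j hij
    obtain ⟨t, htj, ht⟩ := hperp i j hij
    obtain ⟨φ, hX, hY⟩ := exists_direction hr ht.1
    have eq : ∀ l, t ∈ Q.circle l → Real.cos (φ - ψ l) = Real.cos (halfAngle (k l) Q.radius) := by
      intro l hl
      rw [hC l, mem_ofPred_eq, perpForm_on_sphere ht.1 hX hY, mul_eq_zero,
        or_iff_right (hM _).ne'] at hl
      linarith
    exact ⟨φ, eq i ht.2.1, eq j htj⟩

/-! ### The total geodesic curvature of an arc -/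

/-- The total geodesic curvature of the arc that a circle of radius `r` cuts from a generalized
circle of curvature `k` perpendicular to it, as an integral over the radii up to `r`. -/
noncomputable def arcCurvature (k r : ℝ) : ℝ :=
  ∫ ρ in (0 : ℝ)..r, 2 * k / (1 + k ^ 2 * Real.sinh ρ ^ 2)

/-- The arc enclosed by the dual circle has a parametrization by an interval `[-v₀, v₀]` in which
the coordinates are rational functions, and distances are given by a simple formula for all curvatures
`k`, whether the arc belongs to a circle, a horocycle or a hypercycle. -/
lemma arc_eq_image {k r : ℝ} (hk : 0 < k) (hr : 0 < r) (w : ℍ) (ψ : ℝ) {M v₀ : ℝ}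
    (hM : M = √(1 + k ^ 2 * Real.sinh r ^ 2)) (hv₀ : v₀ = Real.sinh r / (Real.cosh r + M)) :
    (0 < v₀ ∧ v₀ < 1) ∧ ∃ γ : ℝ → ℍ,
      (∀ s ∈ Icc (-v₀) v₀, ∀ s' ∈ Icc (-v₀) v₀, Real.cosh (dist (γ s) (γ s')) =
        1 + 2 * (s - s') ^ 2 / ((1 + (k ^ 2 - 1) * s ^ 2) * (1 + (k ^ 2 - 1) * s' ^ 2))) ∧
      γ '' Icc (-v₀) v₀ = {z | perpForm w r k ψ z = 0} ∩ Metric.closedBall w r := by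
  have hs := Real.sinh_pos_iff.2 hr
  have hc := Real.cosh_pos r
  have hcs := Real.cosh_sq r
  have hsc := Real.sinh_lt_cosh r
  have hM0 : 0 < M := hM ▸ Real.sqrt_pos.2 (by positivity)
  have hM2 : M ^ 2 = 1 + k ^ 2 * Real.sinh r ^ 2 := by rw [hM]; exact Real.sq_sqrt (by positivity)
  unfold perpForm
  rw [← hM]
  set s := Real.sinh r with hsdef
  set c := Real.cosh r with hcdef
  have hv0 : 0 < v₀ := by rw [hv₀]; positivity
  have hv1 : v₀ < 1 := by rw [hv₀, div_lt_one (by positivity)]; linarith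
  refine ⟨⟨hv0, hv1⟩, ?_⟩
  have hQ : ∀ v, v ^ 2 ≤ v₀ ^ 2 → 0 < 1 + (k ^ 2 - 1) * v ^ 2 := by
    intro v hv
    have : v₀ ^ 2 < 1 := by nlinarith
    nlinarith [mul_nonneg (sq_nonneg k) (sq_nonneg v)]
  have hD : 0 < k ^ 2 * c + M := by positivity
  -- the hyperboloid coordinates of the point of the arc nearest to `w`
  obtain ⟨m₀, hm₀⟩ : ∃ m₀, m₀ = (1 + k ^ 2 * c ^ 2) / (k ^ 2 * c + M) := ⟨_, rfl⟩
  obtain ⟨m₁, hm₁⟩ : ∃ m₁, m₁ = k * (c * M - 1) / (k ^ 2 * c + M) := ⟨_, rfl⟩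
  have hm0 : 0 < m₀ := by rw [hm₀]; positivity
  have e1 : k * c * m₀ - M * m₁ = k := by
    rw [hm₀, hm₁]; field_simp
    linear_combination -c * hM2 + c * k ^ 2 * hcs
  have e2 : M * m₀ - k * c * m₁ = 1 := by
    rw [hm₀, hm₁]; field_simp; ring
  have e3 : m₀ ^ 2 - m₁ ^ 2 = 1 := by
    have : m₀ ^ 2 - m₁ ^ 2 = ((1 + k ^ 2 * c ^ 2) ^ 2 - (k * (c * M - 1)) ^ 2) / (k ^ 2 * c + M) ^ 2 := by
      rw [hm₀, hm₁]; field_simp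
    rw [this, div_eq_one_iff_eq (by positivity)]
    linear_combination (-k ^ 2 * c ^ 2 - 1) * hM2 + k ^ 2 * (1 + k^2*c^2) * hcs
  have e4 : M ^ 2 - k ^ 2 * c ^ 2 = 1 - k ^ 2 := by rw [hM2, hcs]; ring
  have hMc : m₀ + M * (s ^ 2 / (M * (c + M))) = c := by
    rw [hm₀]; field_simp
    linear_combination (-c) * hM2 - M * hcs
  have hq₀ : 2 * v₀ ^ 2 = (s ^ 2 / (M * (c + M))) * (1 + (k ^ 2 - 1) * v₀ ^ 2) := by
    rw [hv₀]; field_simp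
    linear_combination hM2 - hcs
  have hqv : ∀ v, 0 < 1 + (k ^ 2 - 1) * v ^ 2 →
      (2 * v ^ 2 / (1 + (k ^ 2 - 1) * v ^ 2) ≤ s ^ 2 / (M * (c + M)) ↔ v ^ 2 ≤ v₀ ^ 2) := by
    intro v hv
    have h0 := hQ v₀ le_rfl
    have h1 : s ^ 2 / (M * (c + M)) = 2 * v₀ ^ 2 / (1 + (k ^ 2 - 1) * v₀ ^ 2) := by
      rw [hq₀]; field_simp
    rw [h1, div_le_div_iff₀ hv h0]
    constructor <;> intro h <;> linarith
  -- the parametrization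
  have hγ : ∀ v, ∃ z : ℍ, v ^ 2 ≤ v₀ ^ 2 →
      Real.cos ψ * hypX w z + Real.sin ψ * hypY w z =
        m₁ + k * c * (2 * v ^ 2 / (1 + (k ^ 2 - 1) * v ^ 2)) ∧
      -Real.sin ψ * hypX w z + Real.cos ψ * hypY w z = 2 * v / (1 + (k ^ 2 - 1) * v ^ 2) ∧
      Real.cosh (dist z w) = m₀ + M * (2 * v ^ 2 / (1 + (k ^ 2 - 1) * v ^ 2)) := by
    intro v
    obtain ⟨Q, hQd⟩ : ∃ Q, Q = 1 + (k ^ 2 - 1) * v ^ 2 := ⟨_, rfl⟩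
    rw [← hQd]
    obtain ⟨ξ, hξ⟩ : ∃ ξ, ξ = m₁ + k * c * (2 * v ^ 2 / Q) := ⟨_, rfl⟩
    obtain ⟨η, hη⟩ : ∃ η, η = 2 * v / Q := ⟨_, rfl⟩
    obtain ⟨z, hX, hY, hU⟩ := exists_hyp_eq w (Real.cos ψ * ξ - Real.sin ψ * η)
      (Real.sin ψ * ξ + Real.cos ψ * η)
    have hcs' := Real.sin_sq_add_cos_sq ψ
    refine ⟨z, fun hv => ⟨?_, ?_, ?_⟩⟩
    · rw [hX, hY, ← hξ]; linear_combination ξ * hcs'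
    · rw [hX, hY, ← hη]; linear_combination η * hcs'
    · have hQ0 : 0 < Q := hQd ▸ hQ v hv
      rw [hU, ← sq_eq_sq₀ (Real.sqrt_nonneg _) (by positivity), Real.sq_sqrt (by positivity)]
      have h1 : (Real.cos ψ * ξ - Real.sin ψ * η) ^ 2 + (Real.sin ψ * ξ + Real.cos ψ * η) ^ 2 =
          ξ ^ 2 + η ^ 2 := by linear_combination (ξ ^ 2 + η ^ 2) * hcs'
      obtain ⟨q, hq⟩ : ∃ q, q = 2 * v ^ 2 / Q := ⟨_, rfl⟩
      have h2 : η ^ 2 = 2 * q + (1 - k ^ 2) * q ^ 2 := by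
        rw [hη, hq]; field_simp; rw [hQd]; ring
      rw [← hq] at hξ ⊢
      rw [add_assoc, h1, h2, hξ]
      linear_combination -e3 - 2 * q * e2 - q ^ 2 * e4
  choose γ hγ using hγ
  have habs : ∀ v, v ∈ Icc (-v₀) v₀ ↔ v ^ 2 ≤ v₀ ^ 2 := by
    intro v; rw [sq_le_sq, abs_of_pos hv0, abs_le, mem_Icc]
  refine ⟨γ, ?_, ?_⟩
  · intro v hv v' hv'
    rw [habs] at hv hv'
    obtain ⟨a1, a2, a3⟩ := hγ v hv
    obtain ⟨b1, b2, b3⟩ := hγ v' hv'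
    have hQv := hQ v hv
    have hQv' := hQ v' hv'
    rw [cosh_dist_eq_hyp w]
    have hcs' := Real.sin_sq_add_cos_sq ψ
    have rot : hypX w (γ v) * hypX w (γ v') + hypY w (γ v) * hypY w (γ v') =
        (Real.cos ψ * hypX w (γ v) + Real.sin ψ * hypY w (γ v)) *
          (Real.cos ψ * hypX w (γ v') + Real.sin ψ * hypY w (γ v')) +
        (-Real.sin ψ * hypX w (γ v) + Real.cos ψ * hypY w (γ v)) *
          (-Real.sin ψ * hypX w (γ v') + Real.cos ψ * hypY w (γ v')) := by
      linear_combination (-(hypX w (γ v) * hypX w (γ v') + hypY w (γ v) * hypY w (γ v'))) * hcs'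
    rw [sub_sub, rot, a1, a2, a3, b1, b2, b3]
    have h3 : 1 + 2 * (v - v') ^ 2 / ((1 + (k ^ 2 - 1) * v ^ 2) * (1 + (k ^ 2 - 1) * v' ^ 2)) =
        1 + 2 * v ^ 2 / (1 + (k ^ 2 - 1) * v ^ 2) + 2 * v' ^ 2 / (1 + (k ^ 2 - 1) * v' ^ 2) +
          (1 - k ^ 2) * (2 * v ^ 2 / (1 + (k ^ 2 - 1) * v ^ 2)) *
            (2 * v' ^ 2 / (1 + (k ^ 2 - 1) * v' ^ 2)) -
          (2 * v / (1 + (k ^ 2 - 1) * v ^ 2)) * (2 * v' / (1 + (k ^ 2 - 1) * v' ^ 2)) := by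
      generalize hA : 1 + (k ^ 2 - 1) * v ^ 2 = A at hQv ⊢
      generalize hA' : 1 + (k ^ 2 - 1) * v' ^ 2 = A' at hQv' ⊢
      field_simp
      rw [← hA, ← hA']; ring
    rw [h3]
    linear_combination e3 + (2 * v ^ 2 / (1 + (k ^ 2 - 1) * v ^ 2) +
      2 * v' ^ 2 / (1 + (k ^ 2 - 1) * v' ^ 2)) * e2 + (2 * v ^ 2 / (1 + (k ^ 2 - 1) * v ^ 2)) *
      (2 * v' ^ 2 / (1 + (k ^ 2 - 1) * v' ^ 2)) * e4
  · have ball : ∀ z : ℍ, z ∈ Metric.closedBall w r ↔ Real.cosh (dist z w) ≤ c := by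
      intro z
      rw [Metric.mem_closedBall, hcdef, Real.cosh_le_cosh, abs_of_nonneg dist_nonneg, abs_of_pos hr]
    apply Subset.antisymm
    · rintro _ ⟨v, hv, rfl⟩
      rw [habs] at hv
      obtain ⟨a1, a2, a3⟩ := hγ v hv
      refine ⟨?_, ?_⟩
      · rw [mem_ofPred_eq, a1, a3]; linear_combination e1
      · rw [ball, a3, ← hMc]
        have := mul_le_mul_of_nonneg_left ((hqv v (hQ v hv)).2 hv) hM0.le
        linarith
    · rintro z ⟨hz1, hz2⟩
      rw [ball] at hz2
      rw [mem_ofPred_eq] at hz1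
      have hU1 := Real.one_le_cosh (dist z w)
      have hUsq := cosh_dist_sq_eq w z
      have hcs' := Real.sin_sq_add_cos_sq ψ
      set U := Real.cosh (dist z w) with hU
      obtain ⟨ξ, hξ⟩ : ∃ ξ, ξ = Real.cos ψ * hypX w z + Real.sin ψ * hypY w z := ⟨_, rfl⟩
      obtain ⟨η, hη⟩ : ∃ η, η = -Real.sin ψ * hypX w z + Real.cos ψ * hypY w z := ⟨_, rfl⟩
      have hsq : U ^ 2 = 1 + ξ ^ 2 + η ^ 2 := by
        rw [hUsq, hξ, hη]
        linear_combination (-(hypX w z ^ 2 + hypY w z ^ 2)) * hcs'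
      rw [← hξ] at hz1
      -- the parameter of `z` is the half-angle substitution `η / (1 + l)` on the conic
      -- `l ^ 2 + (k ^ 2 - 1) * η ^ 2 = 1`
      obtain ⟨l, hl⟩ : ∃ l, l = M * U - k * c * ξ := ⟨_, rfl⟩
      have hlpos : 0 < l := by
        have : M * l = U + k ^ 2 * (c - U) := by
          rw [hl]; linear_combination k * c * hz1 + U * e4
        have h2 : 0 < U + k ^ 2 * (c - U) := by
          have := mul_nonneg (sq_nonneg k) (sub_nonneg.2 hz2)
          linarith
        rw [← this] at h2
        exact (mul_pos_iff_of_pos_left hM0).1 h2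
      have hl2 : l ^ 2 + (k ^ 2 - 1) * η ^ 2 = 1 := by
        have h0 : k * c * U - M * ξ = k := by linarith
        have h1 : (k * c * U - M * ξ) ^ 2 = k ^ 2 := by rw [h0]
        rw [hl]
        linear_combination (U ^ 2 - ξ ^ 2) * e4 + (1 - k ^ 2) * hsq + h1
      obtain ⟨v, hv⟩ : ∃ v, v = η / (1 + l) := ⟨_, rfl⟩
      have hQv : 1 + (k ^ 2 - 1) * v ^ 2 = 2 / (1 + l) := by
        rw [hv]; field_simp; linear_combination hl2
      have hQpos : 0 < 1 + (k ^ 2 - 1) * v ^ 2 := by rw [hQv]; positivity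
      have hη' : 2 * v / (1 + (k ^ 2 - 1) * v ^ 2) = η := by rw [hQv, hv]; field_simp
      obtain ⟨q, hq⟩ : ∃ q, q = 2 * v ^ 2 / (1 + (k ^ 2 - 1) * v ^ 2) := ⟨_, rfl⟩
      have hq' : q * (1 + l) = η ^ 2 := by rw [hq, hQv, hv]; field_simp
      have hU' : U = m₀ + M * q := by
        have h1 : k * c * (U - m₀) = M * (ξ - m₁) := by linear_combination hz1 - e1
        obtain ⟨lam, hlam⟩ : ∃ lam, lam = (U - m₀) / M := ⟨_, rfl⟩
        have hl1 : U = m₀ + M * lam := by rw [hlam]; field_simp; ring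
        have hl3 : ξ = m₁ + k * c * lam := by
          have : M * ξ = M * (m₁ + k * c * lam) := by
            rw [hl1] at h1; linear_combination -h1
          exact mul_left_cancel₀ hM0.ne' this
        have hl4 : l - 1 = lam * (1 - k ^ 2) := by
          rw [hl, hl1, hl3]; linear_combination e2 + lam * e4
        have hl5 : lam * (1 + l) = η ^ 2 := by
          rw [hl1, hl3] at hsq
          linear_combination hsq - e3 - 2 * lam * e2 - lam ^ 2 * e4 + lam * hl4
        have : lam = q := by
          have h9 : lam * (1 + l) = q * (1 + l) := by rw [hl5, hq']
          exact mul_right_cancel₀ (by positivity : (1 + l) ≠ 0) h9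
        rw [hl1, this]
      have hξ' : ξ = m₁ + k * c * q := by
        have : M * ξ = M * (m₁ + k * c * q) := by
          rw [hU'] at hz1; linear_combination -hz1 + e1
        exact mul_left_cancel₀ hM0.ne' this
      have hvv : v ^ 2 ≤ v₀ ^ 2 := by
        rw [← hqv v hQpos, ← hq]
        rw [hU', ← hMc, add_le_add_iff_left, mul_le_mul_iff_right₀ hM0] at hz2
        exact hz2
      refine ⟨v, (habs v).2 hvv, ?_⟩
      obtain ⟨a1, a2, a3⟩ := hγ v hvv
      have hXX : hypX w (γ v) = hypX w z := by
        rw [← hq, ← hξ', hξ] at a1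
        rw [hη', hη] at a2
        linear_combination Real.cos ψ * a1 - Real.sin ψ * a2 - (hypX w (γ v) - hypX w z) * hcs'
      have hYY : hypY w (γ v) = hypY w z := by
        rw [← hq, ← hξ', hξ] at a1
        rw [hη', hη] at a2
        linear_combination Real.sin ψ * a1 + Real.cos ψ * a2 - (hypY w (γ v) - hypY w z) * hcs'
      -- equal coordinates force distance zero
      have hd : Real.cosh (dist (γ v) z) = 1 := by
        have hUU : Real.cosh (dist (γ v) w) = U := by rw [a3, ← hq, hU']
        rw [cosh_dist_eq_hyp w, hXX, hYY, hUU, ← hU]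
        linear_combination hUsq
      by_contra hne
      exact absurd hd (Real.one_lt_cosh.2 (dist_ne_zero.2 hne)).ne'

/-- The substitution `v = sinh ρ / (cosh ρ + √(1 + k² sinh² ρ))` turns the length of the arc into
the integral `arcCurvature`: a dual circle of radius `ρ` encloses the parameters `[-v, v]`. -/
lemma integral_two_div_eq {k r : ℝ} (hr : 0 < r) {v₀ : ℝ}
    (hv₀ : v₀ = Real.sinh r / (Real.cosh r + √(1 + k ^ 2 * Real.sinh r ^ 2))) :
    k * ∫ v in (-v₀)..v₀, 2 / (1 + (k ^ 2 - 1) * v ^ 2) = arcCurvature k r := by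
  let V : ℝ → ℝ := fun ρ => Real.sinh ρ / (Real.cosh ρ + √(1 + k ^ 2 * Real.sinh ρ ^ 2))
  let V' : ℝ → ℝ := fun ρ => 1 / (√(1 + k ^ 2 * Real.sinh ρ ^ 2) *
    (Real.cosh ρ + √(1 + k ^ 2 * Real.sinh ρ ^ 2)))
  have hM : ∀ ρ, 0 < √(1 + k ^ 2 * Real.sinh ρ ^ 2) := fun ρ => Real.sqrt_pos.2 (by positivity)
  have hM2 : ∀ ρ, √(1 + k ^ 2 * Real.sinh ρ ^ 2) ^ 2 = 1 + k ^ 2 * Real.sinh ρ ^ 2 :=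
    fun ρ => Real.sq_sqrt (by positivity)
  have hV : ∀ ρ, HasDerivAt V (V' ρ) ρ := by
    intro ρ
    have h1 : HasDerivAt (fun ρ => 1 + k ^ 2 * Real.sinh ρ ^ 2)
        (k ^ 2 * (2 * Real.sinh ρ ^ (2 - 1) * Real.cosh ρ)) ρ :=
      (((Real.hasDerivAt_sinh ρ).pow 2).const_mul _).const_add _
    have h2 := h1.sqrt (by positivity)
    have h3 := (Real.hasDerivAt_sinh ρ).div ((Real.hasDerivAt_cosh ρ).add h2)
      (add_pos (Real.cosh_pos ρ) (hM ρ)).ne'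
    refine h3.congr_deriv ?_
    have hMρ := hM ρ
    have hMρ2 := hM2 ρ
    have hcs := Real.cosh_sq ρ
    have hc := Real.cosh_pos ρ
    simp only [V', Pi.add_apply]
    set M := √(1 + k ^ 2 * Real.sinh ρ ^ 2)
    field_simp
    linear_combination M * hcs + Real.cosh ρ * hMρ2
  have hVlt : ∀ ρ, V ρ ^ 2 < 1 := by
    intro ρ
    have hMρ := hM ρ
    have hcs := Real.cosh_sq ρ
    have hc := Real.cosh_pos ρ
    simp only [V, div_pow]
    rw [div_lt_one (by positivity)]
    nlinarith
  have hQ : ∀ ρ, 0 < 1 + (k ^ 2 - 1) * V ρ ^ 2 := by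
    intro ρ
    have := hVlt ρ
    nlinarith [mul_nonneg (sq_nonneg k) (sq_nonneg (V ρ))]
  have hV'c : Continuous V' := by
    refine continuous_const.div ?_ fun ρ => (mul_pos (hM ρ) (add_pos (Real.cosh_pos ρ) (hM ρ))).ne'
    have := Real.continuous_sinh
    have := Real.continuous_cosh
    fun_prop
  have hsub : ∫ ρ in (0 : ℝ)..r, ((fun v => 2 / (1 + (k ^ 2 - 1) * v ^ 2)) ∘ V) ρ * V' ρ =
      ∫ v in V 0..V r, 2 / (1 + (k ^ 2 - 1) * v ^ 2) := by
    refine intervalIntegral.integral_comp_mul_deriv' (fun ρ _ => hV ρ) hV'c.continuousOn ?_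
    rintro _ ⟨ρ, -, rfl⟩
    refine ContinuousAt.continuousWithinAt ?_
    exact ContinuousAt.div continuousAt_const (by fun_prop) (hQ ρ).ne'
  have hint : IntervalIntegrable (fun v => 2 / (1 + (k ^ 2 - 1) * v ^ 2)) volume (-v₀) v₀ := by
    refine ContinuousOn.intervalIntegrable fun v hv => ContinuousAt.continuousWithinAt ?_
    have hv0 : 0 ≤ v₀ := by
      rw [hv₀]
      exact div_nonneg (Real.sinh_nonneg_iff.2 hr.le) (add_pos (Real.cosh_pos r) (hM r)).le
    rw [uIcc_of_le (by linarith)] at hv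
    have h1 : v ^ 2 ≤ v₀ ^ 2 := by rw [sq_le_sq, abs_of_nonneg hv0, abs_le]; exact hv
    have h2 : v₀ ^ 2 < 1 := by rw [hv₀]; exact hVlt r
    refine ContinuousAt.div continuousAt_const (by fun_prop) (ne_of_gt ?_)
    nlinarith [mul_nonneg (sq_nonneg k) (sq_nonneg v)]
  have heven : ∫ v in (-v₀)..v₀, 2 / (1 + (k ^ 2 - 1) * v ^ 2) =
      2 * ∫ v in (0 : ℝ)..v₀, 2 / (1 + (k ^ 2 - 1) * v ^ 2) := by
    have h0 : (0 : ℝ) ∈ uIcc (-v₀) v₀ := by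
      rcases le_total 0 v₀ with h | h
      · rw [uIcc_of_le (by linarith)]; constructor <;> linarith
      · rw [uIcc_of_ge (by linarith)]; constructor <;> linarith
    rw [← intervalIntegral.integral_add_adjacent_intervals
      (hint.mono_set (uIcc_subset_uIcc_left h0)) (hint.mono_set (uIcc_subset_uIcc_right h0)), two_mul]
    congr 1
    have := intervalIntegral.integral_comp_neg (a := 0) (b := v₀)
      (fun v => 2 / (1 + (k ^ 2 - 1) * v ^ 2))
    simp only [neg_sq, neg_zero] at this
    exact this.symm
  have hV0 : V 0 = 0 := by simp [V]
  have hVr : V r = v₀ := hv₀.symm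
  rw [heven, ← hV0, ← hVr, ← hsub, arcCurvature, ← mul_assoc, ← intervalIntegral.integral_const_mul]
  refine intervalIntegral.integral_congr fun ρ _ => ?_
  have hMρ := hM ρ
  have hMρ2 := hM2 ρ
  have hcs := Real.cosh_sq ρ
  have hc := Real.cosh_pos ρ
  have hQρ : 1 + (k ^ 2 - 1) * V ρ ^ 2 = 2 * √(1 + k ^ 2 * Real.sinh ρ ^ 2) /
      (Real.cosh ρ + √(1 + k ^ 2 * Real.sinh ρ ^ 2)) := by
    simp only [V]
    set M := √(1 + k ^ 2 * Real.sinh ρ ^ 2)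
    field_simp
    linear_combination hcs - hMρ2
  simp only [Function.comp, hQρ, V']
  rw [show 2 * k / (1 + k ^ 2 * Real.sinh ρ ^ 2) =
    2 * k / √(1 + k ^ 2 * Real.sinh ρ ^ 2) ^ 2 by rw [hMρ2]]
  set M := √(1 + k ^ 2 * Real.sinh ρ ^ 2)
  field_simp

/-- The curvature times the length of the arc enclosed by the dual circle. -/
theorem arc_length {k r : ℝ} (hk : 0 < k) (hr : 0 < r) (w : ℍ) (ψ : ℝ) :
    k * (Measure.hausdorffMeasure 1 : Measure ℍ).real
      ({z | perpForm w r k ψ z = 0} ∩ Metric.closedBall w r) = arcCurvature k r := by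
  obtain ⟨⟨hv0, hv1⟩, γ, hd, him⟩ := arc_eq_image hk hr w ψ rfl rfl
  rw [← him, ← integral_two_div_eq hr rfl]
  congr 1
  refine hausdorffMeasure_image_Icc_of_cosh_dist (by linarith) (by fun_prop) ?_ hd
  intro t ht
  have : t ^ 2 < 1 := by
    rw [sq_lt_one_iff_abs_lt_one, abs_lt]; constructor <;> linarith [ht.1, ht.2]
  nlinarith [mul_nonneg (sq_nonneg k) (sq_nonneg t)]

/-- The total curvatures of a packing depend only on the curvatures and the radius of the dual
circle. -/
theorem PolygonPacking.totalCurvature_eq {n : ℕ} (hn : 3 ≤ n) {k : Fin n → ℝ} (hk : ∀ i, 0 < k i)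
    (Q : PolygonPacking n k) (i : Fin n) : Q.totalCurvature i = arcCurvature (k i) Q.radius := by
  obtain ⟨ψ, hψ⟩ := (Q.sum_halfAngle hn hk).2 i
  rw [PolygonPacking.totalCurvature, setIntegral_const, smul_eq_mul, mul_comm, PolygonPacking.arc, hψ,
    arc_length (hk i) Q.radius_pos]

/-! ### Existence of the packing of a polygon -/

lemma cos_le_cos_of_between {α Δ : ℝ} (h0 : 0 ≤ α) (h1 : α ≤ Δ) (h2 : Δ ≤ 2 * Real.pi - α) :
    Real.cos Δ ≤ Real.cos α := by
  rcases le_total Δ Real.pi with h | h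
  · exact Real.cos_le_cos_of_nonneg_of_le_pi h0 h h1
  · rw [← Real.cos_two_pi_sub Δ]
    exact Real.cos_le_cos_of_nonneg_of_le_pi h0 (by linarith) (by linarith)

lemma cos_lt_cos_of_between {α Δ : ℝ} (h0 : 0 ≤ α) (h1 : α < Δ) (h2 : Δ < 2 * Real.pi - α) :
    Real.cos Δ < Real.cos α := by
  rcases le_total Δ Real.pi with h | h
  · exact Real.cos_lt_cos_of_nonneg_of_le_pi h0 h h1
  · rw [← Real.cos_two_pi_sub Δ]
    exact Real.cos_lt_cos_of_nonneg_of_le_pi h0 (by linarith) (by linarith)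

/-- Arcs of half-lengths `θ i` with sum `π` can be placed one after the other around a circle. -/
lemma exists_arrangement {n : ℕ} {θ : Fin n → ℝ} (h0 : ∀ i, 0 < θ i)
    (hsum : ∑ i, θ i = Real.pi) :
    ∃ ψ : Fin n → ℝ, ∀ i j, i ≠ j →
      (Real.cos (ψ i - ψ j) ≤ Real.cos (θ i + θ j)) ∧
      (¬ (SimpleGraph.cycleGraph n).Adj i j → Real.cos (ψ i - ψ j) < Real.cos (θ i + θ j)) ∧
      ((SimpleGraph.cycleGraph n).Adj i j → Real.cos (ψ i - ψ j) = Real.cos (θ i + θ j) ∧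
        ∃ φ, Real.cos (φ - ψ i) = Real.cos (θ i) ∧ Real.cos (φ - ψ j) = Real.cos (θ j)) := by
  -- `Φ m` is the total length of the first `m` arcs
  let Φ : ℕ → ℝ := fun m => ∑ l : Fin n with l.val < m, 2 * θ l
  have hΦs : ∀ i : Fin n, Φ (i + 1) = Φ i + 2 * θ i := by
    intro i
    have : (Finset.univ.filter fun l : Fin n => l.val < i + 1) =
        insert i (Finset.univ.filter fun l : Fin n => l.val < i) := by
      ext l
      simp only [Finset.mem_filter, Finset.mem_univ, true_and, Finset.mem_insert, Fin.ext_iff]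
      omega
    simp only [Φ]
    rw [this, Finset.sum_insert (by simp)]; ring
  have hΦm : Monotone Φ := by
    intro a b hab
    refine Finset.sum_le_sum_of_subset_of_nonneg ?_ fun l _ _ => by linarith [h0 l]
    intro l
    simp only [Finset.mem_filter, Finset.mem_univ, true_and]
    omega
  have hΦ0 : Φ 0 = 0 := by simp [Φ]
  have hΦn : Φ n = 2 * Real.pi := by
    simp only [Φ]
    rw [Finset.filter_true_of_mem fun l _ => l.2, ← Finset.mul_sum, hsum]
  have hΦlt : ∀ a b : ℕ, a < b → b ≤ n → Φ a < Φ b := by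
    intro a b hab hb
    have h1 := hΦs ⟨a, by omega⟩
    have h2 := hΦm (show a + 1 ≤ b from hab)
    have h3 := h0 ⟨a, by omega⟩
    simp only at h1
    linarith
  have main : ∀ i j : Fin n, i < j →
      (Real.cos ((Φ j + θ j) - (Φ i + θ i)) ≤ Real.cos (θ i + θ j)) ∧
      (¬ (SimpleGraph.cycleGraph n).Adj i j →
        Real.cos ((Φ j + θ j) - (Φ i + θ i)) < Real.cos (θ i + θ j)) ∧
      ((SimpleGraph.cycleGraph n).Adj i j →
        Real.cos ((Φ j + θ j) - (Φ i + θ i)) = Real.cos (θ i + θ j) ∧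
        ∃ φ, Real.cos (φ - (Φ i + θ i)) = Real.cos (θ i) ∧
          Real.cos (φ - (Φ j + θ j)) = Real.cos (θ j)) := by
    intro i j hij
    have hij' : i.val < j.val := hij
    have hi := h0 i
    have hj := h0 j
    have e1 := hΦs i
    have e2 := hΦs j
    have m1 : Φ (i + 1) ≤ Φ j := hΦm hij'
    have m2 : Φ (j + 1) ≤ Φ n := hΦm j.2
    have m3 : Φ 0 ≤ Φ i := hΦm (Nat.zero_le _)
    have hadj : (SimpleGraph.cycleGraph n).Adj i j ↔ (i.val = 0 ∧ j.val + 1 = n) ∨ i.val + 1 = j.val := by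
      rw [SimpleGraph.cycleGraph_adj', (Fin.coe_sub_iff_lt).2 hij, (Fin.coe_sub_iff_le).2 hij.le]
      have := j.2
      omega
    refine ⟨cos_le_cos_of_between (by linarith) (by linarith) (by linarith), ?_, ?_⟩
    · intro hna
      rw [hadj, not_or] at hna
      have m4 : Φ (i + 1) < Φ j := hΦlt _ _ (by omega) j.2.le
      refine cos_lt_cos_of_between (by linarith) (by linarith) ?_
      by_cases hi0 : i.val = 0
      · have := j.2
        have m5 : Φ (j + 1) < Φ n := hΦlt _ _ (by omega) le_rfl
        linarith
      · have m5 : Φ 0 < Φ i := hΦlt _ _ (by omega) i.2.le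
        linarith
    · intro ha
      rcases hadj.1 ha with ⟨hi0, hjn⟩ | h
      · rw [hjn] at e2
        rw [hi0] at e1
        rw [hi0]
        refine ⟨?_, 0, ?_, ?_⟩
        · rw [show Φ j + θ j - (Φ 0 + θ i) = 2 * Real.pi - (θ i + θ j) by linarith,
            Real.cos_two_pi_sub]
        · rw [hΦ0, zero_add, zero_sub, Real.cos_neg]
        · rw [show (0 : ℝ) - (Φ j + θ j) = -(2 * Real.pi - θ j) by linarith, Real.cos_neg,
            Real.cos_two_pi_sub]
      · rw [h] at e1
        refine ⟨?_, Φ j, ?_, ?_⟩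
        · congr 1; linarith
        · congr 1; linarith
        · rw [show Φ j - (Φ j + θ j) = -θ j by ring, Real.cos_neg]
  refine ⟨fun i => Φ i + θ i, fun i j hij => ?_⟩
  rcases lt_or_gt_of_ne hij with h | h
  · have := main i j h
    rwa [← Real.cos_neg, neg_sub] at this
  · obtain ⟨a1, a2, a3⟩ := main j i h
    rw [add_comm (θ j) (θ i)] at a1 a2 a3
    refine ⟨a1, fun hna => a2 fun hna' => hna hna'.symm, fun ha => ?_⟩
    obtain ⟨b1, φ, b2, b3⟩ := a3 ha.symm
    exact ⟨b1, φ, b3, b2⟩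

lemma cos_add_halfAngle (k k' r : ℝ) :
    √(1 + k ^ 2 * Real.sinh r ^ 2) * √(1 + k' ^ 2 * Real.sinh r ^ 2) *
      Real.cos (halfAngle k r + halfAngle k' r) = k * k' * Real.sinh r ^ 2 - 1 := by
  have h0 : √(1 + k ^ 2 * Real.sinh r ^ 2) ≠ 0 := (Real.sqrt_pos.2 (by positivity)).ne'
  have h1 : √(1 + k' ^ 2 * Real.sinh r ^ 2) ≠ 0 := (Real.sqrt_pos.2 (by positivity)).ne'
  rw [Real.cos_add, halfAngle, halfAngle, Real.cos_pi_div_two_sub, Real.cos_pi_div_two_sub,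
    Real.sin_pi_div_two_sub, Real.sin_pi_div_two_sub, Real.sin_arctan, Real.sin_arctan,
    Real.cos_arctan, Real.cos_arctan, mul_pow, mul_pow]
  field_simp

/-- Reversed Cauchy–Schwarz inequality for a timelike or lightlike vector `(P, Q₁, Q₂, K)` and a
lightlike vector `(U, u₁, u₂, 1)`. Applied to a sum of two forms `perpForm`, it shows that their disks
are disjoint. -/
lemma lorentz_nonneg {P Q₁ Q₂ K U u₁ u₂ : ℝ} (hP : 0 < P) (hU : 0 < U)
    (hU2 : U ^ 2 = 1 + u₁ ^ 2 + u₂ ^ 2) (h : Q₁ ^ 2 + Q₂ ^ 2 + K ^ 2 ≤ P ^ 2) :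
    0 ≤ P * U + (Q₁ * u₁ + Q₂ * u₂) - K := by
  have h1 : (K - (Q₁ * u₁ + Q₂ * u₂)) ^ 2 ≤ (P * U) ^ 2 := by
    rw [mul_pow, hU2]
    nlinarith [sq_nonneg (K * u₁ + Q₁), sq_nonneg (K * u₂ + Q₂), sq_nonneg (Q₁ * u₂ - Q₂ * u₁),
      mul_le_mul_of_nonneg_right h (by positivity : 0 ≤ 1 + u₁ ^ 2 + u₂ ^ 2)]
  linarith [le_abs_self (K - (Q₁ * u₁ + Q₂ * u₂)), abs_le_of_sq_le_sq h1 (by positivity)]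

lemma lorentz_pos {P Q₁ Q₂ K U u₁ u₂ : ℝ} (hP : 0 < P) (hU : 0 < U)
    (hU2 : U ^ 2 = 1 + u₁ ^ 2 + u₂ ^ 2) (h : Q₁ ^ 2 + Q₂ ^ 2 + K ^ 2 < P ^ 2) :
    0 < P * U + (Q₁ * u₁ + Q₂ * u₂) - K := by
  have h1 : (K - (Q₁ * u₁ + Q₂ * u₂)) ^ 2 < (P * U) ^ 2 := by
    rw [mul_pow, hU2]
    nlinarith [sq_nonneg (K * u₁ + Q₁), sq_nonneg (K * u₂ + Q₂), sq_nonneg (Q₁ * u₂ - Q₂ * u₁),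
      mul_lt_mul_of_pos_right h (by positivity : 0 < 1 + u₁ ^ 2 + u₂ ^ 2)]
  linarith [le_abs_self (K - (Q₁ * u₁ + Q₂ * u₂)), abs_lt_of_sq_lt_sq h1 (by positivity)]

/-- The equality case of `lorentz_nonneg` determines the point of contact. -/
lemma lorentz_eq {P Q₁ Q₂ K U u₁ u₂ : ℝ} (hP : 0 < P)
    (hU2 : U ^ 2 = 1 + u₁ ^ 2 + u₂ ^ 2) (h : Q₁ ^ 2 + Q₂ ^ 2 + K ^ 2 = P ^ 2)
    (h0 : P * U + (Q₁ * u₁ + Q₂ * u₂) - K = 0) : K * U = P := by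
  have h1 : (K * u₁ + Q₁) ^ 2 + (K * u₂ + Q₂) ^ 2 + (Q₁ * u₂ - Q₂ * u₁) ^ 2 = 0 := by
    have : (P * U) ^ 2 = (K - (Q₁ * u₁ + Q₂ * u₂)) ^ 2 := by
      rw [show P * U = K - (Q₁ * u₁ + Q₂ * u₂) by linarith]
    linear_combination this - P ^ 2 * hU2 + (1 + u₁ ^ 2 + u₂ ^ 2) * h
  have h2 : K * u₁ + Q₁ = 0 := by
    nlinarith [sq_nonneg (K * u₁ + Q₁), sq_nonneg (K * u₂ + Q₂), sq_nonneg (Q₁ * u₂ - Q₂ * u₁)]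
  have h3 : K * u₂ + Q₂ = 0 := by
    nlinarith [sq_nonneg (K * u₁ + Q₁), sq_nonneg (K * u₂ + Q₂), sq_nonneg (Q₁ * u₂ - Q₂ * u₁)]
  have : P * (K * U - P) = 0 := by linear_combination K * h0 + h - Q₁ * h2 - Q₂ * h3
  rcases mul_eq_zero.1 this with h | h
  · exact absurd h hP.ne'
  · linarith

lemma perpForm_add (w z : ℍ) (r k ψ k' ψ' : ℝ) :
    perpForm w r k ψ z + perpForm w r k' ψ' z =
      ((k + k') * Real.cosh r) * Real.cosh (dist z w) +
      ((-(√(1 + k ^ 2 * Real.sinh r ^ 2) * Real.cos ψ +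
        √(1 + k' ^ 2 * Real.sinh r ^ 2) * Real.cos ψ')) * hypX w z +
      (-(√(1 + k ^ 2 * Real.sinh r ^ 2) * Real.sin ψ +
        √(1 + k' ^ 2 * Real.sinh r ^ 2) * Real.sin ψ')) * hypY w z) - (k + k') := by
  unfold perpForm; ring

/-- The sum of two forms `perpForm` is timelike, lightlike or spacelike according to how the angle
between the directions compares with the sum of the half-angles. -/
lemma perpForm_add_norm (r k ψ k' ψ' : ℝ) :
    (-(√(1 + k ^ 2 * Real.sinh r ^ 2) * Real.cos ψ +
        √(1 + k' ^ 2 * Real.sinh r ^ 2) * Real.cos ψ')) ^ 2 +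
      (-(√(1 + k ^ 2 * Real.sinh r ^ 2) * Real.sin ψ +
        √(1 + k' ^ 2 * Real.sinh r ^ 2) * Real.sin ψ')) ^ 2 + (k + k') ^ 2 =
      ((k + k') * Real.cosh r) ^ 2 + 2 * (√(1 + k ^ 2 * Real.sinh r ^ 2) *
        √(1 + k' ^ 2 * Real.sinh r ^ 2)) *
        (Real.cos (ψ - ψ') - Real.cos (halfAngle k r + halfAngle k' r)) := by
  have h1 : √(1 + k ^ 2 * Real.sinh r ^ 2) ^ 2 = 1 + k ^ 2 * Real.sinh r ^ 2 :=
    Real.sq_sqrt (by positivity)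
  have h2 : √(1 + k' ^ 2 * Real.sinh r ^ 2) ^ 2 = 1 + k' ^ 2 * Real.sinh r ^ 2 :=
    Real.sq_sqrt (by positivity)
  have h3 := cos_add_halfAngle k k' r
  have h4 := Real.sin_sq_add_cos_sq ψ
  have h5 := Real.sin_sq_add_cos_sq ψ'
  have h6 := Real.cosh_sq r
  rw [Real.cos_sub]
  generalize √(1 + k ^ 2 * Real.sinh r ^ 2) = M at *
  generalize √(1 + k' ^ 2 * Real.sinh r ^ 2) = M' at *
  linear_combination h1 + h2 + 2 * h3 + M ^ 2 * h4 + M' ^ 2 * h5 - (k + k') ^ 2 * h6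

/-- For every dual circle around which the angles add up to `2π` there is a packing. -/
theorem exists_polygonPacking {n : ℕ} {k : Fin n → ℝ} (hk : ∀ i, 0 < k i) {r : ℝ}
    (hr : 0 < r) (hsum : ∑ i, halfAngle (k i) r = Real.pi) :
    Nonempty (PolygonPacking n k) := by
  have hs := Real.sinh_pos_iff.2 hr
  have hc := Real.cosh_pos r
  have hcs := Real.cosh_sq r
  obtain ⟨ψ, hψ⟩ := exists_arrangement (fun i => halfAngle_pos (k i) r) hsum
  have hMpos : ∀ i, 0 < √(1 + k i ^ 2 * Real.sinh r ^ 2) := fun i => Real.sqrt_pos.2 (by positivity)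
  have hP : ∀ i j, 0 < (k i + k j) * Real.cosh r := fun i j =>
    mul_pos (add_pos (hk i) (hk j)) hc
  have hnonneg : ∀ i j, i ≠ j → ∀ z, 0 ≤ perpForm I r (k i) (ψ i) z + perpForm I r (k j) (ψ j) z := by
    intro i j hij z
    rw [perpForm_add]
    refine lorentz_nonneg (hP i j) (Real.cosh_pos _) (cosh_dist_sq_eq I z) ?_
    rw [perpForm_add_norm]
    have := mul_pos (hMpos i) (hMpos j)
    nlinarith [(hψ i j hij).1]
  have hpos : ∀ i j, i ≠ j → ¬ (SimpleGraph.cycleGraph n).Adj i j →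
      ∀ z, 0 < perpForm I r (k i) (ψ i) z + perpForm I r (k j) (ψ j) z := by
    intro i j hij hna z
    rw [perpForm_add]
    refine lorentz_pos (hP i j) (Real.cosh_pos _) (cosh_dist_sq_eq I z) ?_
    rw [perpForm_add_norm]
    have := mul_pos (hMpos i) (hMpos j)
    nlinarith [(hψ i j hij).2.1 hna]
  have hadj : ∀ i j, i ≠ j → ∀ z, perpForm I r (k i) (ψ i) z = 0 → perpForm I r (k j) (ψ j) z = 0 →
      (SimpleGraph.cycleGraph n).Adj i j := by
    intro i j hij z hi hj
    by_contra hna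
    have := hpos i j hij hna z
    rw [hi, hj] at this
    norm_num at this
  have htan : ∀ i j, (SimpleGraph.cycleGraph n).Adj i j →
      ∃ t, TangentAt {z | perpForm I r (k i) (ψ i) z = 0} {z | perpForm I r (k j) (ψ j) z = 0} t := by
    intro i j hij
    obtain ⟨hcos, φ, h1, h2⟩ := (hψ i j hij.ne).2.2 hij
    obtain ⟨z, hz, hX, hY⟩ := exists_mem_sphere I hr φ
    have zi : z ∈ {z | perpForm I r (k i) (ψ i) z = 0} := by
      rw [mem_ofPred_eq, perpForm_on_sphere hz hX hY, h1, sub_self, mul_zero]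
    have zj : z ∈ {z | perpForm I r (k j) (ψ j) z = 0} := by
      rw [mem_ofPred_eq, perpForm_on_sphere hz hX hY, h2, sub_self, mul_zero]
    refine ⟨z, ?_⟩
    rw [setOf_perpForm_I] at zi zj ⊢
    rw [setOf_perpForm_I r (k j)]
    refine tangentAt_of_circleForm (perpForm_I_det _ _ _) (perpForm_I_det _ _ _) zi zj ?_
    have h3 := cos_add_halfAngle (k i) (k j) r
    rw [← hcos, Real.cos_sub] at h3
    linear_combination (-4) * h3 + 4 * k i * k j * hcs
  refine ⟨{
    circle := fun i => {z | perpForm I r (k i) (ψ i) z = 0}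
    disk := fun i => {z | perpForm I r (k i) (ψ i) z < 0}
    isGeneralizedCircle := fun i => isGeneralizedCircle_perpForm_I (hk i) r (ψ i)
    disjoint_disk := ?_
    tangent_of_meet := ?_
    tangent_iff_adj := ?_
    center := I
    radius := r
    radius_pos := hr
    perpendicular := ?_ }⟩
  · intro i j hij
    rw [Set.disjoint_left]
    intro z hi hj
    have := hnonneg i j hij z
    rw [mem_ofPred_eq] at hi hj
    linarith
  · rintro i j hij ⟨z, hi, hj⟩
    exact htan i j (hadj i j hij z hi hj)
  · intro i j hij
    exact ⟨fun ⟨t, ht⟩ => hadj i j hij t ht.1 ht.2.1, htan i j⟩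
  · intro i j t hij ht
    have hi := ht.1
    have hj := ht.2.1
    have hA := hadj i j hij t hi hj
    -- the point of tangency lies on the dual circle
    have hd : dist t I = r := by
      rw [mem_ofPred_eq] at hi hj
      have h0 := perpForm_add I t r (k i) (ψ i) (k j) (ψ j)
      rw [hi, hj, add_zero] at h0
      have hn := perpForm_add_norm r (k i) (ψ i) (k j) (ψ j)
      rw [((hψ i j hij).2.2 hA).1, sub_self, mul_zero, add_zero] at hn
      have := lorentz_eq (hP i j) (cosh_dist_sq_eq I t) hn h0.symm
      exact Real.cosh_strictMonoOn.injOn (dist_nonneg (x := t) (y := I)) hr.le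
        (mul_left_cancel₀ (add_pos (hk i) (hk j)).ne' this)
    have hts : t ∈ Metric.sphere I r := hd
    rw [sphere_eq_circleForm I hr] at hts ⊢
    rw [setOf_perpForm_I] at hi ⊢
    rw [perpendicularAt_iff ?_ (perpForm_I_det _ _ _) hts hi]
    · simp only [I_im, I_re]; field_simp; ring
    · simp only [I_im, I_re]; rw [div_pow (Real.cosh r), hcs]; field_simp; ring

/-! ### The total curvature of an arc as a function of logarithmic parameters -/

lemma hasDerivAt_integral_of_continuousOn {F F' : ℝ → ℝ → ℝ}
    (hF : ∀ l, ContinuousOn (F l) (Icc 0 1))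
    (hF' : ContinuousOn (fun p : ℝ × ℝ => F' p.1 p.2) (univ ×ˢ Icc 0 1))
    (hd : ∀ l, ∀ v ∈ Icc (0 : ℝ) 1, HasDerivAt (fun l => F l v) (F' l v) l) (l₀ : ℝ) :
    HasDerivAt (fun l => ∫ v in (0 : ℝ)..1, F l v) (∫ v in (0 : ℝ)..1, F' l₀ v) l₀ := by
  have hI : Set.uIoc (0 : ℝ) 1 ⊆ Icc 0 1 := by
    rw [uIoc_of_le zero_le_one]; exact Ioc_subset_Icc_self
  obtain ⟨C, hC⟩ := ((isCompact_Icc (a := l₀ - 1) (b := l₀ + 1)).prod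
    (isCompact_Icc (a := (0 : ℝ)) (b := 1))).exists_bound_of_continuousOn
      (hF'.mono (prod_mono_left (subset_univ _)))
  have hF'l : ContinuousOn (F' l₀) (Icc 0 1) :=
    hF'.comp (f := fun v : ℝ => (l₀, v)) (by fun_prop) fun v hv => ⟨mem_univ _, hv⟩
  refine (intervalIntegral.hasDerivAt_integral_of_dominated_loc_of_deriv_le (bound := fun _ => C)
    (Icc_mem_nhds (show l₀ - 1 < l₀ by linarith) (show l₀ < l₀ + 1 by linarith)) ?_ ?_ ?_ ?_ ?_ ?_).2
  · exact Eventually.of_forall fun l =>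
      ((hF l).mono hI).aestronglyMeasurable measurableSet_uIoc
  · exact (by rw [uIcc_of_le zero_le_one]; exact hF l₀ : ContinuousOn (F l₀) (uIcc 0 1)).intervalIntegrable
  · exact (hF'l.mono hI).aestronglyMeasurable measurableSet_uIoc
  · exact Eventually.of_forall fun v hv l hl => hC (l, v) ⟨hl, hI hv⟩
  · exact intervalIntegrable_const
  · exact Eventually.of_forall fun v hv l _ => hd l v (hI hv)

/-- The denominator in the integral `logCurvature`. -/
noncomputable def curvatureDenom (x σ v : ℝ) : ℝ :=
  Real.cosh σ ^ 2 - v ^ 2 + Real.exp x ^ 2 * v ^ 2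

/-- The total curvature of an arc in the parameters `x = log k` and `σ`, where `sinh σ sinh r = 1`
for the radius `r` of the dual circle. -/
noncomputable def logCurvature (x σ : ℝ) : ℝ :=
  ∫ v in (0 : ℝ)..1, 2 * Real.exp x * Real.cosh σ / curvatureDenom x σ v

/-- The half-angle `halfAngle k r` in the parameters `x = log k` and `σ`. -/
noncomputable def logAngle (x σ : ℝ) : ℝ := Real.arctan (Real.exp (-x) * Real.sinh σ)

/-- The part of the derivative of `logCurvature` in `x` that is not accounted for by the symmetry
between `logCurvature` and `2 * logAngle`. -/
noncomputable def curvatureExcess (x σ : ℝ) : ℝ :=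
  ∫ v in (0 : ℝ)..1, 2 * Real.exp x * v ^ 2 / (Real.cosh σ * curvatureDenom x σ v)

lemma curvatureDenom_pos (x σ : ℝ) {v : ℝ} (hv : v ∈ Icc (0 : ℝ) 1) :
    0 < curvatureDenom x σ v := by
  unfold curvatureDenom
  have h1 := Real.cosh_sq σ
  have h2 := Real.exp_pos x
  rcases eq_or_lt_of_le hv.1 with h | h
  · subst h; nlinarith [sq_nonneg (Real.sinh σ)]
  · have : 0 < Real.exp x ^ 2 * v ^ 2 := by positivity
    nlinarith [sq_nonneg (Real.sinh σ), hv.2, hv.1]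

lemma curvatureDenom_le (x σ : ℝ) {v : ℝ} (hv : v ∈ Icc (0 : ℝ) 1) :
    curvatureDenom x σ v ≤ Real.cosh σ ^ 2 + Real.exp x ^ 2 := by
  unfold curvatureDenom
  have : v ^ 2 ≤ 1 := by nlinarith [hv.1, hv.2]
  nlinarith [mul_nonneg (sq_nonneg (Real.exp x)) (sub_nonneg.2 this), sq_nonneg v]

lemma continuous_curvatureDenom (x σ : ℝ) : Continuous (curvatureDenom x σ) := by
  unfold curvatureDenom; fun_prop

lemma hasDerivAt_logCurvature_integrand (a p b q l v : ℝ) (hv : v ∈ Icc (0 : ℝ) 1) :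
    HasDerivAt (fun l => 2 * Real.exp (a + l * p) * Real.cosh (b + l * q) /
        curvatureDenom (a + l * p) (b + l * q) v)
      (p * (2 * Real.exp (a + l * p) * Real.cosh (b + l * q) *
          (Real.cosh (b + l * q) ^ 2 - v ^ 2 - Real.exp (a + l * p) ^ 2 * v ^ 2) /
          curvatureDenom (a + l * p) (b + l * q) v ^ 2) +
        q * Real.sinh (b + l * q) * (-(2 * Real.exp (a + l * p)) *
          (Real.cosh (b + l * q) ^ 2 + v ^ 2 - Real.exp (a + l * p) ^ 2 * v ^ 2) /
          curvatureDenom (a + l * p) (b + l * q) v ^ 2)) l := by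
  have hD := curvatureDenom_pos (a + l * p) (b + l * q) hv
  have hx : HasDerivAt (fun l => a + l * p) p l := by
    simpa using ((hasDerivAt_id l).mul_const p).const_add a
  have hσ : HasDerivAt (fun l => b + l * q) q l := by
    simpa using ((hasDerivAt_id l).mul_const q).const_add b
  have he := hx.exp
  have hc := hσ.cosh
  have hden : HasDerivAt (fun l => curvatureDenom (a + l * p) (b + l * q) v) _ l :=
    (((hc.pow 2).sub_const (v ^ 2)).add ((he.pow 2).mul_const (v ^ 2)))
  refine (((he.const_mul 2).mul hc).div hden hD.ne').congr_deriv ?_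
  rw [← mul_div_assoc, ← mul_div_assoc, ← add_div]
  congr 1
  unfold curvatureDenom
  simp only [Pi.mul_apply]
  push_cast
  ring

/-- The integrals of the partial derivatives of the integrand of `logCurvature`. Up to the term
`curvatureExcess`, these partial derivatives are derivatives of rational functions of `v`. -/
lemma integral_hasDerivAt_terms (x σ : ℝ) :
    (∫ v in (0 : ℝ)..1, 2 * Real.exp x * Real.cosh σ *
        (Real.cosh σ ^ 2 - v ^ 2 - Real.exp x ^ 2 * v ^ 2) / curvatureDenom x σ v ^ 2) =
      2 * Real.exp x * Real.sinh σ ^ 2 / (Real.cosh σ * (Real.exp x ^ 2 + Real.sinh σ ^ 2)) +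
        curvatureExcess x σ ∧
    (∫ v in (0 : ℝ)..1, -(2 * Real.exp x) *
        (Real.cosh σ ^ 2 + v ^ 2 - Real.exp x ^ 2 * v ^ 2) / curvatureDenom x σ v ^ 2) =
      -(2 * Real.exp x) / (Real.exp x ^ 2 + Real.sinh σ ^ 2) := by
  have hc := Real.cosh_pos σ
  have hcs := Real.cosh_sq σ
  have hex := Real.exp_pos x
  have hcont := continuous_curvatureDenom x σ
  have hI : ∀ v ∈ uIcc (0 : ℝ) 1, v ∈ Icc (0 : ℝ) 1 := fun v hv => by
    rwa [uIcc_of_le zero_le_one] at hv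
  have hne : ∀ v ∈ uIcc (0 : ℝ) 1, curvatureDenom x σ v ≠ 0 :=
    fun v hv => (curvatureDenom_pos x σ (hI v hv)).ne'
  have hden : ∀ v, HasDerivAt (curvatureDenom x σ) (2 * (Real.exp x ^ 2 - 1) * v) v := by
    intro v
    refine (((hasDerivAt_const v _).sub (hasDerivAt_pow 2 v)).add
      ((hasDerivAt_pow 2 v).const_mul (Real.exp x ^ 2))).congr_deriv ?_
    push_cast; ring
  have h1 : curvatureDenom x σ 1 = Real.exp x ^ 2 + Real.sinh σ ^ 2 := by
    unfold curvatureDenom; rw [hcs]; ring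
  constructor
  · have key : ∀ v ∈ uIcc (0 : ℝ) 1, HasDerivAt (fun v => 2 * Real.exp x * v *
        (Real.cosh σ ^ 2 - v ^ 2) / (Real.cosh σ * curvatureDenom x σ v))
        (2 * Real.exp x * Real.cosh σ *
          (Real.cosh σ ^ 2 - v ^ 2 - Real.exp x ^ 2 * v ^ 2) / curvatureDenom x σ v ^ 2 -
          2 * Real.exp x * v ^ 2 / (Real.cosh σ * curvatureDenom x σ v)) v := by
      intro v hv
      have hD := hne v hv
      refine ((((hasDerivAt_id v).const_mul (2 * Real.exp x)).mul
        ((hasDerivAt_pow 2 v).const_sub (Real.cosh σ ^ 2))).div ((hden v).const_mul (Real.cosh σ))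
        (mul_ne_zero hc.ne' hD)).congr_deriv ?_
      have hDe : curvatureDenom x σ v = Real.cosh σ ^ 2 - v ^ 2 + Real.exp x ^ 2 * v ^ 2 := rfl
      simp only [id, Pi.mul_apply]
      field_simp
      rw [hDe]
      push_cast
      ring
    have hint1 : IntervalIntegrable (fun v => 2 * Real.exp x * Real.cosh σ *
          (Real.cosh σ ^ 2 - v ^ 2 - Real.exp x ^ 2 * v ^ 2) / curvatureDenom x σ v ^ 2)
          volume 0 1 := by
      refine ContinuousOn.intervalIntegrable (ContinuousOn.div (by fun_prop) (by fun_prop) ?_)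
      exact fun v hv => pow_ne_zero 2 (hne v hv)
    have hint2 : IntervalIntegrable (fun v =>
          2 * Real.exp x * v ^ 2 / (Real.cosh σ * curvatureDenom x σ v)) volume 0 1 := by
      refine ContinuousOn.intervalIntegrable (ContinuousOn.div (by fun_prop) (by fun_prop) ?_)
      exact fun v hv => mul_ne_zero hc.ne' (hne v hv)
    have := intervalIntegral.integral_eq_sub_of_hasDerivAt key (hint1.sub hint2)
    rw [intervalIntegral.integral_sub hint1 hint2, h1] at this
    rw [curvatureExcess, ← sub_eq_iff_eq_add, this]
    simp [hcs]
  · have key : ∀ v ∈ uIcc (0 : ℝ) 1, HasDerivAt (fun v => -(2 * Real.exp x) * v /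
        curvatureDenom x σ v) (-(2 * Real.exp x) *
        (Real.cosh σ ^ 2 + v ^ 2 - Real.exp x ^ 2 * v ^ 2) / curvatureDenom x σ v ^ 2) v := by
      intro v hv
      refine (((hasDerivAt_id v).const_mul (-(2 * Real.exp x))).div (hden v)
        (hne v hv)).congr_deriv ?_
      congr 1
      unfold curvatureDenom
      simp only [id]
      ring
    have hint : IntervalIntegrable (fun v => -(2 * Real.exp x) *
        (Real.cosh σ ^ 2 + v ^ 2 - Real.exp x ^ 2 * v ^ 2) / curvatureDenom x σ v ^ 2)
          volume 0 1 := by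
      refine ContinuousOn.intervalIntegrable (ContinuousOn.div (by fun_prop) (by fun_prop) ?_)
      exact fun v hv => pow_ne_zero 2 (hne v hv)
    have := intervalIntegral.integral_eq_sub_of_hasDerivAt key hint
    rw [this, h1]
    simp

/-- The derivative of `logCurvature` along a line. -/
lemma hasDerivAt_logCurvature (a p b q l : ℝ) :
    HasDerivAt (fun l => logCurvature (a + l * p) (b + l * q))
      (p * (2 * Real.exp (a + l * p) * Real.sinh (b + l * q) ^ 2 /
          (Real.cosh (b + l * q) * (Real.exp (a + l * p) ^ 2 + Real.sinh (b + l * q) ^ 2)) +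
          curvatureExcess (a + l * p) (b + l * q)) +
        q * Real.sinh (b + l * q) * (-(2 * Real.exp (a + l * p)) /
          (Real.exp (a + l * p) ^ 2 + Real.sinh (b + l * q) ^ 2))) l := by
  have hcont := continuous_curvatureDenom
  have hne : ∀ x σ, ∀ v ∈ uIcc (0 : ℝ) 1, curvatureDenom x σ v ≠ 0 := fun x σ v hv =>
    (curvatureDenom_pos x σ (by rwa [uIcc_of_le zero_le_one] at hv)).ne'
  have := hasDerivAt_integral_of_continuousOn
    (fun l => ContinuousOn.div (by fun_prop) (hcont _ _).continuousOn
      fun v hv => (curvatureDenom_pos (a + l * p) (b + l * q) hv).ne')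
    (by
      refine ContinuousOn.add (ContinuousOn.mul continuousOn_const (ContinuousOn.div
        (by fun_prop) (by unfold curvatureDenom; fun_prop) ?_)) (ContinuousOn.mul (by fun_prop)
          (ContinuousOn.div (by fun_prop) (by unfold curvatureDenom; fun_prop) ?_))
      all_goals exact fun z hz => pow_ne_zero 2 (curvatureDenom_pos _ _ hz.2).ne')
    (fun l v hv => hasDerivAt_logCurvature_integrand a p b q l v hv) l
  refine this.congr_deriv ?_
  have hint1 : IntervalIntegrable (fun v => 2 * Real.exp (a + l * p) * Real.cosh (b + l * q) *
          (Real.cosh (b + l * q) ^ 2 - v ^ 2 - Real.exp (a + l * p) ^ 2 * v ^ 2) /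
          curvatureDenom (a + l * p) (b + l * q) v ^ 2) volume 0 1 :=
    ContinuousOn.intervalIntegrable (ContinuousOn.div (by fun_prop)
      ((hcont _ _).continuousOn.pow 2) fun v hv => pow_ne_zero 2 (hne _ _ v hv))
  have hint2 : IntervalIntegrable (fun v => -(2 * Real.exp (a + l * p)) *
          (Real.cosh (b + l * q) ^ 2 + v ^ 2 - Real.exp (a + l * p) ^ 2 * v ^ 2) /
          curvatureDenom (a + l * p) (b + l * q) v ^ 2) volume 0 1 :=
    ContinuousOn.intervalIntegrable (ContinuousOn.div (by fun_prop)
      ((hcont _ _).continuousOn.pow 2) fun v hv => pow_ne_zero 2 (hne _ _ v hv))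
  rw [intervalIntegral.integral_add (hint1.const_mul _) (hint2.const_mul _),
    intervalIntegral.integral_const_mul, intervalIntegral.integral_const_mul,
    (integral_hasDerivAt_terms _ _).1, (integral_hasDerivAt_terms _ _).2]

lemma hasDerivAt_logAngle (a p b q l : ℝ) :
    HasDerivAt (fun l => logAngle (a + l * p) (b + l * q))
      (p * (-(Real.exp (a + l * p) * Real.sinh (b + l * q)) /
          (Real.exp (a + l * p) ^ 2 + Real.sinh (b + l * q) ^ 2)) +
        q * (Real.exp (a + l * p) * Real.cosh (b + l * q) /
          (Real.exp (a + l * p) ^ 2 + Real.sinh (b + l * q) ^ 2))) l := by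
  have hx : HasDerivAt (fun l => a + l * p) p l := by
    simpa using ((hasDerivAt_id l).mul_const p).const_add a
  have hσ : HasDerivAt (fun l => b + l * q) q l := by
    simpa using ((hasDerivAt_id l).mul_const q).const_add b
  refine ((hx.neg.exp).mul hσ.sinh).arctan.congr_deriv ?_
  have he := Real.exp_pos (a + l * p)
  simp only [Pi.neg_apply, Pi.mul_apply, Real.exp_neg]
  field_simp

lemma curvatureExcess_ge {x σ A B : ℝ} (hx : |x| ≤ A) (hσ : |σ| ≤ B) :
    2 * Real.exp (-A) / (3 * (Real.cosh B * (Real.cosh B ^ 2 + Real.exp A ^ 2))) ≤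
      curvatureExcess x σ := by
  have hc := Real.cosh_pos σ
  have hcB := Real.cosh_pos B
  have hex := Real.exp_pos x
  have hcont := continuous_curvatureDenom x σ
  have h1 : Real.exp (-A) ≤ Real.exp x := Real.exp_le_exp.2 (by linarith [(abs_le.1 hx).1])
  have h2 : Real.exp x ≤ Real.exp A := Real.exp_le_exp.2 (abs_le.1 hx).2
  have h3 : Real.cosh σ ≤ Real.cosh B := Real.cosh_le_cosh.2 (hσ.trans (le_abs_self B))
  have h4 : ∫ v in (0 : ℝ)..1, (2 * Real.exp (-A) /
      (Real.cosh B * (Real.cosh B ^ 2 + Real.exp A ^ 2))) * v ^ 2 =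
      2 * Real.exp (-A) / (3 * (Real.cosh B * (Real.cosh B ^ 2 + Real.exp A ^ 2))) := by
    rw [intervalIntegral.integral_const_mul, integral_pow]
    push_cast
    field_simp
    norm_num
  rw [← h4, curvatureExcess]
  refine intervalIntegral.integral_mono_on zero_le_one (Continuous.intervalIntegrable (by fun_prop) _ _)
    (ContinuousOn.intervalIntegrable (ContinuousOn.div (by fun_prop) (by fun_prop) ?_)) ?_
  · intro v hv
    rw [uIcc_of_le zero_le_one] at hv
    exact mul_ne_zero hc.ne' (curvatureDenom_pos x σ hv).ne'
  · intro v hv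
    rw [div_mul_eq_mul_div]
    have hD := curvatureDenom_pos x σ hv
    have hD' : curvatureDenom x σ v ≤ Real.cosh B ^ 2 + Real.exp A ^ 2 :=
      (curvatureDenom_le x σ hv).trans (by gcongr)
    gcongr

/-- Up to the term `c * (x' - x) ^ 2`, the pair `(logCurvature, 2 * logAngle)` is the gradient of a
convex function. -/
lemma logCurvature_monotone {A B : ℝ} {x x' σ σ' : ℝ} (hx : |x| ≤ A) (hx' : |x'| ≤ A)
    (hσ : |σ| ≤ B) (hσ' : |σ'| ≤ B) :
    2 * Real.exp (-A) / (3 * (Real.cosh B * (Real.cosh B ^ 2 + Real.exp A ^ 2))) * (x' - x) ^ 2 ≤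
      (logCurvature x' σ' - logCurvature x σ) * (x' - x) +
        2 * (logAngle x' σ' - logAngle x σ) * (σ' - σ) := by
  set c := 2 * Real.exp (-A) / (3 * (Real.cosh B * (Real.cosh B ^ 2 + Real.exp A ^ 2))) with hcdef
  set p := x' - x with hp
  set q := σ' - σ with hq
  have hd : ∀ l, HasDerivAt (fun l => logCurvature (x + l * p) (σ + l * q) * p +
      2 * logAngle (x + l * p) (σ + l * q) * q) _ l := fun l =>
    ((hasDerivAt_logCurvature x p σ q l).mul_const p).add
      (((hasDerivAt_logAngle x p σ q l).const_mul 2).mul_const q)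
  have key := (convex_Icc (0 : ℝ) 1).mul_sub_le_image_sub_of_le_deriv (C := c * p ^ 2)
    (fun l _ => (hd l).continuousAt.continuousWithinAt)
    (fun l _ => (hd l).differentiableAt.differentiableWithinAt) ?_
    0 (by simp) 1 (by simp) zero_le_one
  · have e1 : x + 1 * p = x' := by rw [hp]; ring
    have e2 : σ + 1 * q = σ' := by rw [hq]; ring
    rw [e1, e2] at key
    simp only [zero_mul, add_zero] at key
    linarith
  · intro l hl
    rw [interior_Icc] at hl
    rw [(hd l).deriv]
    have hxl : |x + l * p| ≤ A := by
      rw [abs_le] at *; rw [hp]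
      constructor <;> nlinarith [hl.1, hl.2]
    have hσl : |σ + l * q| ≤ B := by
      rw [abs_le] at *; rw [hq]
      constructor <;> nlinarith [hl.1, hl.2]
    have hE := curvatureExcess_ge hxl hσl
    rw [← hcdef] at hE
    set E := curvatureExcess (x + l * p) (σ + l * q)
    have he := Real.exp_pos (x + l * p)
    have hc := Real.cosh_pos (σ + l * q)
    set k := Real.exp (x + l * p)
    set H := Real.cosh (σ + l * q)
    set s := Real.sinh (σ + l * q)
    -- the quadratic form of the derivative is a sum of squares
    have hid : (p * (2 * k * s ^ 2 / (H * (k ^ 2 + s ^ 2)) + E) +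
        q * s * (-(2 * k) / (k ^ 2 + s ^ 2))) * p +
        2 * (p * (-(k * s) / (k ^ 2 + s ^ 2)) + q * (k * H / (k ^ 2 + s ^ 2))) * q =
        E * p ^ 2 + 2 * k / (H * (k ^ 2 + s ^ 2)) * (s * p - H * q) ^ 2 := by
      field_simp; ring
    rw [hid]
    have : 0 ≤ 2 * k / (H * (k ^ 2 + s ^ 2)) * (s * p - H * q) ^ 2 := by positivity
    nlinarith [sq_nonneg p]

lemma curvatureExcess_nonneg (x σ : ℝ) : 0 ≤ curvatureExcess x σ :=
  le_trans (by have := Real.cosh_pos |σ|; positivity) (curvatureExcess_ge le_rfl le_rfl)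

/-! ### Bounds for the total curvature of an arc -/

lemma continuous_arcCurvature_integrand (k : ℝ) :
    Continuous fun ρ : ℝ => 2 * k / (1 + k ^ 2 * Real.sinh ρ ^ 2) :=
  Continuous.div (by fun_prop) (by fun_prop) fun ρ => by positivity

lemma continuous_arctan_integrand (k : ℝ) :
    Continuous fun ρ : ℝ => 2 * k * Real.cosh ρ / (1 + k ^ 2 * Real.sinh ρ ^ 2) :=
  Continuous.div (by fun_prop) (by fun_prop) fun ρ => by positivity

/-- With the additional factor `cosh ρ`, the integral `arcCurvature` becomes elementary. The
estimates below compare the two. -/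
lemma integral_arctan_integrand (k a b : ℝ) :
    ∫ ρ in a..b, 2 * k * Real.cosh ρ / (1 + k ^ 2 * Real.sinh ρ ^ 2) =
      2 * Real.arctan (k * Real.sinh b) - 2 * Real.arctan (k * Real.sinh a) := by
  refine intervalIntegral.integral_eq_sub_of_hasDerivAt
    (f := fun ρ => 2 * Real.arctan (k * Real.sinh ρ)) (fun ρ _ => ?_)
    ((continuous_arctan_integrand k).intervalIntegrable _ _)
  refine ((((Real.hasDerivAt_sinh ρ).const_mul k).arctan).const_mul 2).congr_deriv ?_
  rw [mul_pow]
  field_simp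

lemma arcCurvature_pos {k r : ℝ} (hk : 0 < k) (hr : 0 < r) : 0 < arcCurvature k r :=
  intervalIntegral.intervalIntegral_pos_of_pos
    ((continuous_arcCurvature_integrand k).intervalIntegrable _ _) (fun ρ => by positivity) hr

lemma arcCurvature_sub (k r r' : ℝ) : arcCurvature k r' - arcCurvature k r =
    ∫ ρ in r..r', 2 * k / (1 + k ^ 2 * Real.sinh ρ ^ 2) :=
  intervalIntegral.integral_interval_sub_left
    ((continuous_arcCurvature_integrand k).intervalIntegrable _ _)
    ((continuous_arcCurvature_integrand k).intervalIntegrable _ _)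

lemma arcCurvature_mono {k r r' : ℝ} (hk : 0 < k) (h : r ≤ r') :
    arcCurvature k r ≤ arcCurvature k r' := by
  rw [← sub_nonneg, arcCurvature_sub]
  exact intervalIntegral.integral_nonneg h fun ρ _ => by positivity

lemma arcCurvature_lt {k r : ℝ} (hk : 0 < k) (hr : 0 < r) :
    arcCurvature k r < 2 * Real.arctan (k * Real.sinh r) := by
  have := integral_arctan_integrand k 0 r
  simp only [Real.sinh_zero, mul_zero, Real.arctan_zero, sub_zero] at this
  rw [← this, arcCurvature]
  refine intervalIntegral.integral_lt_integral_of_continuousOn_of_le_of_exists_lt hr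
    (continuous_arcCurvature_integrand k).continuousOn (continuous_arctan_integrand k).continuousOn
    (fun ρ _ => ?_) ⟨r, ⟨hr.le, le_rfl⟩, ?_⟩
  · exact div_le_div_of_nonneg_right
      (le_mul_of_one_le_right (by positivity) (Real.one_le_cosh ρ)) (by positivity)
  · exact div_lt_div_of_pos_right
      (lt_mul_of_one_lt_right (by positivity) (Real.one_lt_cosh.2 hr.ne')) (by positivity)

lemma arcCurvature_lt_pi {k r : ℝ} (hk : 0 < k) (hr : 0 < r) : arcCurvature k r < Real.pi := by
  linarith [arcCurvature_lt hk hr, Real.arctan_lt_pi_div_two (k * Real.sinh r)]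

lemma le_arcCurvature {k r : ℝ} (hk : 0 < k) (hr : 0 < r) :
    2 * Real.arctan (k * Real.sinh r) / Real.cosh r ≤ arcCurvature k r := by
  have := integral_arctan_integrand k 0 r
  simp only [Real.sinh_zero, mul_zero, Real.arctan_zero, sub_zero] at this
  rw [← this, arcCurvature, ← intervalIntegral.integral_div]
  refine intervalIntegral.integral_mono_on hr.le
    (((continuous_arctan_integrand k).div_const _).intervalIntegrable _ _)
    ((continuous_arcCurvature_integrand k).intervalIntegrable _ _) fun ρ hρ => ?_
  have h1 := Real.cosh_pos r
  have h2 : Real.cosh ρ ≤ Real.cosh r :=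
    Real.cosh_le_cosh.2 (by rw [abs_of_nonneg hρ.1, abs_of_pos hr]; exact hρ.2)
  rw [div_div, div_le_div_iff₀ (by positivity) (by positivity)]
  have : 0 ≤ 2 * k * (1 + k ^ 2 * Real.sinh ρ ^ 2) := by positivity
  nlinarith

lemma arcCurvature_le {k R : ℝ} (hk : 0 < k) (hR : 0 < R) (r : ℝ) :
    arcCurvature k r ≤ 2 * k * R + Real.pi / Real.cosh R := by
  have h1 := Real.cosh_pos R
  refine (arcCurvature_mono hk (le_max_left r R)).trans ?_
  have h2 : arcCurvature k R ≤ 2 * k * R := by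
    have : ∫ _ρ in (0 : ℝ)..R, 2 * k = 2 * k * R := by
      rw [intervalIntegral.integral_const]; simp; ring
    rw [← this]
    refine intervalIntegral.integral_mono_on hR.le
      ((continuous_arcCurvature_integrand k).intervalIntegrable _ _)
      (intervalIntegrable_const) fun ρ hρ => ?_
    refine div_le_self (by positivity) ?_
    nlinarith [mul_nonneg (sq_nonneg k) (sq_nonneg (Real.sinh ρ))]
  have h3 : arcCurvature k (max r R) - arcCurvature k R ≤ Real.pi / Real.cosh R := by
    rw [arcCurvature_sub]
    have h4 : ∫ ρ in R..max r R, 2 * k * Real.cosh ρ / (1 + k ^ 2 * Real.sinh ρ ^ 2) / Real.cosh R ≤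
        Real.pi / Real.cosh R := by
      rw [intervalIntegral.integral_div, integral_arctan_integrand]
      gcongr
      have h5 := Real.arctan_lt_pi_div_two (k * Real.sinh (max r R))
      have h6 : 0 < Real.arctan (k * Real.sinh R) :=
        Real.arctan_pos.2 (mul_pos hk (Real.sinh_pos_iff.2 hR))
      linarith
    refine le_trans (intervalIntegral.integral_mono_on (le_max_right r R)
      ((continuous_arcCurvature_integrand k).intervalIntegrable _ _)
      (((continuous_arctan_integrand k).div_const _).intervalIntegrable _ _) fun ρ hρ => ?_) h4
    have h7 : Real.cosh R ≤ Real.cosh ρ :=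
      Real.cosh_le_cosh.2 (by rw [abs_of_pos hR, abs_of_pos (hR.trans_le hρ.1)]; exact hρ.1)
    rw [div_div, div_le_div_iff₀ (by positivity) (by positivity)]
    have : 0 ≤ 2 * k * (1 + k ^ 2 * Real.sinh ρ ^ 2) := by positivity
    nlinarith
  linarith

/-- A small curvature forces a small total curvature, whatever the radius. -/
lemma exists_arcCurvature_le {ε : ℝ} (hε : 0 < ε) :
    ∃ A, ∀ x ≤ A, ∀ r, arcCurvature (Real.exp x) r ≤ ε := by
  obtain ⟨R, hR0, hR⟩ : ∃ R : ℝ, 0 < R ∧ Real.pi / Real.cosh R ≤ ε / 2 := by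
    refine ⟨2 * Real.pi / ε, by positivity, ?_⟩
    have h1 : 2 * Real.pi / ε ≤ Real.cosh (2 * Real.pi / ε) :=
      (Real.self_le_sinh_iff.2 (by positivity)).trans (Real.sinh_lt_cosh _).le
    rw [div_le_iff₀ (Real.cosh_pos _)]
    rw [div_le_iff₀ hε] at h1
    linarith
  refine ⟨Real.log (ε / (4 * R)), fun x hx r => (arcCurvature_le (Real.exp_pos x) hR0 r).trans ?_⟩
  have : Real.exp x ≤ ε / (4 * R) := (Real.le_log_iff_exp_le (by positivity)).1 hx
  rw [le_div_iff₀ (by positivity)] at this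
  linarith

/-- A large curvature forces a total curvature close to `π`, as long as the radius is bounded
below. -/
lemma exists_le_arcCurvature {ε r₀ : ℝ} (hε : 0 < ε) (hr₀ : 0 < r₀) :
    ∃ A, ∀ x, A ≤ x → ∀ r, r₀ ≤ r → Real.pi - ε ≤ arcCurvature (Real.exp x) r := by
  have hlim : Tendsto (fun r : ℝ => Real.pi / Real.cosh r) (𝓝[>] 0) (𝓝 Real.pi) := by
    have : ContinuousAt (fun r : ℝ => Real.pi / Real.cosh r) 0 :=
      ContinuousAt.div (by fun_prop) (by fun_prop) (Real.cosh_pos 0).ne'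
    simpa [ContinuousAt] using this.tendsto.mono_left nhdsWithin_le_nhds
  obtain ⟨r, hr1, hr0, hrr⟩ := ((hlim.eventually_const_lt
    (show Real.pi - ε < Real.pi by linarith)).and
    ((eventually_mem_nhdsWithin (a := (0 : ℝ)) (s := Ioi 0)).and
      (nhdsWithin_le_nhds (Iio_mem_nhds hr₀)))).exists
  have hs := Real.sinh_pos_iff.2 hr0
  have hlim2 : Tendsto (fun x => 2 * Real.arctan (Real.exp x * Real.sinh r) / Real.cosh r) atTop
      (𝓝 (2 * (Real.pi / 2) / Real.cosh r)) :=
    (((Real.tendsto_arctan_atTop.mono_right nhdsWithin_le_nhds).comp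
      (Real.tendsto_exp_atTop.atTop_mul_const hs)).const_mul 2).div_const _
  have h1 : Real.pi - ε < 2 * (Real.pi / 2) / Real.cosh r := by
    rwa [mul_div_cancel₀ _ two_ne_zero]
  obtain ⟨A, hA⟩ := eventually_atTop.1 (hlim2.eventually_const_lt h1)
  exact ⟨A, fun x hx r' hr' => (hA x hx).le.trans ((le_arcCurvature (Real.exp_pos x) hr0).trans
    (arcCurvature_mono (Real.exp_pos x) (hrr.le.trans hr')))⟩

/-! ### Logarithmic parameters -/

/-- The radius of the dual circle in terms of the parameter `σ`; an involution of `(0, ∞)`. -/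
noncomputable def dualRadius (σ : ℝ) : ℝ := Real.arsinh (Real.sinh σ)⁻¹

lemma sinh_dualRadius (σ : ℝ) : Real.sinh (dualRadius σ) = (Real.sinh σ)⁻¹ := Real.sinh_arsinh _

lemma dualRadius_pos {σ : ℝ} (hσ : 0 < σ) : 0 < dualRadius σ :=
  Real.arsinh_pos_iff.2 (inv_pos.2 (Real.sinh_pos_iff.2 hσ))

lemma dualRadius_dualRadius (σ : ℝ) : dualRadius (dualRadius σ) = σ := by
  rw [dualRadius, sinh_dualRadius, inv_inv, Real.arsinh_sinh]

lemma logAngle_eq (x : ℝ) {σ : ℝ} (hσ : 0 < σ) :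
    logAngle x σ = halfAngle (Real.exp x) (dualRadius σ) := by
  have hs := Real.sinh_pos_iff.2 hσ
  rw [halfAngle, sinh_dualRadius, logAngle, ← Real.arctan_inv_of_pos (by positivity), Real.exp_neg,
    mul_inv, inv_inv]

lemma logCurvature_eq (x : ℝ) {σ : ℝ} (hσ : 0 < σ) :
    logCurvature x σ = arcCurvature (Real.exp x) (dualRadius σ) := by
  have hs := Real.sinh_pos_iff.2 hσ
  have hr := dualRadius_pos hσ
  have hsr := sinh_dualRadius σ
  set r := dualRadius σ
  have hc := Real.cosh_pos σ
  have hcr : Real.cosh r = Real.cosh σ / Real.sinh σ := by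
    rw [← sq_eq_sq₀ (Real.cosh_pos r).le (by positivity), Real.cosh_sq, hsr, div_pow, Real.cosh_sq]
    field_simp
    ring
  -- the substitution `v = cosh σ tanh ρ`
  set V : ℝ → ℝ := fun ρ => Real.cosh σ * (Real.sinh ρ / Real.cosh ρ) with hVdef
  have hV : ∀ ρ, HasDerivAt V (Real.cosh σ / Real.cosh ρ ^ 2) ρ := by
    intro ρ
    have h1 := Real.cosh_sq ρ
    have h2 := Real.cosh_pos ρ
    refine (((Real.hasDerivAt_sinh ρ).div (Real.hasDerivAt_cosh ρ) h2.ne').const_mul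
      (Real.cosh σ)).congr_deriv ?_
    rw [← mul_div_assoc]
    congr 1
    linear_combination Real.cosh σ * h1
  have hV0 : V 0 = 0 := by simp [hVdef]
  have hVr : V r = 1 := by simp only [hVdef]; rw [hsr, hcr]; field_simp
  have hVI : ∀ ρ ∈ uIcc 0 r, V ρ ∈ Icc (0 : ℝ) 1 := by
    intro ρ hρ
    rw [uIcc_of_le hr.le] at hρ
    have hmono : Monotone V := monotone_of_deriv_nonneg (fun ρ => (hV ρ).differentiableAt)
      fun ρ => by rw [(hV ρ).deriv]; positivity
    exact ⟨hV0 ▸ hmono hρ.1, hVr ▸ hmono hρ.2⟩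
  have hsub := intervalIntegral.integral_comp_mul_deriv' (a := 0) (b := r) (f := V)
    (g := fun v => 2 * Real.exp x * Real.cosh σ / curvatureDenom x σ v)
    (fun ρ _ => hV ρ) (Continuous.continuousOn (Continuous.div (by fun_prop) (by fun_prop)
      fun ρ => (pow_pos (Real.cosh_pos ρ) 2).ne')) (by
        have := continuous_curvatureDenom x σ
        refine ContinuousOn.div (by fun_prop) (by fun_prop) ?_
        rintro _ ⟨ρ, hρ, rfl⟩
        exact (curvatureDenom_pos x σ (hVI ρ hρ)).ne')
  rw [hV0, hVr] at hsub
  rw [logCurvature, ← hsub, arcCurvature]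
  refine intervalIntegral.integral_congr fun ρ _ => ?_
  have h2 := Real.cosh_pos ρ
  have hD : curvatureDenom x σ (V ρ) = Real.cosh σ ^ 2 *
      (1 + Real.exp x ^ 2 * Real.sinh ρ ^ 2) / Real.cosh ρ ^ 2 := by
    simp only [curvatureDenom, hVdef]
    field_simp
    linear_combination Real.cosh_sq ρ
  simp only [Function.comp, hD]
  field_simp

lemma logCurvature_pos (x : ℝ) {σ : ℝ} (hσ : 0 < σ) : 0 < logCurvature x σ := by
  rw [logCurvature_eq x hσ]; exact arcCurvature_pos (Real.exp_pos x) (dualRadius_pos hσ)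

lemma logCurvature_lt_pi (x : ℝ) {σ : ℝ} (hσ : 0 < σ) : logCurvature x σ < Real.pi := by
  rw [logCurvature_eq x hσ]; exact arcCurvature_lt_pi (Real.exp_pos x) (dualRadius_pos hσ)

/-- The function `logCurvature` is globally Lipschitz. Its derivative in `x` is nonnegative and at
most `logCurvature` itself, which is less than `π`. -/
lemma abs_logCurvature_sub_le {x x' σ σ' : ℝ} (hσ : 0 < σ) (hσ' : 0 < σ') :
    |logCurvature x' σ' - logCurvature x σ| ≤ Real.pi * |x' - x| + |σ' - σ| := by
  set p := x' - x with hp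
  set q := σ' - σ with hq
  have key := (convex_Icc (0 : ℝ) 1).norm_image_sub_le_of_norm_hasDerivWithin_le
    (C := Real.pi * |p| + |q|)
    (fun l _ => (hasDerivAt_logCurvature x p σ q l).hasDerivWithinAt) ?_
    (show (0 : ℝ) ∈ Icc (0 : ℝ) 1 by simp) (show (1 : ℝ) ∈ Icc (0 : ℝ) 1 by simp)
  · have e1 : x + 1 * p = x' := by rw [hp]; ring
    have e2 : σ + 1 * q = σ' := by rw [hq]; ring
    rw [e1, e2] at key
    simpa using key
  · intro l hl
    have hσl : 0 < σ + l * q := (convex_Ioi (0 : ℝ)).add_smul_sub_mem hσ hσ' hl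
    set y := x + l * p
    set τ := σ + l * q
    have hc := Real.cosh_pos τ
    have he := Real.exp_pos y
    have hcont := continuous_curvatureDenom y τ
    have hne : ∀ v ∈ uIcc (0 : ℝ) 1, 0 < curvatureDenom y τ v := fun v hv =>
      curvatureDenom_pos y τ (by rwa [uIcc_of_le zero_le_one] at hv)
    have h1 : 2 * Real.exp y * Real.sinh τ ^ 2 / (Real.cosh τ * (Real.exp y ^ 2 + Real.sinh τ ^ 2)) +
        curvatureExcess y τ ≤ Real.pi := by
      refine le_trans ?_ (logCurvature_lt_pi y hσl).le
      rw [← (integral_hasDerivAt_terms y τ).1, logCurvature]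
      refine intervalIntegral.integral_mono_on zero_le_one
        (ContinuousOn.intervalIntegrable (ContinuousOn.div (by fun_prop) (by fun_prop)
          fun v hv => pow_ne_zero 2 (hne v hv).ne'))
        (ContinuousOn.intervalIntegrable (ContinuousOn.div (by fun_prop) (by fun_prop)
          fun v hv => (hne v hv).ne')) fun v hv => ?_
      have hD := curvatureDenom_pos y τ hv
      rw [sq (curvatureDenom y τ v), mul_div_mul_comm]
      refine mul_le_of_le_one_right (by positivity) ?_
      rw [div_le_one hD, curvatureDenom]
      nlinarith [mul_nonneg (sq_nonneg (Real.exp y)) (sq_nonneg v)]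
    have h0 : 0 ≤ 2 * Real.exp y * Real.sinh τ ^ 2 /
        (Real.cosh τ * (Real.exp y ^ 2 + Real.sinh τ ^ 2)) + curvatureExcess y τ :=
      add_nonneg (by positivity) (curvatureExcess_nonneg y τ)
    have h2 : |Real.sinh τ * (-(2 * Real.exp y) / (Real.exp y ^ 2 + Real.sinh τ ^ 2))| ≤ 1 := by
      rw [mul_div_assoc', abs_div, abs_of_pos (by positivity : 0 < Real.exp y ^ 2 + Real.sinh τ ^ 2),
        div_le_one (by positivity), abs_le]
      constructor <;> nlinarith [sq_nonneg (Real.exp y - Real.sinh τ),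
        sq_nonneg (Real.exp y + Real.sinh τ)]
    rw [Real.norm_eq_abs]
    refine (abs_add_le _ _).trans ?_
    rw [abs_mul, mul_assoc q, abs_mul q, abs_of_nonneg h0, mul_comm |p|]
    have := mul_le_mul_of_nonneg_right h1 (abs_nonneg p)
    have := mul_le_mul_of_nonneg_left h2 (abs_nonneg q)
    linarith

/-! ### The packing of one face -/

lemma tendsto_sinh_atTop : Tendsto Real.sinh atTop atTop :=
  tendsto_atTop_mono' _ ((eventually_ge_atTop 0).mono fun _ h => Real.self_le_sinh_iff.2 h)
    tendsto_id

lemma arctan_le_of_nonneg {y : ℝ} (hy : 0 ≤ y) : Real.arctan y ≤ y := by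
  have := Real.le_tan (Real.arctan_nonneg.2 hy) (Real.arctan_lt_pi_div_two y)
  rwa [Real.tan_arctan] at this

lemma logAngle_strictMono (x : ℝ) : StrictMono (logAngle x) := fun _ _ h =>
  Real.arctan_strictMono (mul_lt_mul_of_pos_left (Real.sinh_lt_sinh.2 h) (Real.exp_pos _))

lemma exists_sum_logAngle {n : ℕ} (hn : 3 ≤ n) (x : Fin n → ℝ) :
    ∃ σ, 0 < σ ∧ ∑ i, logAngle (x i) σ = Real.pi := by
  have hcont : Continuous fun σ => ∑ i, logAngle (x i) σ := by
    unfold logAngle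
    fun_prop
  have hlim : Tendsto (fun σ => ∑ i, logAngle (x i) σ) atTop (𝓝 (∑ _i : Fin n, Real.pi / 2)) :=
    tendsto_finsetSum _ fun i _ => (Real.tendsto_arctan_atTop.mono_right nhdsWithin_le_nhds).comp
      (tendsto_sinh_atTop.const_mul_atTop (Real.exp_pos _))
  have hbig : Real.pi < ∑ _i : Fin n, Real.pi / 2 := by
    have : (3 : ℝ) ≤ n := by exact_mod_cast hn
    simp only [Finset.sum_const, Finset.card_univ, Fintype.card_fin, nsmul_eq_mul]
    nlinarith [Real.pi_pos]
  have h0 : ∑ i, logAngle (x i) 0 = 0 := by simp [logAngle]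
  obtain ⟨b, hb, hb0⟩ := ((hlim.eventually_const_lt hbig).and (eventually_gt_atTop 0)).exists
  obtain ⟨σ, hσ, h⟩ := intermediate_value_Icc hb0.le hcont.continuousOn
    (show Real.pi ∈ Icc _ _ from ⟨by rw [h0]; exact Real.pi_pos.le, hb.le⟩)
  refine ⟨σ, hσ.1.lt_of_ne fun h' => ?_, h⟩
  subst h'
  simp only [h0] at h
  exact Real.pi_pos.ne h

/-- The parameter `σ` of the dual circle of a generalized circle packing of a polygon with geodesic
curvatures `exp (x i)`: the solution of the equation that says that the arcs cut from the dual
circle by the disks fill it. -/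
noncomputable def faceParam {n : ℕ} (x : Fin n → ℝ) : ℝ :=
  Classical.epsilon fun σ => 0 < σ ∧ ∑ i, logAngle (x i) σ = Real.pi

/-- The total geodesic curvature of the `i`-th arc of a generalized circle packing of a polygon with
geodesic curvatures `exp (x i)`. -/
noncomputable def faceCurvature {n : ℕ} (x : Fin n → ℝ) (i : Fin n) : ℝ :=
  logCurvature (x i) (faceParam x)

lemma faceParam_pos {n : ℕ} (hn : 3 ≤ n) (x : Fin n → ℝ) : 0 < faceParam x :=
  (Classical.epsilon_spec (exists_sum_logAngle hn x)).1

lemma sum_logAngle_faceParam {n : ℕ} (hn : 3 ≤ n) (x : Fin n → ℝ) :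
    ∑ i, logAngle (x i) (faceParam x) = Real.pi :=
  (Classical.epsilon_spec (exists_sum_logAngle hn x)).2

lemma faceParam_le {n : ℕ} (hn : 3 ≤ n) {x : Fin n → ℝ} {τ : ℝ}
    (h : Real.pi ≤ ∑ i, logAngle (x i) τ) : faceParam x ≤ τ := by
  by_contra! hlt
  have : Nonempty (Fin n) := ⟨⟨0, by omega⟩⟩
  refine absurd (h.trans_lt (Finset.sum_lt_sum_of_nonempty Finset.univ_nonempty fun i _ =>
    logAngle_strictMono (x i) hlt)) ?_
  rw [sum_logAngle_faceParam hn]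
  exact lt_irrefl _

lemma eq_faceParam {n : ℕ} (hn : 3 ≤ n) {x : Fin n → ℝ} {τ : ℝ}
    (h : ∑ i, logAngle (x i) τ = Real.pi) : τ = faceParam x := by
  refine (faceParam_le hn h.ge).antisymm' ?_
  by_contra! hlt
  have : Nonempty (Fin n) := ⟨⟨0, by omega⟩⟩
  refine absurd (Finset.sum_lt_sum_of_nonempty Finset.univ_nonempty fun i _ =>
    logAngle_strictMono (x i) hlt) ?_
  rw [sum_logAngle_faceParam hn, h]
  exact lt_irrefl _

/-- The reason why `faceParam` is nonexpansive: adding `δ` to `σ` compensates adding `δ` to all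
`x i`. -/
lemma exp_mul_sinh_le {σ δ : ℝ} (hδ : 0 ≤ δ) :
    Real.exp δ * Real.sinh σ ≤ Real.sinh (σ + δ) := by
  rw [Real.sinh_eq, Real.sinh_eq, neg_add, Real.exp_add, Real.exp_add]
  have h1 : Real.exp (-δ) ≤ Real.exp δ := Real.exp_le_exp.2 (by linarith)
  nlinarith [Real.exp_pos (-σ)]

lemma faceParam_le_add {n : ℕ} (hn : 3 ≤ n) {x y : Fin n → ℝ} {δ : ℝ} (hδ : 0 ≤ δ)
    (h : ∀ i, y i ≤ x i + δ) : faceParam y ≤ faceParam x + δ := by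
  refine faceParam_le hn ?_
  rw [← sum_logAngle_faceParam hn x]
  refine Finset.sum_le_sum fun i _ => Real.arctan_strictMono.monotone ?_
  have hs := Real.sinh_pos_iff.2 (faceParam_pos hn x)
  calc Real.exp (-x i) * Real.sinh (faceParam x)
      = Real.exp (-(x i + δ)) * (Real.exp δ * Real.sinh (faceParam x)) := by
        rw [← mul_assoc, ← Real.exp_add]; congr 2; ring
    _ ≤ Real.exp (-y i) * Real.sinh (faceParam x + δ) := by
        gcongr
        · exact h i
        · exact exp_mul_sinh_le hδ

lemma abs_faceParam_sub_le {n : ℕ} (hn : 3 ≤ n) {x y : Fin n → ℝ} {δ : ℝ} (hδ : 0 ≤ δ)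
    (h : ∀ i, |y i - x i| ≤ δ) : |faceParam y - faceParam x| ≤ δ := by
  have h1 := faceParam_le_add hn hδ (x := x) (y := y) fun i => by linarith [(abs_le.1 (h i)).2]
  have h2 := faceParam_le_add hn hδ (x := y) (y := x) fun i => by linarith [(abs_le.1 (h i)).1]
  rw [abs_le]
  constructor <;> linarith

lemma exists_faceParam_le {n : ℕ} (hn : 3 ≤ n) (A : ℝ) :
    ∃ B, ∀ x : Fin n → ℝ, (∀ i, |x i| ≤ A) → |faceParam x| ≤ B := by
  refine ⟨faceParam (0 : Fin n → ℝ) + A, fun x hx => ?_⟩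
  have hA : 0 ≤ A := (abs_nonneg _).trans (hx ⟨0, by omega⟩)
  rw [abs_of_pos (faceParam_pos hn x)]
  exact faceParam_le_add hn hA fun i => by simpa using (abs_le.1 (hx i)).2

lemma sum_halfAngle_dualRadius {n : ℕ} (hn : 3 ≤ n) (x : Fin n → ℝ) :
    ∑ i, halfAngle (Real.exp (x i)) (dualRadius (faceParam x)) = Real.pi := by
  rw [← sum_logAngle_faceParam hn x]
  exact Finset.sum_congr rfl fun i _ => (logAngle_eq (x i) (faceParam_pos hn x)).symm

lemma nonempty_polygonPacking {n : ℕ} (hn : 3 ≤ n) {k : Fin n → ℝ} (hk : ∀ i, 0 < k i) :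
    Nonempty (PolygonPacking n k) := by
  refine exists_polygonPacking hk (dualRadius_pos (faceParam_pos hn fun i => Real.log (k i))) ?_
  rw [← sum_halfAngle_dualRadius hn fun i => Real.log (k i)]
  simp only [Real.exp_log (hk _)]

lemma PolygonPacking.totalCurvature_eq_faceCurvature {n : ℕ} (hn : 3 ≤ n) {k : Fin n → ℝ}
    (hk : ∀ i, 0 < k i) (Q : PolygonPacking n k) (i : Fin n) :
    Q.totalCurvature i = faceCurvature (fun i => Real.log (k i)) i := by
  have h1 := (Q.sum_halfAngle hn hk).1
  have h2 : dualRadius Q.radius = faceParam fun i => Real.log (k i) := by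
    refine eq_faceParam hn ?_
    rw [← h1]
    refine Finset.sum_congr rfl fun i _ => ?_
    rw [logAngle_eq _ (dualRadius_pos Q.radius_pos), dualRadius_dualRadius, Real.exp_log (hk i)]
  rw [Q.totalCurvature_eq hn hk, faceCurvature, ← h2, logCurvature_eq _ (dualRadius_pos Q.radius_pos),
    dualRadius_dualRadius, Real.exp_log (hk i)]

lemma faceCurvature_pos {n : ℕ} (hn : 3 ≤ n) (x : Fin n → ℝ) (i : Fin n) :
    0 < faceCurvature x i := logCurvature_pos _ (faceParam_pos hn x)

lemma faceCurvature_lt_pi {n : ℕ} (hn : 3 ≤ n) (x : Fin n → ℝ) (i : Fin n) :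
    faceCurvature x i < Real.pi := logCurvature_lt_pi _ (faceParam_pos hn x)

lemma faceCurvature_eq_arcCurvature {n : ℕ} (hn : 3 ≤ n) (x : Fin n → ℝ) (i : Fin n) :
    faceCurvature x i = arcCurvature (Real.exp (x i)) (dualRadius (faceParam x)) :=
  logCurvature_eq _ (faceParam_pos hn x)

/-- The elementary upper bounds of the total curvatures in `arcCurvature_lt` add up to `π (n - 2)`. -/
lemma sum_arctan_dualRadius {n : ℕ} (hn : 3 ≤ n) (x : Fin n → ℝ) :
    ∑ i, 2 * Real.arctan (Real.exp (x i) * Real.sinh (dualRadius (faceParam x))) =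
      Real.pi * (n - 2) := by
  have h := sum_halfAngle_dualRadius hn x
  simp only [halfAngle, Finset.sum_sub_distrib, Finset.sum_const, Finset.card_univ,
    Fintype.card_fin, nsmul_eq_mul] at h
  rw [← Finset.mul_sum]
  linarith

/-- The Gauss–Bonnet inequality for a generalized polygon: its area is positive. -/
lemma sum_faceCurvature_lt {n : ℕ} (hn : 3 ≤ n) (x : Fin n → ℝ) :
    ∑ i, faceCurvature x i < Real.pi * (n - 2) := by
  have : Nonempty (Fin n) := ⟨⟨0, by omega⟩⟩
  rw [← sum_arctan_dualRadius hn x]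
  refine Finset.sum_lt_sum_of_nonempty Finset.univ_nonempty fun i _ => ?_
  rw [faceCurvature_eq_arcCurvature hn]
  exact arcCurvature_lt (Real.exp_pos _) (dualRadius_pos (faceParam_pos hn x))

lemma sum_faceCurvature_lt_min {n : ℕ} (hn : 3 ≤ n) (x : Fin n → ℝ) {W : Finset (Fin n)}
    (hW : W.Nonempty) :
    ∑ i ∈ W, faceCurvature x i < Real.pi * min (W.card : ℝ) ((n : ℝ) - 2) := by
  rw [mul_min_of_nonneg _ _ Real.pi_pos.le, lt_min_iff]
  constructor
  · rw [mul_comm, ← nsmul_eq_mul, ← Finset.sum_const]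
    exact Finset.sum_lt_sum_of_nonempty hW fun i _ => faceCurvature_lt_pi hn x i
  · exact (Finset.sum_le_univ_sum_of_nonneg fun i => (faceCurvature_pos hn x i).le).trans_lt
      (sum_faceCurvature_lt hn x)

lemma abs_faceCurvature_sub_le {n : ℕ} (hn : 3 ≤ n) {x y : Fin n → ℝ} {δ : ℝ} (hδ : 0 ≤ δ)
    (h : ∀ i, |y i - x i| ≤ δ) (i : Fin n) :
    |faceCurvature y i - faceCurvature x i| ≤ (Real.pi + 1) * δ := by
  have h1 := abs_logCurvature_sub_le (x := x i) (x' := y i) (faceParam_pos hn x) (faceParam_pos hn y)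
  have h2 := abs_faceParam_sub_le hn hδ h
  have h3 := mul_le_mul_of_nonneg_left (h i) Real.pi_pos.le
  unfold faceCurvature
  linarith

/-- The total curvatures of the arcs are strongly monotone functions of the logarithms of the
curvatures, on bounded sets. -/
lemma exists_faceCurvature_monotone {n : ℕ} (hn : 3 ≤ n) (A : ℝ) : ∃ c > 0, ∀ x y : Fin n → ℝ,
    (∀ i, |x i| ≤ A) → (∀ i, |y i| ≤ A) → c * ∑ i, (y i - x i) ^ 2 ≤
      ∑ i, (faceCurvature y i - faceCurvature x i) * (y i - x i) := by
  obtain ⟨B, hB⟩ := exists_faceParam_le hn A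
  have hcB := Real.cosh_pos B
  refine ⟨2 * Real.exp (-A) / (3 * (Real.cosh B * (Real.cosh B ^ 2 + Real.exp A ^ 2))),
    by positivity, fun x y hx hy => ?_⟩
  have key := Finset.sum_le_sum fun i (_ : i ∈ Finset.univ) =>
    logCurvature_monotone (hx i) (hy i) (hB x hx) (hB y hy)
  -- the angle terms cancel, because their sum over the vertices of a face is constant
  rw [Finset.sum_add_distrib, ← Finset.mul_sum, ← Finset.sum_mul, ← Finset.mul_sum,
    Finset.sum_sub_distrib, sum_logAngle_faceParam hn, sum_logAngle_faceParam hn] at key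
  simpa [faceCurvature] using key

/-- If the curvatures at the vertices in `W` are large and the others are bounded, then the
inequality `sum_faceCurvature_lt_min` is nearly an equality. -/
lemma exists_le_sum_faceCurvature {n : ℕ} (hn : 3 ≤ n) (B : ℝ) {ε : ℝ} (hε : 0 < ε) :
    ∃ A, ∀ (x : Fin n → ℝ) (W : Finset (Fin n)), (∀ i ∈ W, A ≤ x i) → (∀ i ∉ W, x i ≤ B) →
      Real.pi * min (W.card : ℝ) ((n : ℝ) - 2) - ε ≤ ∑ i ∈ W, faceCurvature x i := by
  have hn' : (3 : ℝ) ≤ n := by exact_mod_cast hn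
  have hπ := Real.pi_pos
  set E := Real.pi * (n - 2) + 2 * n * Real.exp B with hE
  have hE0 : 0 < E := add_pos (mul_pos hπ (by linarith)) (by positivity)
  obtain ⟨A, hA⟩ := exists_le_arcCurvature (ε := ε / n) (r₀ := Real.arsinh (ε / E))
    (by positivity) (Real.arsinh_pos_iff.2 (by positivity))
  refine ⟨A, fun x W hW hWc => ?_⟩
  have hr := dualRadius_pos (faceParam_pos hn x)
  have hsum := sum_arctan_dualRadius hn x
  simp only [faceCurvature_eq_arcCurvature hn]
  set r := dualRadius (faceParam x)
  rw [mul_min_of_nonneg _ _ hπ.le]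
  -- If the radius of the dual circle is bounded below, then the arcs in `W` all have total curvature
  -- close to `π`. If it is small, the polygon is almost Euclidean and the total curvatures almost add
  -- up to `π (n - 2)`, with only a small share for the arcs outside `W`.
  rcases le_or_gt (Real.arsinh (ε / E)) r with h | h
  · refine (sub_le_sub_right (min_le_left _ _) ε).trans ?_
    have h1 : (W.card : ℝ) * (Real.pi - ε / n) ≤ ∑ i ∈ W, arcCurvature (Real.exp (x i)) r := by
      rw [← nsmul_eq_mul, ← Finset.sum_const]
      exact Finset.sum_le_sum fun i hi => hA (x i) (hW i hi) r h
    have h2 : (W.card : ℝ) ≤ n := by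
      exact_mod_cast (Finset.card_le_univ W).trans_eq (Fintype.card_fin n)
    have h3 : (W.card : ℝ) * (ε / n) ≤ ε := by
      rw [mul_div_assoc', div_le_iff₀ (by positivity)]
      nlinarith
    nlinarith
  · refine (sub_le_sub_right (min_le_right _ _) ε).trans ?_
    have hs := Real.sinh_pos_iff.2 hr
    have hs' : Real.sinh r * E ≤ ε := by
      rw [← le_div_iff₀ hE0, ← Real.sinh_arsinh (ε / E)]
      exact (Real.sinh_lt_sinh.2 h).le
    have hc := Real.one_le_cosh r
    have hc' : Real.cosh r ≤ 1 + Real.sinh r := by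
      have := Real.cosh_sq r
      nlinarith
    have h1 : (∑ i ∈ W, 2 * Real.arctan (Real.exp (x i) * Real.sinh r)) / Real.cosh r ≤
        ∑ i ∈ W, arcCurvature (Real.exp (x i)) r := by
      rw [Finset.sum_div]
      exact Finset.sum_le_sum fun i _ => le_arcCurvature (Real.exp_pos _) hr
    refine le_trans ?_ h1
    have h2 : ∑ i ∈ Wᶜ, 2 * Real.arctan (Real.exp (x i) * Real.sinh r) ≤
        2 * n * Real.exp B * Real.sinh r := by
      have h3 : ∀ i ∈ Wᶜ, 2 * Real.arctan (Real.exp (x i) * Real.sinh r) ≤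
          2 * (Real.exp B * Real.sinh r) := fun i hi => by
        have h4 := arctan_le_of_nonneg (y := Real.exp (x i) * Real.sinh r) (by positivity)
        have h5 := mul_le_mul_of_nonneg_right
          (Real.exp_le_exp.2 (hWc i (Finset.mem_compl.1 hi))) hs.le
        linarith
      refine (Finset.sum_le_sum h3).trans ?_
      rw [Finset.sum_const, nsmul_eq_mul]
      have h6 : ((Wᶜ).card : ℝ) ≤ n := by
        exact_mod_cast (Finset.card_le_univ Wᶜ).trans_eq (Fintype.card_fin n)
      have : 0 ≤ Real.exp B * Real.sinh r := by positivity
      nlinarith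
    rw [← Finset.sum_add_sum_compl W] at hsum
    rw [le_div_iff₀ (by linarith)]
    have h7 : 0 ≤ Real.pi * ((n : ℝ) - 2) := mul_nonneg hπ.le (by linarith)
    nlinarith

/-! ### Every vertex is a corner of a face -/

/-- A plane disk does not embed in the line: on a circle around its centre, the difference of the
values at antipodal points is odd, hence vanishes somewhere. -/
lemma not_injOn_ball_of_continuousOn {f : EuclideanSpace ℝ (Fin 2) → ℝ}
    {c : EuclideanSpace ℝ (Fin 2)} {r : ℝ} (hr : 0 < r) (hf : ContinuousOn f (Metric.ball c r)) :
    ¬ InjOn f (Metric.ball c r) := by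
  intro hinj
  have hrank : 1 < Module.rank ℝ (EuclideanSpace ℝ (Fin 2)) := by
    rw [rank_eq_card_basis (EuclideanSpace.basisFun (Fin 2) ℝ).toBasis]
    simp
  have hpre := isPreconnected_sphere hrank (0 : EuclideanSpace ℝ (Fin 2)) (r / 2)
  obtain ⟨u, hu⟩ := NormedSpace.sphere_nonempty (x := (0 : EuclideanSpace ℝ (Fin 2))) (r := r / 2) |>.2
    (by positivity)
  have hball : ∀ u ∈ Metric.sphere (0 : EuclideanSpace ℝ (Fin 2)) (r / 2), c + u ∈ Metric.ball c r ∧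
      c - u ∈ Metric.ball c r := by
    intro u hu
    rw [mem_sphere_zero_iff_norm] at hu
    constructor
    · rw [Metric.mem_ball, dist_eq_norm, add_sub_cancel_left, hu]; linarith
    · rw [Metric.mem_ball, dist_eq_norm, sub_sub_cancel_left, norm_neg, hu]; linarith
  have hg : ContinuousOn (fun u => f (c + u) - f (c - u)) (Metric.sphere 0 (r / 2)) :=
    (hf.comp (by fun_prop) fun u hu => (hball u hu).1).sub
      (hf.comp (by fun_prop) fun u hu => (hball u hu).2)
  have hu' : -u ∈ Metric.sphere (0 : EuclideanSpace ℝ (Fin 2)) (r / 2) := by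
    simpa using hu
  have hzero : (0 : ℝ) ∈ (fun u => f (c + u) - f (c - u)) '' Metric.sphere 0 (r / 2) := by
    rcases le_total (f (c + u) - f (c - u)) 0 with h | h
    · refine hpre.intermediate_value hu hu' hg ⟨h, ?_⟩
      simp only [sub_neg_eq_add, ← sub_eq_add_neg]
      linarith
    · refine hpre.intermediate_value hu' hu hg ⟨?_, h⟩
      simp only [sub_neg_eq_add, ← sub_eq_add_neg]
      linarith
  obtain ⟨w, hw, hw0⟩ := hzero
  have h1 := hinj (hball w hw).1 (hball w hw).2 (sub_eq_zero.1 hw0)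
  have h2 : w = 0 := by
    have h3 : w = -w := add_left_cancel (h1.trans (sub_eq_add_neg c w))
    have h4 : (2 : ℝ) • w = 0 := by rw [two_smul]; nth_rw 2 [h3]; exact add_neg_cancel w
    exact (smul_eq_zero.1 h4).resolve_left two_ne_zero
  rw [h2, mem_sphere_zero_iff_norm, norm_zero] at hw
  linarith

section Surface

variable {S : Type*} [TopologicalSpace S] [ChartedSpace (EuclideanHalfSpace 2) S]

/-- Every nonempty open subset of a surface with boundary contains an embedded disk. -/
lemma exists_ball_embedding {U : Set S} (hU : IsOpen U) (hne : U.Nonempty) :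
    ∃ (c : EuclideanSpace ℝ (Fin 2)) (r : ℝ) (h : EuclideanSpace ℝ (Fin 2) → S), 0 < r ∧
      ContinuousOn h (Metric.ball c r) ∧ InjOn h (Metric.ball c r) ∧
      MapsTo h (Metric.ball c r) U := by
  obtain ⟨x, hx⟩ := hne
  set e := extChartAt (𝓡∂ 2) x
  have hy : e x ∈ e.target := mem_extChartAt_target x
  have hcont : ContinuousOn e.symm e.target := continuousOn_extChartAt_symm x
  have hmem : e.symm ⁻¹' U ∈ 𝓝[e.target] (e x) := by
    refine (hcont _ hy).preimage_mem_nhdsWithin (hU.mem_nhds ?_)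
    rwa [extChartAt_to_inv]
  obtain ⟨O, hO, hxO, hOU⟩ := mem_nhdsWithin.1 hmem
  obtain ⟨c, hcO, hc⟩ := mem_closure_iff.1 (extChartAt_target_subset_closure_interior hy) O hO hxO
  obtain ⟨r, hr, hball⟩ := Metric.isOpen_iff.1 (hO.inter isOpen_interior) c ⟨hcO, hc⟩
  refine ⟨c, r, e.symm, hr, hcont.mono fun z hz => interior_subset (hball hz).2,
    e.symm.injOn.mono fun z hz => interior_subset (hball hz).2, fun z hz =>
      hOU ⟨(hball hz).1, interior_subset (hball hz).2⟩⟩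

/-- An arc in a surface has empty interior: a disk inside it would embed in an interval. -/
lemma interior_range_arc [T2Space S] {γ : C(unitInterval, S)} (hγ : Function.Injective γ) :
    interior (range γ) = ∅ := by
  by_contra! hne
  obtain ⟨c, r, h, hr, hc, hi, hm⟩ := exists_ball_embedding isOpen_interior hne
  have hemb : IsEmbedding γ := (γ.continuous.isClosedEmbedding hγ).isEmbedding
  have hinv : ∀ z, ∃ t, z ∈ Metric.ball c r → γ t = h z := fun z => by
    by_cases hz : z ∈ Metric.ball c r
    · obtain ⟨t, ht⟩ := interior_subset (hm hz)
      exact ⟨t, fun _ => ht⟩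
    · exact ⟨0, fun hz' => absurd hz' hz⟩
  choose t ht using hinv
  refine not_injOn_ball_of_continuousOn (c := c) (f := fun z => (t z : ℝ)) hr ?_ ?_
  · refine continuous_subtype_val.comp_continuousOn (hemb.continuousOn_iff.2 ?_)
    exact hc.congr fun z hz => ht z hz
  · intro z hz z' hz' heq
    refine hi hz hz' ?_
    rw [← ht z hz, ← ht z' hz', Subtype.ext heq]

variable {V F : Type*} [Fintype V] [Fintype F]

/-- Every vertex is a corner of a face: the edges are arcs, so that the complement of the graph is
dense, and every vertex lies in the closure of one of the finitely many faces, hence in its frontier. -/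
lemma PolygonalDecomposition.exists_corner_eq [T2Space S] [CompactSpace S]
    (D : PolygonalDecomposition S V F) (v : V) : ∃ f j, D.corner f j = v := by
  set X := range D.point ∪ ⋃ e, D.edge e with hX
  have harc : ∀ e : D.graph.edgeSet, ∃ γ : C(unitInterval, S),
      Function.Injective γ ∧ range γ = D.edge e ∧ ∀ w ∈ (e : Sym2 V), D.point w ∈ D.edge e := by
    rintro ⟨e, he⟩
    induction e with
    | h a b =>
      obtain ⟨γ, h1, h2, h3, h4⟩ := D.edge_arc a b he
      refine ⟨γ, h1, h4, fun w hw => ?_⟩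
      rw [← h4]
      rcases Sym2.mem_iff.1 hw with rfl | rfl
      · exact ⟨0, h2⟩
      · exact ⟨1, h3⟩
  have hXe : X = ⋃ e, D.edge e := by
    rw [hX, union_eq_right]
    rintro _ ⟨w, rfl⟩
    have h3 := D.three_le_degree w
    obtain ⟨u, hu⟩ : (D.graph.neighborSet w).Nonempty :=
      nonempty_of_ncard_ne_zero (by omega)
    exact mem_iUnion.2 ⟨⟨s(w, u), hu⟩, (harc ⟨s(w, u), hu⟩).choose_spec.2.2 w (by simp)⟩
  have hdense : Dense Xᶜ := by
    rw [hXe, compl_iUnion]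
    refine dense_iInter_of_isOpen (fun e => ?_) fun e => ?_
    all_goals obtain ⟨γ, h1, h2, -⟩ := harc e
    · rw [← h2]
      exact (isCompact_range γ.continuous).isClosed.isOpen_compl
    · rw [← interior_eq_empty_iff_dense_compl, ← h2]
      exact interior_range_arc h1
  have hcover : Xᶜ ⊆ ⋃ f, D.face f := by
    intro y hy
    have : connectedComponentIn Xᶜ y ∈ range D.face := by
      rw [D.range_face]; exact ⟨y, hy, rfl⟩
    obtain ⟨f, hf⟩ := this
    exact mem_iUnion.2 ⟨f, by rw [hf]; exact mem_connectedComponentIn hy⟩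
  have hface : ∀ f, D.face f ⊆ Xᶜ := by
    intro f
    have : D.face f ∈ range D.face := ⟨f, rfl⟩
    rw [D.range_face] at this
    obtain ⟨y, -, hy⟩ := this
    rw [hy]
    exact connectedComponentIn_subset _ _
  have hv : D.point v ∈ ⋃ f, closure (D.face f) := by
    rw [← closure_iUnion_of_finite, (hdense.mono hcover).closure_eq]
    trivial
  obtain ⟨f, hf⟩ := mem_iUnion.1 hv
  have hfr : D.point v ∈ frontier (D.face f) :=
    ⟨hf, fun h => hface f (interior_subset h) (Or.inl ⟨v, rfl⟩)⟩
  rw [D.frontier_face f] at hfr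
  simp only [mem_iUnion] at hfr
  obtain ⟨e, ⟨i, j, -, hij⟩, he⟩ := hfr
  have := D.mem_of_point_mem_edge v e he
  rw [hij, Sym2.mem_iff] at this
  rcases this with h | h
  · exact ⟨f, i, h.symm⟩
  · exact ⟨f, j, h.symm⟩

end Surface

/-! ### The total geodesic curvatures of a packing metric -/

namespace PolygonalDecomposition

section

variable {S : Type*} [TopologicalSpace S] [ChartedSpace (EuclideanHalfSpace 2) S]
  {V F : Type*} [Fintype V] [Fintype F]

open Classical in
/-- The total geodesic curvatures of the packing metric with geodesic curvatures `exp (x i)`. -/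
noncomputable def curvatureMap (D : PolygonalDecomposition S V F) (x : V → ℝ) (i : V) : ℝ :=
  ∑ f, ∑ j, if D.corner f j = i then faceCurvature (fun j => x (D.corner f j)) j else 0

variable (D : PolygonalDecomposition S V F)

lemma nonempty_packingMetric {k : V → ℝ} (hk : ∀ i, 0 < k i) : Nonempty (D.PackingMetric k) :=
  ⟨fun f => (nonempty_polygonPacking (D.three_le_size f) fun j => hk (D.corner f j)).some⟩

lemma totalCurvature_eq_curvatureMap {k : V → ℝ} (hk : ∀ i, 0 < k i) (M : D.PackingMetric k) :
    D.totalCurvature M = D.curvatureMap fun i => Real.log (k i) := by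
  funext i
  unfold totalCurvature curvatureMap
  refine Finset.sum_congr rfl fun f _ => Finset.sum_congr rfl fun j _ => ?_
  rw [(M f).totalCurvature_eq_faceCurvature (D.three_le_size f) fun j => hk (D.corner f j)]

lemma sum_curvatureMap_mul (x w : V → ℝ) : ∑ i, D.curvatureMap x i * w i =
    ∑ f, ∑ j, faceCurvature (fun j => x (D.corner f j)) j * w (D.corner f j) := by
  classical
  simp only [curvatureMap, Finset.sum_mul]
  rw [Finset.sum_comm]
  refine Finset.sum_congr rfl fun f _ => ?_
  rw [Finset.sum_comm]
  refine Finset.sum_congr rfl fun j _ => ?_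
  simp [ite_mul]

open Classical in
lemma sum_curvatureMap (x : V → ℝ) (W : Finset V) : ∑ i ∈ W, D.curvatureMap x i =
    ∑ f ∈ D.facesMeeting W, ∑ j with D.corner f j ∈ W,
      faceCurvature (fun j => x (D.corner f j)) j := by
  have h := D.sum_curvatureMap_mul x fun i => if i ∈ W then 1 else 0
  simp only [mul_ite, mul_one, mul_zero, ← Finset.sum_filter, Finset.filter_univ_mem] at h
  rw [h]
  refine (Finset.sum_subset (Finset.subset_univ _) fun f _ hf => Finset.sum_eq_zero
    fun j hj => absurd ?_ hf).symm
  exact Finset.mem_filter.2 ⟨Finset.mem_univ _, _, (Finset.mem_filter.1 hj).2, j, rfl⟩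

open Classical in
lemma cornersIn_eq (f : F) (W : Finset V) :
    D.cornersIn f W = (Finset.univ.filter fun j => D.corner f j ∈ W).card := by
  rw [cornersIn, ← Finset.card_image_of_injective _ (D.corner_injective f)]
  congr 1
  ext v
  simp only [Finset.mem_filter, mem_range, Finset.mem_image, Finset.mem_univ, true_and]
  constructor
  · rintro ⟨hv, j, rfl⟩; exact ⟨j, hv, rfl⟩
  · rintro ⟨j, hj, rfl⟩; exact ⟨hj, j, rfl⟩

lemma exists_abs_curvatureMap_sub_le : ∃ K > 0, ∀ (x y : V → ℝ) (δ : ℝ), 0 ≤ δ →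
    (∀ i, |y i - x i| ≤ δ) → ∀ i, |D.curvatureMap y i - D.curvatureMap x i| ≤ K * δ := by
  classical
  have hπ := Real.pi_pos
  refine ⟨1 + ∑ f : F, ∑ _j : Fin (D.size f), (Real.pi + 1), by positivity,
    fun x y δ hδ h i => ?_⟩
  rw [add_mul, Finset.sum_mul]
  refine le_add_of_nonneg_of_le (by positivity) ?_
  simp only [curvatureMap, ← Finset.sum_sub_distrib, Finset.sum_mul]
  refine (Finset.abs_sum_le_sum_abs _ _).trans (Finset.sum_le_sum fun f _ =>
    (Finset.abs_sum_le_sum_abs _ _).trans (Finset.sum_le_sum fun j _ => ?_))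
  split_ifs with hj
  · exact abs_faceCurvature_sub_le (D.three_le_size f) hδ (fun j => h _) j
  · rw [sub_zero, abs_zero]; positivity

lemma exists_abs_curvatureMap_le : ∃ M, ∀ x i, |D.curvatureMap x i| ≤ M := by
  classical
  refine ⟨∑ f : F, ∑ _j : Fin (D.size f), Real.pi, fun x i => ?_⟩
  refine (Finset.abs_sum_le_sum_abs _ _).trans (Finset.sum_le_sum fun f _ =>
    (Finset.abs_sum_le_sum_abs _ _).trans (Finset.sum_le_sum fun j _ => ?_))
  split_ifs with hj
  · rw [abs_of_pos (faceCurvature_pos (D.three_le_size f) _ j)]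
    exact (faceCurvature_lt_pi (D.three_le_size f) _ j).le
  · rw [abs_zero]; exact Real.pi_pos.le

/-- A vertex with a small curvature has a small total curvature. -/
lemma exists_curvatureMap_le {ε : ℝ} (hε : 0 < ε) :
    ∃ A, ∀ x i, x i ≤ A → D.curvatureMap x i ≤ ε := by
  classical
  have hK : (0 : ℝ) < 1 + ∑ f : F, ∑ _j : Fin (D.size f), 1 := by positivity
  obtain ⟨A, hA⟩ := exists_arcCurvature_le
    (show 0 < ε / (1 + ∑ f : F, ∑ _j : Fin (D.size f), 1) by positivity)
  refine ⟨A, fun x i hi => ?_⟩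
  have : D.curvatureMap x i ≤ (ε / (1 + ∑ f : F, ∑ _j : Fin (D.size f), 1)) *
      ∑ f : F, ∑ _j : Fin (D.size f), 1 := by
    simp only [curvatureMap, Finset.mul_sum, mul_one]
    refine Finset.sum_le_sum fun f _ => Finset.sum_le_sum fun j _ => ?_
    split_ifs with hj
    · rw [faceCurvature_eq_arcCurvature (D.three_le_size f)]
      exact hA _ (by rw [hj]; exact hi) _
    · positivity
  refine this.trans ?_
  rw [div_mul_eq_mul_div, div_le_iff₀ hK]
  nlinarith

open Classical in
/-- If the curvatures at the vertices in `W` are large and the others are bounded, then the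
inequality for `W` that defines admissibility is nearly an equality. -/
lemma exists_le_sum_curvatureMap (B : ℝ) {ε : ℝ} (hε : 0 < ε) :
    ∃ A, ∀ (x : V → ℝ) (W : Finset V), (∀ i ∈ W, A ≤ x i) → (∀ i ∉ W, x i ≤ B) →
      ∑ f ∈ D.facesMeeting W, Real.pi * min (D.cornersIn f W : ℝ) ((D.size f : ℝ) - 2) - ε ≤
        ∑ i ∈ W, D.curvatureMap x i := by
  have hK : (0 : ℝ) < 1 + ∑ f : F, 1 := by positivity
  have hε' : 0 < ε / (1 + ∑ f : F, 1) := by positivity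
  choose A hA using fun f => exists_le_sum_faceCurvature (D.three_le_size f) B hε'
  obtain ⟨A', hA'⟩ : ∃ A', ∀ f, A f ≤ A' := Finite.exists_le A
  refine ⟨A', fun x W hW hWc => ?_⟩
  rw [D.sum_curvatureMap]
  have h1 : ∑ f ∈ D.facesMeeting W, ε / (1 + ∑ f : F, 1) ≤ ε := by
    refine (Finset.sum_le_univ_sum_of_nonneg fun f => hε'.le).trans ?_
    rw [← mul_one (ε / _), ← Finset.mul_sum, div_mul_eq_mul_div, div_le_iff₀ hK]
    nlinarith
  refine (sub_le_sub_left h1 _).trans ?_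
  rw [← Finset.sum_sub_distrib]
  refine Finset.sum_le_sum fun f _ => ?_
  rw [D.cornersIn_eq]
  refine hA f _ _ (fun j hj => (hA' f).trans (hW _ (Finset.mem_filter.1 hj).2)) fun j hj =>
    hWc _ fun h => hj (Finset.mem_filter.2 ⟨Finset.mem_univ _, h⟩)

end

section

variable {S : Type*} [TopologicalSpace S] [T2Space S] [CompactSpace S]
  [ChartedSpace (EuclideanHalfSpace 2) S] {V F : Type*} [Fintype V] [Fintype F]
  (D : PolygonalDecomposition S V F)

lemma curvatureMap_pos (x : V → ℝ) (i : V) : 0 < D.curvatureMap x i := by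
  classical
  obtain ⟨f, j, hj⟩ := D.exists_corner_eq i
  have h0 : ∀ f j, 0 ≤ if D.corner f j = i then faceCurvature (fun j => x (D.corner f j)) j else 0 :=
    fun f j => by
      split_ifs
      · exact (faceCurvature_pos (D.three_le_size f) _ _).le
      · exact le_rfl
  unfold curvatureMap
  refine Finset.sum_pos' (fun f _ => Finset.sum_nonneg fun j _ => h0 f j) ⟨f, Finset.mem_univ _, ?_⟩
  refine Finset.sum_pos' (fun j _ => h0 f j) ⟨j, Finset.mem_univ _, ?_⟩
  rw [if_pos hj]
  exact faceCurvature_pos (D.three_le_size f) _ _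

theorem curvatureMap_mem_admissible (x : V → ℝ) : D.curvatureMap x ∈ D.admissible := by
  classical
  refine ⟨D.curvatureMap_pos x, fun W hW => ?_⟩
  rw [D.sum_curvatureMap]
  obtain ⟨v, hv⟩ := hW
  obtain ⟨f, j, hj⟩ := D.exists_corner_eq v
  refine Finset.sum_lt_sum_of_nonempty ⟨f, Finset.mem_filter.2 ⟨Finset.mem_univ _, v, hv, j, hj⟩⟩
    fun f hf => ?_
  rw [D.cornersIn_eq]
  refine sum_faceCurvature_lt_min (D.three_le_size f) _ ?_
  obtain ⟨-, w, hw, j, rfl⟩ := Finset.mem_filter.1 hf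
  exact ⟨j, Finset.mem_filter.2 ⟨Finset.mem_univ _, hw⟩⟩

/-- The total curvatures are strongly monotone functions of the logarithms of the curvatures, on
bounded sets. -/
theorem exists_curvatureMap_monotone (A : ℝ) : ∃ c > 0, ∀ x y : V → ℝ,
    (∀ i, |x i| ≤ A) → (∀ i, |y i| ≤ A) → c * ∑ i, (y i - x i) ^ 2 ≤
      ∑ i, (D.curvatureMap y i - D.curvatureMap x i) * (y i - x i) := by
  classical
  choose c hc0 hc using fun f => exists_faceCurvature_monotone (D.three_le_size f) A
  obtain ⟨c', hc'0, hc'⟩ : ∃ c' > 0, ∀ f, c' ≤ c f := by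
    rcases isEmpty_or_nonempty F with h | h
    · exact ⟨1, one_pos, fun f => h.elim f⟩
    · obtain ⟨f, hf⟩ := Finite.exists_min c
      exact ⟨c f, hc0 f, hf⟩
  refine ⟨c', hc'0, fun x y hx hy => ?_⟩
  simp only [sub_mul, Finset.sum_sub_distrib]
  rw [D.sum_curvatureMap_mul y, D.sum_curvatureMap_mul x, ← Finset.sum_sub_distrib]
  simp only [← Finset.sum_sub_distrib, ← sub_mul]
  have hcov : ∑ i, (y i - x i) ^ 2 ≤ ∑ f, ∑ j, (y (D.corner f j) - x (D.corner f j)) ^ 2 := by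
    rw [Finset.sum_sigma' Finset.univ (fun f => (Finset.univ : Finset (Fin (D.size f))))
      fun f j => (y (D.corner f j) - x (D.corner f j)) ^ 2]
    -- a corner at each vertex picks out the summand of that vertex
    choose f j hj using D.exists_corner_eq
    have hinj : Function.Injective fun v => (⟨f v, j v⟩ : Σ f, Fin (D.size f)) := by
      intro v w h
      have := congrArg (fun p : Σ f, Fin (D.size f) => D.corner p.1 p.2) h
      simpa only [hj] using this
    calc ∑ i, (y i - x i) ^ 2
        = ∑ p ∈ Finset.univ.image fun v => (⟨f v, j v⟩ : Σ f, Fin (D.size f)),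
            (y (D.corner p.1 p.2) - x (D.corner p.1 p.2)) ^ 2 := by
          rw [Finset.sum_image fun _ _ _ _ h => hinj h]
          simp only [hj]
      _ ≤ _ := Finset.sum_le_sum_of_subset_of_nonneg (fun p _ => by simp)
          fun p _ _ => sq_nonneg _
  refine (mul_le_mul_of_nonneg_left hcov hc'0.le).trans ?_
  rw [Finset.mul_sum]
  refine Finset.sum_le_sum fun g _ => le_trans ?_ (hc g _ _ (fun j => hx _) fun j => hy _)
  exact mul_le_mul_of_nonneg_right (hc' g) (Finset.sum_nonneg fun j _ => sq_nonneg _)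

end

end PolygonalDecomposition

/-! ### Strongly monotone maps and their gradient-like flows -/

/-- A bounded Lipschitz vector field is complete. -/
lemma exists_hasDerivAt_of_lipschitz_bounded {E : Type*} [NormedAddCommGroup E] [NormedSpace ℝ E]
    [CompleteSpace E] {f : E → E} {K M : NNReal} (hf : LipschitzWith K f) (hM : ∀ x, ‖f x‖ ≤ M)
    (x₀ : E) : ∃ x : ℝ → E, x 0 = x₀ ∧ ∀ t, HasDerivAt x (f (x t)) t := by
  have hloc : ∀ n : ℕ, ∃ α : ℝ → E, α 0 = x₀ ∧
      ∀ t ∈ Ioo (-(n + 1 : ℝ)) (n + 1), HasDerivAt α (f (α t)) t := by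
    intro n
    have hn : (0 : ℝ) ≤ n + 1 := by positivity
    have hpl : IsPicardLindelof (fun _ => f) (tmin := -(n + 1 : ℝ)) (tmax := n + 1)
        ⟨0, by constructor <;> linarith⟩ x₀ (M * (n + 1)) 0 M K := by
      refine IsPicardLindelof.of_time_independent (fun x _ => hM x) hf.lipschitzOnWith ?_
      simp
    obtain ⟨α, h0, hα⟩ := hpl.exists_eq_forall_mem_Icc_hasDerivWithinAt₀
    exact ⟨α, h0, fun t ht => (hα t (Ioo_subset_Icc_self ht)).hasDerivAt
      (Icc_mem_nhds ht.1 ht.2)⟩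
  choose α h0 hα using hloc
  have huniq : ∀ n m : ℕ, n ≤ m → EqOn (α n) (α m) (Ioo (-(n + 1 : ℝ)) (n + 1)) := by
    intro n m hnm
    have hnm' : (n : ℝ) ≤ m := by exact_mod_cast hnm
    refine ODE_solution_unique_of_mem_Ioo (v := fun _ => f) (s := fun _ => univ) (t₀ := 0) (K := K)
      (fun t _ => hf.lipschitzOnWith) ⟨by linarith [n.cast_nonneg (α := ℝ)],
        by linarith [n.cast_nonneg (α := ℝ)]⟩ (fun t ht => ⟨hα n t ht, trivial⟩)
      (fun t ht => ⟨hα m t ⟨by linarith [ht.1], by linarith [ht.2]⟩, trivial⟩) ?_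
    rw [h0, h0]
  have hmem : ∀ (t : ℝ) (n : ℕ), |t| ≤ n → t ∈ Ioo (-(n + 1 : ℝ)) (n + 1) := by
    intro t n h
    rw [abs_le] at h
    constructor <;> linarith
  have heq : ∀ (t : ℝ) (n : ℕ), |t| ≤ n → α ⌈|t|⌉₊ t = α n t := fun t n h =>
    huniq _ n (Nat.ceil_le.2 h) (hmem t _ (Nat.le_ceil _))
  refine ⟨fun t => α ⌈|t|⌉₊ t, h0 _, fun t => ?_⟩
  have hlt : |t| < (⌈|t|⌉₊ + 1 : ℕ) := by
    push_cast
    linarith [Nat.le_ceil |t|]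
  have hev : (fun t => α ⌈|t|⌉₊ t) =ᶠ[𝓝 t] α (⌈|t|⌉₊ + 1) := by
    filter_upwards [continuous_abs.continuousAt.eventually (gt_mem_nhds hlt)] with s hs
    exact heq s _ hs.le
  have := (hα (⌈|t|⌉₊ + 1) t (hmem t _ hlt.le)).congr_of_eventuallyEq hev
  rwa [← heq t _ hlt.le] at this

/-- A Lipschitz strongly monotone map `f` of a Hilbert space has a zero, the fixed point of the
contraction `x ↦ x - δ f x` for small `δ`. -/
lemma exists_eq_zero_of_strongly_monotone {E : Type*} [NormedAddCommGroup E]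
    [InnerProductSpace ℝ E] [CompleteSpace E] {f : E → E} {K : NNReal} (hf : LipschitzWith K f)
    {ε : ℝ} (hε : 0 < ε) (hmon : ∀ x y, ε * ‖x - y‖ ^ 2 ≤ inner ℝ (f x - f y) (x - y)) :
    ∃ x, f x = 0 := by
  set L : ℝ := K + ε with hL
  have hL0 : 0 < L := by positivity
  have hεL : ε ≤ L := by rw [hL]; linarith [K.coe_nonneg]
  set δ : ℝ := ε / L ^ 2 with hδ
  have hδ0 : 0 < δ := by positivity
  have hq1 : 0 ≤ 1 - ε ^ 2 / L ^ 2 := by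
    rw [sub_nonneg, div_le_one (by positivity)]
    gcongr
  have hq2 : 1 - ε ^ 2 / L ^ 2 < 1 := by
    have : 0 < ε ^ 2 / L ^ 2 := by positivity
    linarith
  obtain ⟨q, hq⟩ : ∃ q : NNReal, (q : ℝ) = √(1 - ε ^ 2 / L ^ 2) :=
    ⟨Real.toNNReal _, Real.coe_toNNReal _ (Real.sqrt_nonneg _)⟩
  have hcon : ContractingWith q fun x => x - δ • f x := by
    refine ⟨?_, LipschitzWith.of_dist_le_mul fun x y => ?_⟩
    · rw [← NNReal.coe_lt_coe, hq]
      exact (Real.sqrt_lt_sqrt hq1 hq2).trans_eq Real.sqrt_one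
    · rw [dist_eq_norm, dist_eq_norm, hq,
        ← pow_le_pow_iff_left₀ (norm_nonneg _) (by positivity) two_ne_zero, mul_pow,
        Real.sq_sqrt hq1]
      have e1 : x - δ • f x - (y - δ • f y) = (x - y) - δ • (f x - f y) := by
        rw [smul_sub]; abel
      rw [e1, norm_sub_sq_real, inner_smul_right, real_inner_comm, norm_smul, mul_pow,
        Real.norm_eq_abs, sq_abs]
      have h1 := hmon x y
      have h2 : ‖f x - f y‖ ≤ L * ‖x - y‖ := by
        have := hf.dist_le_mul x y
        rw [dist_eq_norm, dist_eq_norm] at this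
        refine this.trans ?_
        gcongr
        rw [hL]; linarith
      have h3 : ‖f x - f y‖ ^ 2 ≤ L ^ 2 * ‖x - y‖ ^ 2 := by
        rw [← mul_pow]; gcongr
      have h4 := mul_le_mul_of_nonneg_left h1 hδ0.le
      have h5 := mul_le_mul_of_nonneg_left h3 (sq_nonneg δ)
      have h6 : δ * (ε * ‖x - y‖ ^ 2) = ε ^ 2 / L ^ 2 * ‖x - y‖ ^ 2 := by rw [hδ]; ring
      have h7 : δ ^ 2 * (L ^ 2 * ‖x - y‖ ^ 2) = ε ^ 2 / L ^ 2 * ‖x - y‖ ^ 2 := by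
        rw [hδ]; field_simp
      nlinarith
  refine ⟨hcon.fixedPoint _, ?_⟩
  have := hcon.fixedPoint_isFixedPt
  rw [Function.IsFixedPt, sub_eq_self] at this
  exact (smul_eq_zero.1 this).resolve_left hδ0.ne'

/-- A convergent curve whose velocity converges has limit velocity zero. -/
lemma eq_zero_of_tendsto_deriv {x v : ℝ → ℝ} {a ℓ : ℝ}
    (hd : ∀ t, 0 ≤ t → HasDerivWithinAt x (v t) (Ici 0) t)
    (hx : Tendsto x atTop (𝓝 a)) (hv : Tendsto v atTop (𝓝 ℓ)) : ℓ = 0 := by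
  have hmv : ∀ n : ℕ, ∃ ξ : ℝ, (n : ℝ) ≤ ξ ∧ v ξ = x (n + 1) - x n := by
    intro n
    have hn : (0 : ℝ) ≤ n := n.cast_nonneg
    obtain ⟨ξ, hξ, h⟩ := exists_hasDerivAt_eq_slope x v (lt_add_one (n : ℝ))
      (fun t ht => (hd t (hn.trans ht.1)).continuousWithinAt.mono fun s hs => hn.trans hs.1)
      (fun t ht => (hd t (hn.trans ht.1.le)).hasDerivAt (Ici_mem_nhds (hn.trans_lt ht.1)))
    exact ⟨ξ, hξ.1.le, by rw [h]; ring⟩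
  choose ξ hξ h using hmv
  have h1 : Tendsto (fun n => v (ξ n)) atTop (𝓝 ℓ) :=
    hv.comp (tendsto_atTop_mono hξ tendsto_natCast_atTop_atTop)
  have h2 : Tendsto (fun n : ℕ => x ((n : ℝ) + 1) - x n) atTop (𝓝 (a - a)) :=
    (hx.comp (tendsto_atTop_add_const_right _ 1 tendsto_natCast_atTop_atTop)).sub
      (hx.comp tendsto_natCast_atTop_atTop)
  rw [sub_self] at h2
  exact tendsto_nhds_unique (by simpa only [h] using h1) h2

/-- Trajectories of `x' = -(L x - L a)` converge exponentially to the equilibrium `a` if `L` is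
strongly monotone on bounded sets: the distance from `a` decreases, so the trajectory is bounded, and
then decreases exponentially. -/
lemma exists_exponential_decay {V : Type*} [Fintype V] {L : (V → ℝ) → V → ℝ}
    (hL : ∀ A : ℝ, ∃ c > 0, ∀ x y : V → ℝ, (∀ i, |x i| ≤ A) → (∀ i, |y i| ≤ A) →
      c * ∑ i, (y i - x i) ^ 2 ≤ ∑ i, (L y i - L x i) * (y i - x i))
    {x : ℝ → V → ℝ} {a : V → ℝ}
    (hx : ∀ t, 0 ≤ t → ∀ i, HasDerivWithinAt (fun s => x s i) (-(L (x t) i - L a i)) (Ici 0) t) :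
    ∃ C c : ℝ, 0 < C ∧ 0 < c ∧ ∀ t, 0 ≤ t → ∀ i, |x t i - a i| ≤ C * Real.exp (-c * t) := by
  have hφ : ∀ t, 0 ≤ t → HasDerivWithinAt (fun s => ∑ i, (x s i - a i) ^ 2)
      (-(2 * ∑ i, (L (x t) i - L a i) * (x t i - a i))) (Ici 0) t := by
    intro t ht
    refine (HasDerivWithinAt.fun_sum fun i _ =>
      ((hx t ht i).sub_const (a i)).pow 2).congr_deriv ?_
    rw [Finset.mul_sum, ← Finset.sum_neg_distrib]
    refine Finset.sum_congr rfl fun i _ => ?_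
    push_cast
    ring
  set φ : ℝ → ℝ := fun s => ∑ i, (x s i - a i) ^ 2 with hφdef
  have hφc : ContinuousOn φ (Ici 0) := fun t ht => (hφ t ht).continuousWithinAt
  have hφ0 : ∀ t, 0 ≤ φ t := fun t => Finset.sum_nonneg fun i _ => sq_nonneg _
  have hxφ : ∀ t i, |x t i - a i| ≤ √(φ t) := fun t i => by
    rw [← Real.sqrt_sq_eq_abs]
    exact Real.sqrt_le_sqrt (Finset.single_le_sum (f := fun i => (x t i - a i) ^ 2)
      (fun i _ => sq_nonneg _) (Finset.mem_univ i))
  have hint : ∀ t ∈ interior (Ici (0 : ℝ)), 0 ≤ t ∧ interior (Ici (0 : ℝ)) ⊆ Ici 0 :=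
    fun t ht => ⟨interior_subset ht, interior_subset⟩
  have hanti : AntitoneOn φ (Ici 0) := by
    refine antitoneOn_of_hasDerivWithinAt_nonpos (convex_Ici 0) hφc
      (fun t ht => (hφ t (hint t ht).1).mono (hint t ht).2) fun t ht => ?_
    have hpos : 0 ≤ ∑ i, (L (x t) i - L a i) * (x t i - a i) := by
      obtain ⟨A, hA⟩ : ∃ A, ∀ i, max |a i| |x t i| ≤ A := Finite.exists_le _
      obtain ⟨c, hc, h⟩ := hL A
      refine le_trans ?_ (h a (x t) (fun i => (le_max_left _ _).trans (hA i))
        fun i => (le_max_right _ _).trans (hA i))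
      exact mul_nonneg hc.le (hφ0 t)
    linarith
  obtain ⟨A, hA⟩ : ∃ A, ∀ i, |a i| + √(φ 0) ≤ A := Finite.exists_le _
  obtain ⟨c, hc, hmon⟩ := hL A
  have hxA : ∀ t, 0 ≤ t → ∀ i, |x t i| ≤ A := fun t ht i => by
    have h1 := (hxφ t i).trans (Real.sqrt_le_sqrt (hanti (self_mem_Ici (a := (0 : ℝ))) ht ht))
    have h2 := abs_add_le (x t i - a i) (a i)
    rw [sub_add_cancel] at h2
    linarith [hA i]
  have haA : ∀ i, |a i| ≤ A := fun i => by linarith [hA i, Real.sqrt_nonneg (φ 0)]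
  have hψ : AntitoneOn (fun t => Real.exp (2 * c * t) * φ t) (Ici 0) := by
    have hder : ∀ t, HasDerivAt (fun t => Real.exp (2 * c * t)) (Real.exp (2 * c * t) * (2 * c)) t :=
      fun t => (((hasDerivAt_id t).const_mul (2 * c)).exp).congr_deriv (by simp)
    refine antitoneOn_of_hasDerivWithinAt_nonpos (convex_Ici 0)
      ((Continuous.continuousOn (by fun_prop)).mul hφc)
      (fun t ht => ((hder t).hasDerivWithinAt).mul ((hφ t (hint t ht).1).mono (hint t ht).2))
      fun t ht => ?_
    have h1 := hmon a (x t) haA (hxA t (hint t ht).1)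
    change c * φ t ≤ _ at h1
    have h2 := Real.exp_pos (2 * c * t)
    nlinarith
  refine ⟨√(φ 0) + 1, c, by positivity, hc, fun t ht i => ?_⟩
  have h1 := hψ (self_mem_Ici (a := (0 : ℝ))) ht ht
  simp only [mul_zero, Real.exp_zero, one_mul] at h1
  have h2 : √(φ t) ≤ √(φ 0) * Real.exp (-c * t) := by
    rw [Real.sqrt_le_left (by positivity), mul_pow, Real.sq_sqrt (hφ0 0), ← Real.exp_nat_mul]
    have h3 : Real.exp ((2 : ℕ) * (-c * t)) * Real.exp (2 * c * t) = 1 := by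
      rw [← Real.exp_add]; push_cast; ring_nf; exact Real.exp_zero
    have h4 := Real.exp_pos ((2 : ℕ) * (-c * t))
    calc φ t = Real.exp ((2 : ℕ) * (-c * t)) * (Real.exp (2 * c * t) * φ t) := by
          rw [← mul_assoc, h3, one_mul]
      _ ≤ Real.exp ((2 : ℕ) * (-c * t)) * φ 0 := by gcongr
      _ = _ := mul_comm _ _
  refine (hxφ t i).trans (h2.trans ?_)
  gcongr
  linarith

/-! ### Existence of packing metrics and convergence of the flow -/

namespace PolygonalDecomposition

section

variable {S : Type*} [TopologicalSpace S] [ChartedSpace (EuclideanHalfSpace 2) S]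
  {V F : Type*} [Fintype V] [Fintype F] (D : PolygonalDecomposition S V F)

lemma exists_lipschitzWith_curvatureMap : ∃ K : NNReal, LipschitzWith K D.curvatureMap := by
  obtain ⟨K, hK, h⟩ := D.exists_abs_curvatureMap_sub_le
  lift K to NNReal using hK.le
  refine ⟨K, LipschitzWith.of_dist_le_mul fun y x => ?_⟩
  rw [dist_pi_le_iff (by positivity)]
  intro i
  rw [Real.dist_eq]
  exact h x y _ dist_nonneg (fun i => by rw [← Real.dist_eq]; exact dist_le_pi_dist y x i) i

lemma continuous_curvatureMap : Continuous D.curvatureMap :=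
  D.exists_lipschitzWith_curvatureMap.choose_spec.continuous

/-- In the coordinates `log k` the flow is the trajectory of a bounded Lipschitz vector field. -/
theorem exists_isRicciFlow (Lhat : V → ℝ) {k₀ : V → ℝ} (hk₀ : ∀ i, 0 < k₀ i) :
    ∃ k, D.IsRicciFlow Lhat k₀ k := by
  obtain ⟨K, hK⟩ := D.exists_lipschitzWith_curvatureMap
  obtain ⟨M, hM⟩ := D.exists_abs_curvatureMap_le
  have hf : LipschitzWith K fun x => Lhat - D.curvatureMap x := by
    simpa using (LipschitzWith.const Lhat).sub hK
  have hb : ∀ x, ‖Lhat - D.curvatureMap x‖ ≤ (‖Lhat‖ + |M|).toNNReal := fun x => by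
    rw [Real.coe_toNNReal _ (by positivity)]
    refine (norm_sub_le _ _).trans (add_le_add le_rfl ?_)
    exact (pi_norm_le_iff_of_nonneg (abs_nonneg M)).2 fun i => (hM x i).trans (le_abs_self M)
  obtain ⟨x, hx0, hx⟩ := exists_hasDerivAt_of_lipschitz_bounded hf hb fun i => Real.log (k₀ i)
  refine ⟨fun t i => Real.exp (x t i), ?_, fun t _ i => Real.exp_pos _, fun t _ => ?_⟩
  · funext i
    simp only [hx0]
    exact Real.exp_log (hk₀ i)
  · obtain ⟨Q⟩ := D.nonempty_packingMetric (k := fun i => Real.exp (x t i)) fun i => Real.exp_pos _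
    refine ⟨Q, fun i => ?_⟩
    rw [D.totalCurvature_eq_curvatureMap fun i => Real.exp_pos _]
    simp only [Real.log_exp]
    refine ((hasDerivAt_pi.1 (hx t) i).exp.congr_deriv ?_).hasDerivWithinAt
    simp only [Pi.sub_apply]
    ring

lemma IsRicciFlow.hasDerivWithinAt_log {D : PolygonalDecomposition S V F} {Lhat k₀ : V → ℝ}
    {k : ℝ → V → ℝ} (h : D.IsRicciFlow Lhat k₀ k) {t : ℝ} (ht : 0 ≤ t) (i : V) :
    HasDerivWithinAt (fun s => Real.log (k s i))
      (-(D.curvatureMap (fun i => Real.log (k t i)) i - Lhat i)) (Ici 0) t := by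
  obtain ⟨Q, hQ⟩ := h.ode t ht
  have hk := h.pos t ht i
  refine ((hQ i).log hk.ne').congr_deriv ?_
  rw [D.totalCurvature_eq_curvatureMap (h.pos t ht)]
  field_simp

/-- The limit of a convergent flow is an equilibrium. -/
lemma IsRicciFlow.curvatureMap_eq_of_tendsto {D : PolygonalDecomposition S V F} {Lhat k₀ : V → ℝ}
    {k : ℝ → V → ℝ} (h : D.IsRicciFlow Lhat k₀ k) {a : V → ℝ} (ha : ∀ i, 0 < a i)
    (hk : Tendsto k atTop (𝓝 a)) : D.curvatureMap (fun i => Real.log (a i)) = Lhat := by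
  have hlog : Tendsto (fun t i => Real.log (k t i)) atTop (𝓝 fun i => Real.log (a i)) :=
    tendsto_pi_nhds.2 fun i => (tendsto_pi_nhds.1 hk i).log (ha i).ne'
  funext i
  have := eq_zero_of_tendsto_deriv (fun t ht => h.hasDerivWithinAt_log ht i)
    (tendsto_pi_nhds.1 hlog i)
    (((tendsto_pi_nhds.1 ((D.continuous_curvatureMap.tendsto _).comp hlog) i).sub_const
      (Lhat i)).neg)
  linarith

end

section

variable {S : Type*} [TopologicalSpace S] [T2Space S] [CompactSpace S]
  [ChartedSpace (EuclideanHalfSpace 2) S] {V F : Type*} [Fintype V] [Fintype F]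
  (D : PolygonalDecomposition S V F)

theorem curvatureMap_injective : Function.Injective D.curvatureMap := by
  intro x y h
  obtain ⟨A, hA⟩ : ∃ A, ∀ i, max |x i| |y i| ≤ A := Finite.exists_le _
  obtain ⟨c, hc, hmon⟩ := D.exists_curvatureMap_monotone A
  have h1 := hmon x y (fun i => (le_max_left _ _).trans (hA i))
    fun i => (le_max_right _ _).trans (hA i)
  simp only [h, sub_self, zero_mul, Finset.sum_const_zero] at h1
  have h2 : ∑ i, (y i - x i) ^ 2 ≤ 0 := by
    by_contra! hlt
    linarith [mul_pos hc hlt]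
  have h3 := (Finset.sum_eq_zero_iff_of_nonneg fun i _ => sq_nonneg (y i - x i)).1
    (h2.antisymm (Finset.sum_nonneg fun i _ => sq_nonneg _))
  funext i
  have := pow_eq_zero_iff two_ne_zero |>.1 (h3 i (Finset.mem_univ i))
  linarith

/-- The perturbed equations are strongly monotone on the whole space, not only on bounded sets. -/
lemma exists_curvatureMap_add_smul_eq (Lhat : V → ℝ) {ε : ℝ} (hε : 0 < ε) :
    ∃ x : V → ℝ, ∀ i, D.curvatureMap x i + ε * x i = Lhat i := by
  obtain ⟨K, hK⟩ := D.exists_lipschitzWith_curvatureMap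
  set f : EuclideanSpace ℝ V → EuclideanSpace ℝ V := fun x =>
    WithLp.toLp 2 (fun i => D.curvatureMap x.ofLp i + ε * x i - Lhat i) with hfdef
  obtain ⟨K', hf⟩ : ∃ K', LipschitzWith K' f := by
    have h1 : LipschitzWith (K + ε.toNNReal) fun x : V → ℝ =>
        fun i => D.curvatureMap x i + ε * x i - Lhat i := by
      refine LipschitzWith.of_dist_le_mul fun x y => (dist_pi_le_iff (by positivity)).2 fun i => ?_
      have h2 := (dist_le_pi_dist (D.curvatureMap x) (D.curvatureMap y) i).trans (hK.dist_le_mul x y)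
      have h3 := mul_le_mul_of_nonneg_left (dist_le_pi_dist x y i) hε.le
      rw [Real.dist_eq] at h2 h3 ⊢
      rw [← abs_of_pos hε, ← abs_mul, abs_of_pos hε] at h3
      have h4 := abs_add_le (D.curvatureMap x i - D.curvatureMap y i) (ε * (x i - y i))
      have h5 : D.curvatureMap x i + ε * x i - Lhat i - (D.curvatureMap y i + ε * y i - Lhat i) =
          D.curvatureMap x i - D.curvatureMap y i + ε * (x i - y i) := by ring
      rw [h5, NNReal.coe_add, Real.coe_toNNReal ε hε.le, add_mul]
      exact h4.trans (add_le_add h2 h3)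
    exact ⟨_, ((PiLp.lipschitzWith_toLp 2 fun _ : V => ℝ).comp h1).comp
      (PiLp.lipschitzWith_ofLp 2 fun _ : V => ℝ)⟩
  obtain ⟨x, hx⟩ := exists_eq_zero_of_strongly_monotone hf hε fun x y => by
    have hsq : ‖x - y‖ ^ 2 = ∑ i, (x i - y i) ^ 2 := by
      rw [EuclideanSpace.real_norm_sq_eq]; rfl
    obtain ⟨A, hA⟩ : ∃ A, ∀ i, max |x i| |y i| ≤ A := Finite.exists_le _
    obtain ⟨c, hc, hmon⟩ := D.exists_curvatureMap_monotone A
    have h1 := hmon y.ofLp x.ofLp (fun i => (le_max_right _ _).trans (hA i))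
      fun i => (le_max_left _ _).trans (hA i)
    have h2 : 0 ≤ c * ∑ i, (x i - y i) ^ 2 :=
      mul_nonneg hc.le (Finset.sum_nonneg fun i _ => sq_nonneg _)
    rw [hsq, PiLp.inner_apply, Finset.mul_sum]
    have h3 : ∀ i, inner ℝ ((f x - f y) i) ((x - y) i) =
        (D.curvatureMap x.ofLp i - D.curvatureMap y.ofLp i) * (x i - y i) +
          ε * (x i - y i) ^ 2 := by
      intro i
      simp only [hfdef, PiLp.sub_apply, Real.inner_apply]
      ring
    refine le_trans ?_ (Finset.sum_congr rfl fun i _ => (h3 i).symm).le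
    rw [Finset.sum_add_distrib]
    linarith
  refine ⟨x.ofLp, fun i => ?_⟩
  have := congrArg (fun z : EuclideanSpace ℝ V => z i) hx
  simp only [hfdef, PiLp.zero_apply] at this
  linarith

/-- Admissible vectors are total curvatures: a solution is a limit of the solutions of the
perturbed equations `L(x) + ε x = L̂` as `ε → 0`, and the admissibility inequality for the set of
vertices where these are unbounded rules out that they diverge. -/
theorem exists_curvatureMap_eq {Lhat : V → ℝ} (hL : Lhat ∈ D.admissible) :
    ∃ x, D.curvatureMap x = Lhat := by
  classical
  have hsol : ∀ ε : ℝ, ∃ x : V → ℝ, 0 < ε → ∀ i, D.curvatureMap x i + ε * x i = Lhat i := fun ε =>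
    if hε : 0 < ε then (D.exists_curvatureMap_add_smul_eq Lhat hε).imp fun _ h _ => h
    else ⟨0, fun h => absurd h hε⟩
  choose x hx using hsol
  -- lower bound: at a vertex with `x i` very negative both terms on the left are too small
  obtain ⟨A, hA⟩ : ∃ A, ∀ ε, 0 < ε → ∀ i, A ≤ x ε i := by
    choose A hA using fun i => D.exists_curvatureMap_le (half_pos (hL.1 i))
    obtain ⟨A', hA'⟩ : ∃ A', ∀ i, A' ≤ min (A i) 0 := Finite.exists_ge _
    refine ⟨A', fun ε hε i => ?_⟩
    by_contra! hlt
    have h1 := hA i (x ε) i (hlt.le.trans ((hA' i).trans (min_le_left _ _)))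
    have h2 := hx ε hε i
    have h3 : x ε i ≤ 0 := hlt.le.trans ((hA' i).trans (min_le_right _ _))
    nlinarith [hL.1 i]
  set l : Ultrafilter ℝ := Ultrafilter.of (𝓝[>] (0 : ℝ))
  have hl : (l : Filter ℝ) ≤ 𝓝[>] 0 := Ultrafilter.of_le _
  have hpos : ∀ᶠ ε in (l : Filter ℝ), 0 < ε := hl eventually_mem_nhdsWithin
  have hdich : ∀ i, Tendsto (fun ε => x ε i) l atTop ∨ ∃ B, ∀ᶠ ε in (l : Filter ℝ), x ε i ≤ B := by
    intro i
    by_cases h : Tendsto (fun ε => x ε i) l atTop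
    · exact Or.inl h
    · rw [tendsto_atTop] at h
      push Not at h
      obtain ⟨B, hB⟩ := h
      exact Or.inr ⟨B, hB.mono fun ε h => h.le⟩
  -- the vertices where the solutions diverge
  set W : Finset V := Finset.univ.filter fun i => Tendsto (fun ε => x ε i) l atTop with hW
  obtain ⟨B, hB⟩ : ∃ B, ∀ i ∉ W, ∀ᶠ ε in (l : Filter ℝ), x ε i ≤ B := by
    have : ∀ i, ∃ B, i ∉ W → ∀ᶠ ε in (l : Filter ℝ), x ε i ≤ B := fun i => by
      rcases hdich i with h | ⟨B, h⟩
      · exact ⟨0, fun hi => absurd (Finset.mem_filter.2 ⟨Finset.mem_univ i, h⟩) hi⟩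
      · exact ⟨B, fun _ => h⟩
    choose B hB using this
    obtain ⟨B', hB'⟩ : ∃ B', ∀ i, B i ≤ B' := Finite.exists_le _
    exact ⟨B', fun i hi => (hB i hi).mono fun ε h => h.trans (hB' i)⟩
  have hWe : W = ∅ := by
    by_contra hne
    have hlt := hL.2 W (Finset.nonempty_iff_ne_empty.2 hne)
    obtain ⟨A', hA'⟩ := D.exists_le_sum_curvatureMap B (half_pos (sub_pos.2 hlt))
    have hbig : ∀ᶠ ε in (l : Filter ℝ), ∀ i ∈ W, max A' 0 ≤ x ε i :=
      (Finset.eventually_all W).2 fun i hi =>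
        (Finset.mem_filter.1 hi).2.eventually_ge_atTop (max A' 0)
    have hsmall : ∀ᶠ ε in (l : Filter ℝ), ∀ i ∈ Wᶜ, x ε i ≤ B :=
      (Finset.eventually_all Wᶜ).2 fun i hi => hB i (Finset.mem_compl.1 hi)
    obtain ⟨ε, hε, h1, h2⟩ := (hpos.and (hbig.and hsmall)).exists
    have h3 := hA' (x ε) W (fun i hi => (le_max_left _ _).trans (h1 i hi))
      fun i hi => h2 i (Finset.mem_compl.2 hi)
    have h4 : ∑ i ∈ W, D.curvatureMap (x ε) i ≤ ∑ i ∈ W, Lhat i := by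
      refine Finset.sum_le_sum fun i hi => ?_
      have h5 : 0 ≤ x ε i := (le_max_right _ _).trans (h1 i hi)
      have h6 := hx ε hε i
      nlinarith [mul_nonneg hε.le h5]
    linarith
  have hbdd : ∀ᶠ ε in (l : Filter ℝ), x ε ∈ Icc (fun _ => A) (fun _ => B) := by
    have : ∀ᶠ ε in (l : Filter ℝ), ∀ i, x ε i ≤ B :=
      eventually_all.2 fun i => hB i (by rw [hWe]; exact Finset.notMem_empty i)
    filter_upwards [hpos, this] with ε hε h
    exact ⟨fun i => hA ε hε i, fun i => h i⟩
  -- the solutions are bounded, so they have a limit along the ultrafilter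
  obtain ⟨a, -, ha⟩ := (isCompact_Icc (a := fun _ : V => A) (b := fun _ => B)).ultrafilter_le_nhds'
    (l.map x) hbdd
  have hxa : Tendsto x l (𝓝 a) := ha
  have hε0 : Tendsto (fun ε : ℝ => ε) l (𝓝 0) := hl.trans nhdsWithin_le_nhds
  refine ⟨a, funext fun i => ?_⟩
  have h1 : Tendsto (fun ε => D.curvatureMap (x ε) i + ε * x ε i) l
      (𝓝 (D.curvatureMap a i + 0 * a i)) :=
    (tendsto_pi_nhds.1 ((D.continuous_curvatureMap.tendsto a).comp hxa) i).add
      (hε0.mul (tendsto_pi_nhds.1 hxa i))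
  rw [zero_mul, add_zero] at h1
  exact tendsto_nhds_unique h1 (tendsto_const_nhds.congr' (hpos.mono fun ε hε => (hx ε hε i).symm))

end

end PolygonalDecomposition

/-! ### Exponential convergence of the curvatures -/

lemma abs_exp_sub_one_le_mul (d : ℝ) : |Real.exp d - 1| ≤ Real.exp |d| * |d| := by
  rcases le_total 0 d with h | h
  · rw [abs_of_nonneg h, abs_of_nonneg (by linarith [Real.one_le_exp h])]
    have h1 := Real.add_one_le_exp (-d)
    have h2 : Real.exp d * Real.exp (-d) = 1 := by rw [← Real.exp_add, add_neg_cancel, Real.exp_zero]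
    nlinarith [Real.exp_pos d]
  · rw [abs_of_nonpos h, abs_of_nonpos (by linarith [Real.exp_le_one_iff.2 h])]
    have h1 := Real.add_one_le_exp d
    have h2 := Real.one_le_exp (neg_nonneg.2 h)
    nlinarith

namespace PolygonalDecomposition

variable {S : Type*} [TopologicalSpace S] [T2Space S] [CompactSpace S]
  [ChartedSpace (EuclideanHalfSpace 2) S] {V F : Type*} [Fintype V] [Fintype F]
  {D : PolygonalDecomposition S V F}

/-- The convergence of `log k` carries over to `k`, since `log k` stays in a bounded set. -/
lemma IsRicciFlow.exists_exponential_decay {Lhat k₀ : V → ℝ} {k : ℝ → V → ℝ}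
    (h : D.IsRicciFlow Lhat k₀ k) {a : V → ℝ} (ha : D.curvatureMap a = Lhat) :
    ∃ C c : ℝ, 0 < C ∧ 0 < c ∧
      ∀ t, 0 ≤ t → ∀ i, |k t i - Real.exp (a i)| ≤ C * Real.exp (-c * t) := by
  obtain ⟨C, c, hC, hc, hdec⟩ := _root_.exists_exponential_decay D.exists_curvatureMap_monotone
    (x := fun t i => Real.log (k t i)) (a := a) fun t ht i => by
      rw [ha]; exact h.hasDerivWithinAt_log ht i
  obtain ⟨A, hA⟩ : ∃ A, ∀ i, a i ≤ A := Finite.exists_le _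
  refine ⟨Real.exp A * Real.exp C * C, c, by positivity, hc, fun t ht i => ?_⟩
  have hd := hdec t ht i
  set d := Real.log (k t i) - a i with hdd
  have hexp : Real.exp (-c * t) ≤ 1 := Real.exp_le_one_iff.2 (by nlinarith)
  have hdC : |d| ≤ C := hd.trans (mul_le_of_le_one_right hC.le hexp)
  have hk : k t i - Real.exp (a i) = Real.exp (a i) * (Real.exp d - 1) := by
    rw [mul_sub, mul_one, ← Real.exp_add, hdd, add_sub_cancel, Real.exp_log (h.pos t ht i)]
  rw [hk, abs_mul, abs_of_pos (Real.exp_pos _), mul_assoc, mul_assoc]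
  refine mul_le_mul (Real.exp_le_exp.2 (hA i)) ((abs_exp_sub_one_le_mul d).trans ?_) (abs_nonneg _)
    (Real.exp_pos _).le
  exact mul_le_mul (Real.exp_le_exp.2 hdC) hd (abs_nonneg _) (Real.exp_pos _).le

lemma IsRicciFlow.convergesInPos {Lhat k₀ : V → ℝ} {k : ℝ → V → ℝ}
    (h : D.IsRicciFlow Lhat k₀ k) {a : V → ℝ} (ha : D.curvatureMap a = Lhat) :
    ConvergesInPos k := by
  obtain ⟨C, c, -, hc, hdec⟩ := h.exists_exponential_decay ha
  refine ⟨fun i => Real.exp (a i), fun i => Real.exp_pos _, tendsto_pi_nhds.2 fun i => ?_⟩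
  rw [tendsto_iff_norm_sub_tendsto_zero]
  have hlim : Tendsto (fun t => C * Real.exp (-c * t)) atTop (𝓝 0) := by
    have := (Real.tendsto_exp_atBot.comp
      (tendsto_id.const_mul_atTop_of_neg (neg_neg_of_pos hc))).const_mul C
    simpa using this
  exact squeeze_zero' (Eventually.of_forall fun t => norm_nonneg _)
    ((eventually_ge_atTop 0).mono fun t ht => hdec t ht i) hlim

end PolygonalDecomposition

theorem theorem1p2 {S : Type*} [TopologicalSpace S] [T2Space S] [CompactSpace S]
    [ConnectedSpace S] [ChartedSpace (EuclideanHalfSpace 2) S]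
    {V F : Type*} [Fintype V] [Fintype F] (D : PolygonalDecomposition S V F)
    (Lhat k0 : V → ℝ) (hk0 : ∀ i, 0 < k0 i) :
    (∃ k : ℝ → V → ℝ, D.IsRicciFlow Lhat k0 k) ∧
    ∀ k : ℝ → V → ℝ, D.IsRicciFlow Lhat k0 k →
      (ConvergesInPos k ↔ Lhat ∈ D.admissible) ∧
      (ConvergesInPos k → ∃ kstar : V → ℝ,
        (∀ i, 0 < kstar i) ∧
        (∃ M : D.PackingMetric kstar, ∀ i, D.totalCurvature M i = Lhat i) ∧
        (∀ k' : V → ℝ, (∀ i, 0 < k' i) →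
          (∃ M : D.PackingMetric k', ∀ i, D.totalCurvature M i = Lhat i) → k' = kstar) ∧
        ∃ C c : ℝ, 0 < C ∧ 0 < c ∧
          ∀ t : ℝ, 0 ≤ t → ∀ i, |k t i - kstar i| ≤ C * Real.exp (-c * t)) := by
  refine ⟨D.exists_isRicciFlow Lhat hk0, fun k hk => ?_⟩
  have hconv : ConvergesInPos k → ∃ a, D.curvatureMap a = Lhat := fun ⟨b, hb, hkb⟩ =>
    ⟨_, hk.curvatureMap_eq_of_tendsto hb hkb⟩
  refine ⟨⟨fun h => ?_, fun h => ?_⟩, fun h => ?_⟩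
  · obtain ⟨a, ha⟩ := hconv h
    exact ha ▸ D.curvatureMap_mem_admissible a
  · obtain ⟨a, ha⟩ := D.exists_curvatureMap_eq h
    exact hk.convergesInPos ha
  · obtain ⟨a, ha⟩ := hconv h
    have hpos : ∀ i, 0 < Real.exp (a i) := fun i => Real.exp_pos _
    refine ⟨fun i => Real.exp (a i), hpos, ?_, ?_, hk.exists_exponential_decay ha⟩
    · obtain ⟨M⟩ := D.nonempty_packingMetric hpos
      refine ⟨M, fun i => ?_⟩
      rw [D.totalCurvature_eq_curvatureMap hpos]
      simp only [Real.log_exp]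
      rw [ha]
    · rintro k' hk' ⟨M, hM⟩
      have h1 : D.curvatureMap (fun i => Real.log (k' i)) = D.curvatureMap a := by
        rw [ha, ← D.totalCurvature_eq_curvatureMap hk' M]
        exact funext hM
      funext i
      rw [← congrFun (D.curvatureMap_injective h1) i, Real.exp_log (hk' i)]
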